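/- Let $$K=\langle a,b,r,t,x,z \mid xaxa=t,\ bxbx=t,\ bbtaa=t,\ a^{-1}br=ra^{-1}b,\ zt=tz,\ btaz=zbta\rangle ,$$ $$G=\langle u,v,b,r \mid u^2=v^2,\ bvbu=b^{-1}ub^{-1}v,\ u^{-1}b^{-1}vbr=ru^{-1}b^{-1}vb\rangle ,$$ and let $H=\langle u^2,\,bvbu\rangle\le G$. Definitions. For a finite generating family $X$ of a group $\Gamma$ let $A=X\cup X^{-1}$ and $A'=A\cup\{\$\}$, where $\$$ is an extra symbol that maps to $1$. For a word $w\in A^*$, $w(t)$ is its prefix of length $t$ (and $w(t)=w$ for $t\ge l(w)$), and $l_A$ is the word length in $\Gamma$ over $A$. *Asynchronously automatic.* $\Gamma$ is asynchronously automatic if for some finite generating family $X$ there are a regular language $L\subseteq A^*$ mapping onto $\Gamma$ and, for each $a\in A'$, a finite deterministic asynchronous two-tape automaton (in each transition it reads one symbol from one of its two tapes, the tape being determined by the state; each tape carries a word followed by an end marker; when one tape is exhausted the other is read) which accepts a pair $(w,y)$ of words in $A^*$ if and only if $w,y\in L$ and $wa=_\Gamma y$. *Strong automatic coset systems.* An automatic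 coset system for $(\Gamma,\Delta)$, where $\Delta\le\Gamma$, is given by a regular language $L\subseteq A^*$ (the language of the coset word-acceptor) containing at least one word in each right coset $\Delta g$, such that for each $a\in A'$ there is a finite automaton accepting exactly the padded pairs $(w^+,y^+)$ with $w,y\in L$ and $\Delta wa=\Delta y$. It is strong if there is a constant $k$ such that $l_A\bigl(w(t)^{-1}\,h\,y(t)\bigr)\le k$ for all $t\ge 0$ whenever $w,y\in L$, $a\in A$, $h\in\Delta$ and $wa=_\Gamma hy$. A finite generating set $Y$ of $\Delta$ is efficient with respect to it if, with $B=Y\cup Y^{-1}$, for all $w,y\in L$, $b\in B$, $h\in\Delta$ with $wb=_\Gamma hy$, either $h=1$ or $h\in B$. Then the following hold. 1. $K$ is the HNN extension of $G$ along $H$ in which the stable letter centralises $H$: there is an isomorphism from $K$ onto $\langle G, z\mid zh=hz\ (h\in H)\rangle$ that sends $xa\mapsto u$, $bx\mapsto v$, $b\mapsto b$, $r\mapsto r$, $z\mapsto z$. 2. $H$ is free of rank $2$. 3. $G$ is strongly coset automatic with respect to $H$, and $Y=\{u^2,\,bvbu^{-1}\}$ is an efficient generating set of $H$: there is a strong automatic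 coset system for $(G,H)$ over the generators $u,v,b,r$ with respect to which $Y$ is efficient. 4. $K$ is asynchronously automatic. -/

import Mathlib

open scoped Pointwise

namespace AutGroup

/-! ### Words over a generating family

For a family `x : ι → G`, the alphabet `A = X ∪ X⁻¹` is `ι × Bool`: the letter `(i, true)` stands
for `x i`, and `(i, false)` for its inverse.  The alphabet `A' = A ∪ {$}` is `Option (ι × Bool)`,
with `none` for the symbol `$`. -/

/-- The alphabet `A` of letters and inverse letters. -/
abbrev Letter (ι : Type) : Type := ι × Bool

/-- The group element that a letter stands for. -/
def letterVal {ι G : Type} [Group G] (x : ι → G) : Letter ι → G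
  | (i, true) => x i
  | (i, false) => (x i)⁻¹

/-- The group element that a symbol of `A'` stands for; `$` stands for the identity. -/
def symbolVal {ι G : Type} [Group G] (x : ι → G) : Option (Letter ι) → G
  | none => 1
  | some a => letterVal x a

/-- The group element onto which a word maps. -/
def wordVal {ι G : Type} [Group G] (x : ι → G) (w : List (Letter ι)) : G :=
  (w.map (letterVal x)).prod

/-- The family `x` generates `G`. -/
def Generates {ι G : Type} [Group G] (x : ι → G) : Prop :=
  Subgroup.closure (Set.range x) = ⊤

/-- The length of `g` over the alphabet `A` is at most `k`. -/
def LengthLE {ι G : Type} [Group G] (x : ι → G) (g : G) (k : ℕ) : Prop :=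
  ∃ p : List (Letter ι), p.length ≤ k ∧ wordVal x p = g

/-! ### Asynchronous two-tape automata -/

/-- The two input tapes. -/
inductive Side : Type
  | left
  | right

/-- A deterministic asynchronous two-tape automaton over the alphabet `α` with state set `σ`.
In each transition it reads one symbol from one tape, and the state determines which tape.
The symbol is a letter `some a`, or the end marker `none` that closes each tape. -/
structure AsyncDFA (α σ : Type) where
  /-- The tape from which a state reads. -/
  side : σ → Side
  /-- The transition function. -/
  step : σ → Option α → σ
  /-- The start state. -/
  start : σ
  /-- The accept states. -/
  accept : Set σ

/-- The state that is reached from the state `s` after reading the contents `p` of the left tape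
and `q` of the right tape.  When one tape is exhausted, the other one is read. -/
def AsyncDFA.evalFrom {α σ : Type} (M : AsyncDFA α σ) :
    σ → List (Option α) → List (Option α) → σ
  | s, [], [] => s
  | s, c :: p, [] => M.evalFrom (M.step s c) p []
  | s, [], d :: q => M.evalFrom (M.step s d) [] q
  | s, c :: p, d :: q =>
    match M.side s with
    | .left => M.evalFrom (M.step s c) p (d :: q)
    | .right => M.evalFrom (M.step s d) (c :: p) q
termination_by _ p q => p.length + q.length

/-- The contents of a tape that carries the word `w`: the word followed by the end marker. -/
def tape {α : Type} (w : List α) : List (Option α) := w.map some ++ [none]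

/-- The automaton accepts the pair of words `(w, y)`. -/
def AsyncDFA.Accepts {α σ : Type} (M : AsyncDFA α σ) (w y : List α) : Prop :=
  M.evalFrom M.start (tape w) (tape y) ∈ M.accept

/-- `G` has an asynchronously automatic structure over the finite generating family `x`:
a word-acceptor with language `L`, and for each symbol `a` of `A'` an asynchronous multiplier
automaton that accepts exactly the pairs `(w, y)` with `w, y ∈ L` and `w a =_G y`. -/
def IsAsynchronouslyAutomaticWith {ι G : Type} [Group G] (x : ι → G) : Prop :=
  ∃ L : Language (Letter ι), L.IsRegular ∧
    (∀ g : G, ∃ w ∈ L, wordVal x w = g) ∧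
    ∀ a : Option (Letter ι), ∃ (σ : Type) (_ : Fintype σ) (M : AsyncDFA (Letter ι) σ),
      ∀ w y : List (Letter ι),
        M.Accepts w y ↔ w ∈ L ∧ y ∈ L ∧ wordVal x w * symbolVal x a = wordVal x y

/-- `G` is asynchronously automatic, with respect to some finite generating family. -/
def IsAsynchronouslyAutomatic (G : Type) [Group G] : Prop :=
  ∃ (n : ℕ) (x : Fin n → G), Generates x ∧ IsAsynchronouslyAutomaticWith x

/-! ### Automatic coset systems -/

/-- The padded pair of two words: the shorter one is extended by symbols `$` at its end. -/
def paddedPair {α : Type} : List α → List α → List (Option α × Option α)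
  | [], [] => []
  | a :: w, [] => (some a, none) :: paddedPair w []
  | [], b :: y => (none, some b) :: paddedPair [] y
  | a :: w, b :: y => (some a, some b) :: paddedPair w y

/-- `L` is the language of the coset word-acceptor of an automatic coset system for `(G, H)` over
the generating family `x`: it is regular, it meets every right coset `H g`, and for each symbol `a`
of `A'` there is a finite automaton that accepts exactly the padded pairs of words `w, y ∈ L`
with `H w a = H y`. -/
def IsAutomaticCosetSystem {ι G : Type} [Group G] (x : ι → G) (H : Subgroup G)
    (L : Language (Letter ι)) : Prop :=
  L.IsRegular ∧
    (∀ g : G, ∃ w ∈ L, wordVal x w ∈ MulOpposite.op g • (H : Set G)) ∧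
    ∀ a : Option (Letter ι),
      ∃ (σ : Type) (_ : Fintype σ) (M : DFA (Option (Letter ι) × Option (Letter ι)) σ),
        M.accepts = {p | ∃ w ∈ L, ∃ y ∈ L, p = paddedPair w y ∧
          MulOpposite.op (wordVal x w * symbolVal x a) • (H : Set G) =
            MulOpposite.op (wordVal x y) • (H : Set G)}

/-- The system is strong: there is a bound `k` such that, whenever `w, y ∈ L`, `a ∈ A` and `h ∈ H`
satisfy `w a =_G h y`, the elements `w(t)⁻¹ h y(t)` have length at most `k` for all `t`, where
`w(t)` is the prefix of `w` of length `t` (and `w` itself if `t` exceeds the length of `w`). -/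
def IsStrongAutomaticCosetSystem {ι G : Type} [Group G] (x : ι → G) (H : Subgroup G)
    (L : Language (Letter ι)) : Prop :=
  IsAutomaticCosetSystem x H L ∧
    ∃ k : ℕ, ∀ w ∈ L, ∀ y ∈ L, ∀ a : Letter ι, ∀ h ∈ H,
      wordVal x w * letterVal x a = h * wordVal x y →
        ∀ t : ℕ, LengthLE x ((wordVal x (w.take t))⁻¹ * h * wordVal x (y.take t)) k

/-- `Y` is an efficient generating set of `H` with respect to the coset system with word-acceptor
language `L`: it is a finite generating set of `H` and, with `B = Y ∪ Y⁻¹`, whenever `w, y ∈ L`,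
`b ∈ B` and `h ∈ H` satisfy `w b =_G h y`, either `h = 1` or `h ∈ B`. -/
def IsEfficient {ι G : Type} [Group G] (x : ι → G) (H : Subgroup G) (L : Language (Letter ι))
    (Y : Set G) : Prop :=
  Y.Finite ∧ Subgroup.closure Y = H ∧
    ∀ w ∈ L, ∀ y ∈ L, ∀ b ∈ Y ∪ Y⁻¹, ∀ h ∈ H,
      wordVal x w * b = h * wordVal x y → h = 1 ∨ h ∈ Y ∪ Y⁻¹

end AutGroup

namespace Sapir

/-! ### Sapir's group `K` -/

/-- The six generators of `K`. -/
inductive KGen : Type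
  | a | b | r | t | x | z

/-- The relators of `K`: a relation `p = q` is written as `p * q⁻¹`. -/
def kRels : Set (FreeGroup KGen) :=
  let a := FreeGroup.of KGen.a
  let b := FreeGroup.of KGen.b
  let r := FreeGroup.of KGen.r
  let t := FreeGroup.of KGen.t
  let x := FreeGroup.of KGen.x
  let z := FreeGroup.of KGen.z
  {(x * a * x * a) * t⁻¹,
   (b * x * b * x) * t⁻¹,
   (b * b * t * a * a) * t⁻¹,
   (a⁻¹ * b * r) * (r * a⁻¹ * b)⁻¹,
   (z * t) * (t * z)⁻¹,
   (b * t * a * z) * (z * b * t * a)⁻¹}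

/-- `K = ⟨a, b, r, t, x, z | xaxa = t, bxbx = t, bbtaa = t, a⁻¹br = ra⁻¹b, zt = tz, btaz = zbta⟩`. -/
abbrev K : Type := PresentedGroup kRels

/-- The generators as elements of `K`. -/
def kGen (i : KGen) : K := PresentedGroup.of i

/-! ### The base group `G` and its subgroup `H` -/

/-- The four generators of `G`. -/
inductive GGen : Type
  | u | v | b | r

/-- The relators of `G`. -/
def gRels : Set (FreeGroup GGen) :=
  let u := FreeGroup.of GGen.u
  let v := FreeGroup.of GGen.v
  let b := FreeGroup.of GGen.b
  let r := FreeGroup.of GGen.r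
  {u ^ 2 * (v ^ 2)⁻¹,
   (b * v * b * u) * (b⁻¹ * u * b⁻¹ * v)⁻¹,
   (u⁻¹ * b⁻¹ * v * b * r) * (r * u⁻¹ * b⁻¹ * v * b)⁻¹}

/-- `G = ⟨u, v, b, r | u² = v², bvbu = b⁻¹ub⁻¹v, u⁻¹b⁻¹vbr = ru⁻¹b⁻¹vb⟩`. -/
abbrev G : Type := PresentedGroup gRels

/-- The generators as elements of `G`. -/
def gGen (i : GGen) : G := PresentedGroup.of i

/-- The subgroup `H = ⟨u², bvbu⟩` of `G`. -/
def H : Subgroup G :=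
  Subgroup.closure {gGen .u ^ 2, gGen .b * gGen .v * gGen .b * gGen .u}

/-- The set `Y = {u², bvbu⁻¹}`. -/
def Y : Set G :=
  {gGen .u ^ 2, gGen .b * gGen .v * gGen .b * (gGen .u)⁻¹}

end Sapir

/-! `G` is the fundamental group of a square complex with one vertex. Its edges are `u`, `v`, `b`,
`s = vbu⁻¹`, `uru⁻¹` and `q = b(uru⁻¹)b⁻¹`; its squares read `uu = vv`, `vb = su`, `ssbb = 1`, and
two squares saying that conjugation of `uru⁻¹` by `b` and by `s` gives `q`. Its link has no
triangles, so the complex is nonpositively curved. Both elements of `Y` are diagonals of squares,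
`u²` and `bs = bvbu⁻¹`. The picture is that the translates of these diagonals in the universal cover
form a convex tree on which `H` acts, and that a right coset of `H` is a vertex of the quotient by
`H`.

Cosets are represented by normal cube paths (in the sense of Niblo and Reeves) that leave this tree.
`Data.act` continues such a path by an edge: the edge is appended, or cancelled, or pushed back
along a strip of squares. By `act_inv` and `act_square` this defines an action of `G`; `H` fixes the
constant path, so normal paths in one coset coincide (`IsAction.eq_of_mul_eq`). `adjacent_act` shows
that the old and the new path fellow travel and that the coset changes by a factor in `Y ∪ Y⁻¹ ∪
{1}`. By `exists_cocycle_square` the same correction set suffices for a whole diagonal, which is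
efficiency. Bounded differences are recognized by finite automata, so this gives the strong coset
system.

Freeness of `H` comes from an explicit action of `G` on four copies of the free group, in which `Y`
acts on one copy as left translation by the basis. The isomorphism with the HNN extension is the
substitution `t = u²`, `x = b⁻¹v`, `a = v⁻¹bu`, under which `bta = bvbu`.

Elements of `K` have normal forms `w₀ z^e₁ w₁ z^e₂ w₂ ⋯`, where `w₀` represents an element of `G` (a
reduced word over `Y` and a coset representative) and the other `wᵢ` are coset representatives.
Right multiplication by `g` turns the last `w` into `h y` with `h ∈ H`; since `z` centralizes `H`,
`h` passes to the preceding syllable, and so on. Efficiency keeps all these `h` in one finite set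
(`exists_tail_mul`). Hence corresponding syllables fellow travel, although their lengths may differ,
and an automaton that waits at each `z` for the other tape compares the two normal forms. -/

namespace SquareComplex

/-! ### Square complexes with one vertex, and cube paths that leave a fixed subcomplex

A nonpositively curved square complex with one vertex is encoded by its oriented edges `D` and by
the corners of its squares.  `adj a b` says that the edges `a`, `b` leaving a vertex span a square,
and `tr a b` is the edge opposite to `b` in that square, so that `a * tr a b = b * tr b a` in the
fundamental group.  The data `entering`, `flip` and `diag` describe a tree of diagonals of squares,
on which a subgroup `H` of the fundamental group acts: the ends of the diagonals at the base vertex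
are spanned by pairs of `entering` edges, their beginnings by the pairs `diag`. -/

/-- A square complex with one vertex and a system of diagonals. -/
structure Data (D : Type) where
  /-- The inverse edge. -/
  inv : D → D
  /-- Two edges span a square. -/
  adj : D → D → Bool
  /-- The edge `tr a b` is opposite to `b` in the square that is spanned by `a` and `b`. -/
  tr : D → D → D
  /-- A linear preorder, used to choose one of the two paths across a square. -/
  key : D → ℕ
  /-- Edges that span a square whose diagonal towards the vertex is distinguished. -/
  entering : D → Bool
  /-- The edge in the same coset as an entering edge. -/
  flip : D → D
  /-- Edges that span a square whose diagonal away from the vertex is distinguished. -/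
  diag : D → D → Bool
  inv_inv : ∀ a, inv (inv a) = a
  adj_symm : ∀ a b, adj a b → adj b a
  key_inj : ∀ a b, key a = key b → a = b
  adj_tr : ∀ a b, adj a b → adj (inv a) (tr a b)
  tr_tr : ∀ a b, adj a b → tr (inv a) (tr a b) = b
  tr_tr_inv : ∀ a b, adj a b → tr (tr a b) (inv a) = inv (tr b a)
  no_triangle : ∀ a b c, adj a b → adj b c → ¬ adj a c
  entering_adj : ∀ a b, entering a → entering b → adj a b → tr a b = inv (flip a)
  entering_flip : ∀ a, entering a → adj (inv a) (inv (flip a)) ∧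
    entering (tr (inv a) (inv (flip a))) ∧ ¬ entering (flip a)
  adj_flip : ∀ a, entering a → adj (inv (flip a)) (inv a) ∧
    diag (flip a) (tr (inv (flip a)) (inv a))
  diag_symm : ∀ a b, diag a b → diag b a
  diag_adj : ∀ a b, diag a b → adj a b ∧ ¬ entering a ∧ entering (inv (tr a b)) ∧
    flip (inv (tr a b)) = a

/-- A cube of a cube path: an edge, or a square spanned by two edges. -/
inductive Cube (D : Type) : Type
  | edge (a : D)
  | square (a b : D)

open SquareComplex.Cube

variable {D : Type}

namespace Data

variable {S : Data D}

/-! ### Corners of a square. -/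

lemma adj_irrefl (a : D) : ¬ S.adj a a := fun h => S.no_triangle a a a h h h

lemma adj_ne {a b : D} (h : S.adj a b) : a ≠ b := by
  rintro rfl; exact adj_irrefl a h

lemma tr_injective {a b c : D} (hb : S.adj a b) (hc : S.adj a c) (h : S.tr a b = S.tr a c) :
    b = c := by
  rw [← S.tr_tr a b hb, h, S.tr_tr a c hc]

lemma tr_inv_tr {a e : D} (h : S.adj (S.inv a) e) : S.tr a (S.tr (S.inv a) e) = e := by
  simpa [S.inv_inv] using S.tr_tr _ _ h

lemma adj_tr_inv {a e : D} (h : S.adj (S.inv a) e) : S.adj a (S.tr (S.inv a) e) := by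
  simpa [S.inv_inv] using S.adj_tr _ _ h

/-- The square axioms carry a corner to the next one; applied twice they reach the corner opposite
to the start. -/
lemma adj_far {a b : D} (h : S.adj a b) : S.adj (S.inv (S.tr a b)) (S.inv (S.tr b a)) := by
  have := S.adj_tr _ _ (S.adj_symm _ _ (S.adj_tr _ _ h))
  rwa [S.tr_tr_inv _ _ h] at this

lemma tr_far {a b : D} (h : S.adj a b) :
    S.tr (S.inv (S.tr a b)) (S.inv (S.tr b a)) = S.inv a := by
  have := S.tr_tr _ _ (S.adj_symm _ _ (S.adj_tr _ _ h))
  rwa [S.tr_tr_inv _ _ h] at this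

variable (S)

/-- The edge `e` continues the cube path `w` (last cube first) to a normal cube path. -/
def Fresh : List (Cube D) → D → Prop
  | [], e => ¬ S.entering e
  | edge a :: _, e => e ≠ S.inv a ∧ ¬ S.adj (S.inv a) e
  | square a b :: _, e => e ≠ S.inv (S.tr a b) ∧ e ≠ S.inv (S.tr b a)

/-- Normal cube paths, last cube first. -/
def Normal : List (Cube D) → Prop
  | [] => True
  | edge a :: w => Normal w ∧ S.Fresh w a
  | square a b :: w => Normal w ∧ S.Fresh w a ∧ S.Fresh w b ∧ S.adj a b ∧ S.key a < S.key b ∧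
      (w = [] → ¬ S.diag a b)

/-- Continue a cube path by the square that is spanned by `a` and `b`. -/
def addSq (w : List (Cube D)) (a b : D) : List (Cube D) :=
  if w = [] ∧ S.diag a b then [] else if S.key a < S.key b then square a b :: w else square b a :: w

variable {S}

lemma addSq_comm (w : List (Cube D)) {a b : D} (h : S.adj a b) :
    S.addSq w a b = S.addSq w b a := by
  have h1 : S.diag a b = S.diag b a := by
    rw [Bool.eq_iff_iff]; exact ⟨S.diag_symm a b, S.diag_symm b a⟩
  have h2 : S.key a ≠ S.key b := fun e => adj_ne h (S.key_inj a b e)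
  unfold addSq
  rw [h1]
  split_ifs <;> first | rfl | omega

lemma normal_addSq {w : List (Cube D)} (hw : S.Normal w) {a b : D} (h : S.adj a b)
    (ha : S.Fresh w a) (hb : S.Fresh w b) : S.Normal (S.addSq w a b) := by
  have h2 : S.key a ≠ S.key b := fun e => adj_ne h (S.key_inj a b e)
  unfold addSq
  split_ifs with h3 h4
  · trivial
  · exact ⟨hw, ha, hb, h, h4, fun h5 h6 => h3 ⟨h5, h6⟩⟩
  · exact ⟨hw, hb, ha, S.adj_symm _ _ h, by omega, fun h5 h6 => h3 ⟨h5, S.diag_symm _ _ h6⟩⟩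

/-! ### Continuing a normal cube path by an edge. -/

variable [DecidableEq D] (S)

instance : ∀ w e, Decidable (S.Fresh w e)
  | [], _ => inferInstanceAs (Decidable (¬ _))
  | edge _ :: _, _ => inferInstanceAs (Decidable (_ ∧ _))
  | square _ _ :: _, _ => inferInstanceAs (Decidable (_ ∧ _))

/-- The normal cube path to the end of the edge `e` that leaves the end of `w`. -/
def act : List (Cube D) → D → List (Cube D)
  | [], e => if S.entering e then [edge (S.flip e)] else [edge e]
  | edge a :: w, e =>
    if e = S.inv a then w
    else if S.adj (S.inv a) e then
      if S.Fresh w (S.tr (S.inv a) e) then S.addSq w (S.tr (S.inv a) e) a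
      else edge (S.tr (S.tr (S.inv a) e) a) :: act w (S.tr (S.inv a) e)
    else edge e :: edge a :: w
  | square a b :: w, e =>
    if e = S.inv (S.tr a b) then edge a :: w
    else if e = S.inv (S.tr b a) then edge b :: w
    else edge e :: square a b :: w

variable {S}

lemma act_of_fresh {w : List (Cube D)} {e : D} (h : S.Fresh w e) :
    S.act w e = edge e :: w := by
  match w with
  | [] => simp only [Fresh] at h; simp [act, h]
  | edge a :: w => simp only [Fresh] at h; simp [act, h]
  | square a b :: w => simp only [Fresh] at h; simp [act, h]

lemma act_edge_inv (a : D) (w : List (Cube D)) : S.act (edge a :: w) (S.inv a) = w := by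
  simp [act]

lemma act_edge_adj_fresh {a e : D} {w : List (Cube D)} (h : S.adj a e) (hf : S.Fresh w e) :
    S.act (edge a :: w) (S.tr a e) = S.addSq w e a := by
  have h1 := S.adj_tr _ _ h
  rw [act, if_neg (adj_ne h1).symm, if_pos h1, S.tr_tr _ _ h, if_pos hf]

lemma act_edge_adj_not_fresh {a e : D} {w : List (Cube D)} (h : S.adj a e)
    (hf : ¬ S.Fresh w e) :
    S.act (edge a :: w) (S.tr a e) = edge (S.tr e a) :: S.act w e := by
  have h1 := S.adj_tr _ _ h
  rw [act, if_neg (adj_ne h1).symm, if_pos h1, S.tr_tr _ _ h, if_neg hf]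

lemma act_square_left (a b : D) (w : List (Cube D)) :
    S.act (square a b :: w) (S.inv (S.tr a b)) = edge a :: w := by
  simp [act]

lemma act_square_right {a b : D} (h : S.adj a b) (w : List (Cube D)) :
    S.act (square a b :: w) (S.inv (S.tr b a)) = edge b :: w := by
  have := adj_ne (adj_far h)
  simp [act, this.symm]

/-- Going back along an edge from the end of a square over a fresh corner. -/
lemma act_addSq {w : List (Cube D)} {a b : D} (h : S.adj a b) (ha : S.Fresh w a) :
    S.act (S.addSq w a b) (S.inv (S.tr a b)) = edge a :: w := by
  unfold addSq
  split_ifs with h1 h2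
  · obtain ⟨rfl, h1⟩ := h1
    obtain ⟨-, -, h3, h4⟩ := S.diag_adj _ _ h1
    simp [act, h3, h4]
  · exact act_square_left _ _ _
  · exact act_square_right (S.adj_symm _ _ h) _

/-- The ways in which an edge can fail to be fresh. -/
lemma not_fresh_cases {w : List (Cube D)} {e : D} (h : ¬ S.Fresh w e) :
    (w = [] ∧ S.entering e) ∨
    (∃ a w', w = edge a :: w' ∧ e = S.inv a) ∨
    (∃ a w' e', w = edge a :: w' ∧ S.adj a e' ∧ e = S.tr a e') ∨
    (∃ a b w', w = square a b :: w' ∧ (e = S.inv (S.tr a b) ∨ e = S.inv (S.tr b a))) := by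
  match w with
  | [] => left; simpa [Fresh] using h
  | edge a :: w =>
    right
    by_cases he : e = S.inv a
    · exact Or.inl ⟨a, w, rfl, he⟩
    · right; left
      have h2 : S.adj (S.inv a) e := by
        by_contra h3; exact h ⟨he, h3⟩
      exact ⟨a, w, _, rfl, adj_tr_inv h2, (tr_inv_tr h2).symm⟩
  | square a b :: w =>
    right; right; right
    refine ⟨a, b, w, rfl, ?_⟩
    by_contra h3
    push Not at h3
    exact h h3

/-- A fresh edge stays fresh after it is transported along an edge that is not fresh. -/
lemma fresh_act {w : List (Cube D)} (hw : S.Normal w) {a b : D} (h : S.adj a b)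
    (ha : S.Fresh w a) (hb : ¬ S.Fresh w b) : S.Fresh (S.act w b) (S.tr b a) := by
  have hba := S.adj_symm _ _ h
  have h1 := S.adj_tr _ _ hba
  -- a criterion for the case that the new last cube is an edge
  have key : ∀ k w', S.adj (S.inv b) k → S.tr b a ≠ k → S.Fresh (edge (S.inv k) :: w') (S.tr b a) := by
    intro k w' hk hne
    refine ⟨by rwa [S.inv_inv], ?_⟩
    rw [S.inv_inv]
    exact fun h2 => S.no_triangle _ _ _ hk h2 h1
  rcases not_fresh_cases hb with ⟨rfl, hb⟩ | ⟨c, w', rfl, rfl⟩ | ⟨c, w', e', rfl, hc, rfl⟩ |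
    ⟨c, d, w', rfl, hcd⟩
  · replace hb : S.entering b := by simpa [Fresh] using hb
    obtain ⟨h2, h3, -⟩ := S.entering_flip _ hb
    -- The new path is the edge `flip b`. If `a` were transported to `(flip b)⁻¹`, then transporting
    -- back would show that `a` is entering, against its freshness.
    have := key (S.inv (S.flip b)) [] h2 (by
      intro h4
      rw [← h4, S.tr_tr _ _ hba] at h3
      exact ha h3)
    simpa [act, hb, S.inv_inv] using this
  · exact absurd hba ha.2
  · have hne : S.tr (S.tr c e') a ≠ S.tr (S.tr c e') (S.inv c) := fun h4 =>
      ha.1 (tr_injective hba (S.adj_symm _ _ (S.adj_tr _ _ hc)) h4)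
    have hk : S.adj (S.inv (S.tr c e')) (S.tr (S.tr c e') (S.inv c)) :=
      S.adj_tr _ _ (S.adj_symm _ _ (S.adj_tr _ _ hc))
    by_cases hf : S.Fresh w' e'
    · rw [act_edge_adj_fresh hc hf]
      unfold addSq
      rw [S.tr_tr_inv _ _ hc] at hne
      have hne2 : S.tr (S.tr c e') a ≠ S.inv (S.tr c e') := (adj_ne h1).symm
      split_ifs with h5 h6
      -- The square is distinguished and the path collapses to the constant one. If the transported
      -- edge were entering, it would span a square with the entering edge `b⁻¹`; the opposite side
      -- there is `c⁻¹`, which forces `a = c⁻¹`.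
      · obtain ⟨rfl, h5⟩ := h5
        intro hn
        have h5' := S.diag_symm _ _ h5
        obtain ⟨-, -, h7, h8⟩ := S.diag_adj _ _ h5'
        have h9 := S.entering_adj _ _ h7 hn h1
        rw [S.tr_tr _ _ hba, h8] at h9
        exact ha.1 h9
      · exact ⟨hne, hne2⟩
      · exact ⟨hne2, hne⟩
    · rw [act_edge_adj_not_fresh hc hf]
      have := key _ (S.act w' e') hk hne
      rwa [S.tr_tr_inv _ _ hc, S.inv_inv] at this
  · have hcd' : S.adj c d := hw.2.2.2.1
    rcases hcd with rfl | rfl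
    · rw [act_square_left]
      have := key (S.inv c) w' (by
        have := S.adj_tr _ _ (adj_far hcd')
        rwa [tr_far hcd'] at this) (by
        intro h4
        rw [← tr_far hcd'] at h4
        exact ha.2 (tr_injective hba (adj_far hcd') h4))
      rwa [S.inv_inv] at this
    · rw [act_square_right hcd']
      have hdc := S.adj_symm _ _ hcd'
      have := key (S.inv d) w' (by
        have := S.adj_tr _ _ (adj_far hdc)
        rwa [tr_far hdc] at this) (by
        intro h4
        rw [← tr_far hdc] at h4
        exact ha.1 (tr_injective hba (adj_far hdc) h4))
      rwa [S.inv_inv] at this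

/-- The only delicate case is the push back across a square, where `fresh_act` says that the
parallel copy of the last edge is still fresh. -/
lemma normal_act : ∀ {w : List (Cube D)}, S.Normal w → ∀ e, S.Normal (S.act w e)
  | w, hw, e => by
    by_cases hf : S.Fresh w e
    · rw [act_of_fresh hf]; exact ⟨hw, hf⟩
    rcases not_fresh_cases hf with ⟨rfl, hb⟩ | ⟨c, w', rfl, rfl⟩ | ⟨c, w', e', rfl, hc, rfl⟩ |
      ⟨c, d, w', rfl, rfl | rfl⟩
    · simp only [act, hb, if_true]
      exact ⟨trivial, (S.entering_flip _ hb).2.2⟩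
    · rw [act_edge_inv]; exact hw.1
    · by_cases hf' : S.Fresh w' e'
      · rw [act_edge_adj_fresh hc hf']
        exact normal_addSq hw.1 (S.adj_symm _ _ hc) hf' hw.2
      · rw [act_edge_adj_not_fresh hc hf']
        exact ⟨normal_act hw.1 e', fresh_act hw.1 hc hw.2 hf'⟩
    · rw [act_square_left]; exact ⟨hw.1, hw.2.1⟩
    · rw [act_square_right hw.2.2.2.1]; exact ⟨hw.1, hw.2.2.1⟩
  termination_by w => w.length

/-- Going back along an edge that was not fresh and did not shorten the path is not fresh. -/
lemma not_fresh_act_inv {w : List (Cube D)} {e : D} (hw : S.Normal w) (hf : ¬ S.Fresh w e)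
    (hne : ∀ a w', w = edge a :: w' → e ≠ S.inv a) : ¬ S.Fresh (S.act w e) (S.inv e) := by
  rcases not_fresh_cases hf with ⟨rfl, hb⟩ | ⟨c, w', rfl, rfl⟩ | ⟨c, w', e', rfl, hc, rfl⟩ |
      ⟨c, d, w', rfl, rfl | rfl⟩
  · simp only [act, hb, if_true]
    exact fun h => h.2 (S.adj_flip _ hb).1
  · exact absurd rfl (hne _ _ rfl)
  · by_cases hf' : S.Fresh w' e'
    · rw [act_edge_adj_fresh hc hf']
      unfold addSq
      split_ifs with h5 h6
      · obtain ⟨rfl, h5⟩ := h5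
        exact fun h => h (S.diag_adj _ _ (S.diag_symm _ _ h5)).2.2.1
      · exact fun h => h.2 rfl
      · exact fun h => h.1 rfl
    · rw [act_edge_adj_not_fresh hc hf']
      exact fun h => h.2 (adj_far (S.adj_symm _ _ hc))
  · rw [act_square_left, S.inv_inv]
    exact fun h => h.2 (S.adj_tr _ _ hw.2.2.2.1)
  · rw [act_square_right hw.2.2.2.1, S.inv_inv]
    exact fun h => h.2 (S.adj_tr _ _ (S.adj_symm _ _ hw.2.2.2.1))

/-- Makes each edge a permutation of the normal paths. A push back across a strip of squares is
undone by pushing back across the same strip from its other side. -/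
lemma act_inv : ∀ {w : List (Cube D)}, S.Normal w → ∀ e, S.act (S.act w e) (S.inv e) = w
  | w, hw, e => by
    by_cases hf : S.Fresh w e
    · rw [act_of_fresh hf, act_edge_inv]
    rcases not_fresh_cases hf with ⟨rfl, hb⟩ | ⟨c, w', rfl, rfl⟩ | ⟨c, w', e', rfl, hc, rfl⟩ |
      ⟨c, d, w', rfl, rfl | rfl⟩
    -- From the edge `flip e`, the edge `e⁻¹` completes a distinguished square at the base vertex,
    -- which `addSq` collapses to the constant path.
    · obtain ⟨h1, h2⟩ := S.adj_flip _ hb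
      have h3 : S.Fresh [] (S.tr (S.inv (S.flip e)) (S.inv e)) :=
        (S.diag_adj _ _ (S.diag_symm _ _ h2)).2.1
      have h4 := act_edge_adj_fresh (adj_tr_inv h1) h3
      rw [tr_inv_tr h1] at h4
      simp only [act, hb, if_true] at h4 ⊢
      rw [h4, addSq_comm _ (S.adj_symm _ _ (adj_tr_inv h1))]
      simp [addSq, h2]
    · rw [act_edge_inv, S.inv_inv, act_of_fresh hw.2]
    · by_cases hf' : S.Fresh w' e'
      · rw [act_edge_adj_fresh hc hf', addSq_comm _ (S.adj_symm _ _ hc), act_addSq hc hw.2]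
      · rw [act_edge_adj_not_fresh hc hf']
        have h1 : S.adj (S.tr e' c) (S.inv e') :=
          S.adj_symm _ _ (S.adj_tr _ _ (S.adj_symm _ _ hc))
        have h2 : S.tr (S.tr e' c) (S.inv e') = S.inv (S.tr c e') :=
          S.tr_tr_inv _ _ (S.adj_symm _ _ hc)
        -- This forces the return through the recursive branch of `act` again, instead of the one
        -- that creates a square.
        have h3 : ¬ S.Fresh (S.act w' e') (S.inv e') := by
          apply not_fresh_act_inv hw.1 hf'
          rintro a w'' rfl rfl
          exact hw.2.2 (S.adj_symm _ _ hc)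
        rw [← h2, act_edge_adj_not_fresh h1 h3, act_inv hw.1 e',
          S.tr_tr _ _ (S.adj_symm _ _ hc)]
    · rw [act_square_left, S.inv_inv, act_edge_adj_fresh hw.2.2.2.1 hw.2.2.1]
      rw [addSq_comm _ (S.adj_symm _ _ hw.2.2.2.1)]
      unfold addSq
      rw [if_neg (fun h => hw.2.2.2.2.2 h.1 h.2), if_pos hw.2.2.2.2.1]
    · rw [act_square_right hw.2.2.2.1, S.inv_inv,
        act_edge_adj_fresh (S.adj_symm _ _ hw.2.2.2.1) hw.2.1]
      unfold addSq
      rw [if_neg (fun h => hw.2.2.2.2.2 h.1 h.2), if_pos hw.2.2.2.2.1]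
  termination_by w => w.length

lemma act_square_of_fresh {w : List (Cube D)} (hw : S.Normal w) {a b : D} (h : S.adj a b)
    (ha : S.Fresh w a) :
    S.act (S.act w a) (S.tr a b) = S.act (S.act w b) (S.tr b a) := by
  by_cases hb : S.Fresh w b
  · rw [act_of_fresh ha, act_of_fresh hb, act_edge_adj_fresh h hb,
      act_edge_adj_fresh (S.adj_symm _ _ h) ha, addSq_comm _ h]
  · rw [act_of_fresh ha, act_edge_adj_not_fresh h hb, act_of_fresh (fresh_act hw h ha hb)]

/-- A square that has the last edge `c` as a side: pushing across it and returning along the copy of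
`c` amounts to stepping back along `c` first. -/
lemma act_square_of_back {w : List (Cube D)} {c e : D} (h : S.adj c e) :
    S.act (S.act (edge c :: w) (S.tr c e)) (S.tr (S.tr c e) (S.inv c)) = S.act w e := by
  rw [S.tr_tr_inv _ _ h]
  by_cases hf : S.Fresh w e
  · rw [act_edge_adj_fresh h hf, act_addSq (S.adj_symm _ _ h) hf, act_of_fresh hf]
  · rw [act_edge_adj_not_fresh h hf, act_edge_inv]

/-- The defining relations of the fundamental group hold for the action. If one of the edges is
fresh, `act_square_of_fresh` applies. Otherwise both are entering, or one retraces the last edge, or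
both are sides of the last square; all other combinations are excluded. -/
lemma act_square {w : List (Cube D)} (hw : S.Normal w) {a b : D} (h : S.adj a b) :
    S.act (S.act w a) (S.tr a b) = S.act (S.act w b) (S.tr b a) := by
  have hba := S.adj_symm _ _ h
  by_cases ha : S.Fresh w a
  · exact act_square_of_fresh hw h ha
  by_cases hb : S.Fresh w b
  · exact (act_square_of_fresh hw hba hb).symm
  rcases not_fresh_cases ha with ⟨rfl, ha'⟩ | ⟨c, w', rfl, rfl⟩ | ⟨c, w', e', rfl, hc, rfl⟩ |
      ⟨c, d, w', rfl, hcd⟩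
  · have hb' : S.entering b := by simpa [Fresh] using hb
    rw [S.entering_adj _ _ ha' hb' h, S.entering_adj _ _ hb' ha' hba]
    simp [act, ha', hb']
  · rw [act_edge_inv]
    have h3 := act_square_of_back (w := w') (adj_tr_inv h)
    rw [tr_inv_tr h] at h3
    exact h3.symm
  · rcases not_fresh_cases hb with ⟨h0, -⟩ | ⟨c', w'', h0, rfl⟩ | ⟨c', w'', f', h0, hc', rfl⟩ |
      ⟨c', d', w'', h0, -⟩
    · simp at h0
    · obtain ⟨h1, rfl⟩ := List.cons.inj h0
      obtain rfl := Cube.edge.inj h1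
      rw [act_edge_inv, S.tr_tr _ _ hc]
      exact act_square_of_back hc
    · obtain ⟨h1, rfl⟩ := List.cons.inj h0
      obtain rfl := Cube.edge.inj h1
      -- Both edges span a square with `c⁻¹` and with each other, a triangle in the link.
      exact absurd (S.adj_tr _ _ hc') (S.no_triangle _ _ _ (S.adj_tr _ _ hc) h)
    · simp at h0
  · have hcd' : S.adj c d := hw.2.2.2.1
    have hdc' := S.adj_symm _ _ hcd'
    have hb' : b = S.inv (S.tr c d) ∨ b = S.inv (S.tr d c) := by
      by_contra h3
      push Not at h3
      exact hb h3
    rcases hcd with rfl | rfl <;> rcases hb' with rfl | rfl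
    · exact absurd h (adj_irrefl _)
    · rw [act_square_left, act_square_right hcd', tr_far hcd', tr_far hdc', act_edge_inv, act_edge_inv]
    · rw [act_square_left, act_square_right hcd', tr_far hcd', tr_far hdc', act_edge_inv, act_edge_inv]
    · exact absurd h (adj_irrefl _)

end Data

end SquareComplex

namespace AutGroup

/-! ### Word length and fellow travelling -/

section Length

variable {ι Γ : Type} [Group Γ] {x : ι → Γ}

lemma wordVal_nil (x : ι → Γ) : wordVal x [] = 1 := rfl

lemma wordVal_cons (x : ι → Γ) (a : Letter ι) (w : List (Letter ι)) :
    wordVal x (a :: w) = letterVal x a * wordVal x w := by simp [wordVal]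

lemma wordVal_append (x : ι → Γ) (w y : List (Letter ι)) :
    wordVal x (w ++ y) = wordVal x w * wordVal x y := by simp [wordVal]

lemma letterVal_not (x : ι → Γ) (i : ι) (c : Bool) :
    letterVal x (i, !c) = (letterVal x (i, c))⁻¹ := by
  cases c <;> simp [letterVal]

lemma lengthLE_wordVal (x : ι → Γ) (w : List (Letter ι)) : LengthLE x (wordVal x w) w.length :=
  ⟨w, le_rfl, rfl⟩

lemma LengthLE.mono {g : Γ} {k l : ℕ} (h : LengthLE x g k) (hkl : k ≤ l) : LengthLE x g l := by
  obtain ⟨p, hp, rfl⟩ := h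
  exact ⟨p, hp.trans hkl, rfl⟩

lemma LengthLE.one (x : ι → Γ) (k : ℕ) : LengthLE x 1 k := ⟨[], by simp, rfl⟩

lemma LengthLE.mul {g h : Γ} {k l : ℕ} (hg : LengthLE x g k) (hh : LengthLE x h l) :
    LengthLE x (g * h) (k + l) := by
  obtain ⟨p, hp, rfl⟩ := hg
  obtain ⟨q, hq, rfl⟩ := hh
  exact ⟨p ++ q, by simp; omega, wordVal_append _ _ _⟩

lemma LengthLE.inv {g : Γ} {k : ℕ} (hg : LengthLE x g k) : LengthLE x g⁻¹ k := by
  obtain ⟨p, hp, rfl⟩ := hg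
  refine ⟨(p.map fun a => (a.1, !a.2)).reverse, by simpa using hp, ?_⟩
  clear hp
  induction p with
  | nil => simp [wordVal]
  | cons a p ih =>
    obtain ⟨i, c⟩ := a
    rw [List.map_cons, List.reverse_cons, wordVal_append, ih, wordVal_cons, wordVal_cons,
      letterVal_not, wordVal_nil]
    simp

lemma lengthLE_letterVal (x : ι → Γ) (a : Letter ι) : LengthLE x (letterVal x a) 1 :=
  ⟨[a], le_rfl, by simp [wordVal]⟩

lemma lengthLE_take (x : ι → Γ) (w : List (Letter ι)) (t : ℕ) :
    LengthLE x (wordVal x (w.take t)) w.length :=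
  (lengthLE_wordVal x _).mono (by simp)

lemma lengthLE_take_take (x : ι → Γ) (w : List (Letter ι)) {s t c : ℕ} (h : s ≤ t)
    (hc : min t w.length ≤ s + c) :
    LengthLE x ((wordVal x (w.take s))⁻¹ * wordVal x (w.take t)) c := by
  obtain ⟨d, rfl⟩ := Nat.exists_eq_add_of_le h
  rw [List.take_add, wordVal_append, inv_mul_cancel_left]
  exact (lengthLE_wordVal x _).mono (by simp; omega)

lemma finite_setOf_lengthLE [Finite ι] (x : ι → Γ) (k : ℕ) : {g | LengthLE x g k}.Finite := by
  have h := (List.finite_length_le (Letter ι) k).image (wordVal x)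
  refine h.subset ?_
  rintro g ⟨p, hp, rfl⟩
  exact ⟨p, hp, rfl⟩

/-- Two words fellow travel up to a bounded delay, where the second one starts at `h`. -/
def DelayedFellow (x : ι → Γ) (c k : ℕ) (h : Γ) (w y : List (Letter ι)) : Prop :=
  ∀ t ≤ w.length, ∃ t', t ≤ t' + c ∧ t' ≤ t + c ∧
    LengthLE x ((wordVal x (w.take t))⁻¹ * h * wordVal x (y.take t')) k

/-- A bounded delay costs only a bounded distance, provided that the second word is not much longer
than the first. -/
lemma DelayedFellow.fellow {c k : ℕ} {h : Γ} {w y : List (Letter ι)}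
    (H : DelayedFellow x c k h w y) (hc : y.length ≤ w.length + c) (t : ℕ) :
    LengthLE x ((wordVal x (w.take t))⁻¹ * h * wordVal x (y.take t)) (k + 2 * c) := by
  -- Here `t₁` is the smaller of `t` and the length of `w`. The index `t'` may lag by `c`, and `y`
  -- may outlast `w` by another `c`, whence `2 * c`.
  have key : ∀ t₁ t', t₁ ≤ t → t₁ = t ∨ t₁ = w.length → t₁ ≤ t' + c → t' ≤ t₁ + c →
      LengthLE x ((wordVal x (y.take t'))⁻¹ * wordVal x (y.take t)) (2 * c) := by
    intro t₁ t' h1 h2 h3 h4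
    rcases le_total t' t with h5 | h5
    · exact lengthLE_take_take x y h5 (by omega)
    · have := (lengthLE_take_take x y (c := 2 * c) h5 (by omega)).inv
      simpa using this
  rcases le_total t w.length with h1 | h1
  · obtain ⟨t', h2, h3, h4⟩ := H t h1
    have := h4.mul (key t t' le_rfl (Or.inl rfl) h2 h3)
    simpa [mul_assoc] using this
  · obtain ⟨t', h2, h3, h4⟩ := H _ le_rfl
    have := h4.mul (key _ t' h1 (Or.inr rfl) h2 h3)
    rw [List.take_of_length_le h1]
    rw [List.take_of_length_le le_rfl] at this
    simpa [mul_assoc] using this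

/-- On the common prefix the words are synchronous; during `p` the second word rests at the end of
the prefix. -/
lemma DelayedFellow.of_append {w p q : List (Letter ι)} {m : ℕ} (hp : p.length ≤ m) :
    DelayedFellow x m m 1 (w ++ p) (w ++ q) := by
  intro t ht
  rw [List.length_append] at ht
  rcases le_total t w.length with h1 | h1
  · refine ⟨t, by omega, by omega, ?_⟩
    rw [List.take_append_of_le_length h1, List.take_append_of_le_length h1]
    simpa using LengthLE.one x m
  · refine ⟨w.length, by omega, by omega, ?_⟩
    rw [List.take_append_of_le_length le_rfl, List.take_length, List.take_append,
      List.take_of_length_le h1, wordVal_append]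
    simpa using ((lengthLE_take x p _).mono hp).inv

lemma DelayedFellow.append {w y p q : List (Letter ι)} {c k j l : ℕ} {h : Γ}
    (H : DelayedFellow x c k h w y) (hp : p.length ≤ l)
    (h1 : w.length + l ≤ y.length + c) (h2 : y.length ≤ w.length + c)
    (hj : LengthLE x ((wordVal x w)⁻¹ * h * wordVal x y) j) (hk : l + j ≤ k) :
    DelayedFellow x c k h (w ++ p) (y ++ q) := by
  intro t ht
  rw [List.length_append] at ht
  rcases le_total t w.length with h3 | h3
  · obtain ⟨t', h4, h5, h6⟩ := H t h3
    -- Cutting `t'` off at the end of `y` keeps the prefix from running into `q`.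
    refine ⟨min t' y.length, by omega, by omega, ?_⟩
    rw [List.take_append_of_le_length h3, List.take_append_of_le_length (by omega)]
    have : y.take (min t' y.length) = y.take t' := by
      rcases le_total t' y.length with h7 | h7
      · rw [min_eq_left h7]
      · rw [min_eq_right h7, List.take_length, List.take_of_length_le h7]
    rwa [this]
  · refine ⟨y.length, by omega, by omega, ?_⟩
    rw [List.take_append_of_le_length le_rfl, List.take_length, List.take_append,
      List.take_of_length_le h3, wordVal_append]
    have := (((lengthLE_take x p (t - w.length)).mono hp).inv.mul hj).mono hk
    simpa [mul_assoc] using this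

end Length

end AutGroup

/-! ### Neighbouring normal cube paths fellow travel. -/

namespace SquareComplex

open AutGroup SquareComplex.Cube

namespace Data

variable {D Γ ι : Type} [Group Γ]

/-- The edges of the complex are realized by elements of a group that satisfy the relations of the
squares, and the distinguished diagonals and the coset corrections lie in `B`. -/
structure Realizes (S : Data D) (g : D → Γ) (B : Set Γ) : Prop where
  inv : ∀ a, g (S.inv a) = (g a)⁻¹
  square : ∀ a b, S.adj a b → g a * g (S.tr a b) = g b * g (S.tr b a)
  one_mem : 1 ∈ B
  flip_mem : ∀ a, S.entering a → g a * (g (S.flip a))⁻¹ ∈ B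
  diag_mem : ∀ a b, S.diag a b → g a * g (S.tr a b) ∈ B

/-- The element at the end of a cube path. -/
def pathVal (S : Data D) (g : D → Γ) : List (Cube D) → Γ
  | [] => 1
  | edge a :: w => pathVal S g w * g a
  | square a b :: w => pathVal S g w * (g a * g (S.tr a b))

/-- The word read along a cube path, where each edge is replaced by a word. -/
def pathWord (S : Data D) (code : D → List (Letter ι)) : List (Cube D) → List (Letter ι)
  | [] => []
  | edge a :: w => pathWord S code w ++ code a
  | square a b :: w => pathWord S code w ++ (code a ++ code (S.tr a b))

variable {S : Data D} {g : D → Γ} {B : Set Γ}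

lemma wordVal_pathWord {x : ι → Γ} {code : D → List (Letter ι)}
    (hcode : ∀ a, wordVal x (code a) = g a) :
    ∀ w, wordVal x (S.pathWord code w) = S.pathVal g w
  | [] => rfl
  | edge a :: w => by
    simp only [pathWord, pathVal, wordVal_append, hcode, wordVal_pathWord hcode w]
  | square a b :: w => by
    simp only [pathWord, pathVal, wordVal_append, hcode, wordVal_pathWord hcode w]

lemma Realizes.pathVal_addSq (R : S.Realizes g B) {w : List (Cube D)} {a b : D}
    (h : S.adj a b) (hd : ¬ (w = [] ∧ S.diag a b)) :
    S.pathVal g (S.addSq w a b) = S.pathVal g w * (g a * g (S.tr a b)) := by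
  unfold addSq
  rw [if_neg hd]
  split_ifs
  · rfl
  · rw [pathVal, R.square _ _ h]

/-- The relation between a path and its continuation by an edge `e`: the end points differ by `e`
up to an element of `B` on the left, and the words fellow travel. -/
def Adjacent (S : Data D) (g : D → Γ) (B : Set Γ) (x : ι → Γ) (code : D → List (Letter ι)) (m : ℕ)
    (w y : List (Cube D)) (e : Γ) : Prop :=
  ∃ h ∈ B, S.pathVal g w * e = h * S.pathVal g y ∧
    (S.pathWord code w).length ≤ (S.pathWord code y).length + m ∧
    (S.pathWord code y).length ≤ (S.pathWord code w).length + m ∧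
    DelayedFellow x (3 * m) (3 * m) h (S.pathWord code w) (S.pathWord code y)

lemma DelayedFellow_mono {x : ι → Γ} {c k c' k' : ℕ} {h : Γ} {w y : List (Letter ι)}
    (H : DelayedFellow x c k h w y) (hc : c ≤ c') (hk : k ≤ k') :
    DelayedFellow x c' k' h w y := by
  intro t ht
  obtain ⟨t', h1, h2, h3⟩ := H t ht
  exact ⟨t', by omega, by omega, h3.mono hk⟩

/-- Covers the moves that change only a bounded final segment; they need no coset correction. -/
lemma adjacent_of_append (R : S.Realizes g B) {x : ι → Γ} {code : D → List (Letter ι)} {m : ℕ}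
    {w y : List (Cube D)} {e : Γ} {v p q : List (Letter ι)}
    (he : S.pathVal g w * e = S.pathVal g y) (hw : S.pathWord code w = v ++ p)
    (hy : S.pathWord code y = v ++ q) (hp : p.length ≤ 2 * m) (hpq : p.length ≤ q.length + m)
    (hqp : q.length ≤ p.length + m) : S.Adjacent g B x code m w y e := by
  refine ⟨1, R.one_mem, by rw [he, one_mul], ?_, ?_, ?_⟩
  · rw [hw, hy]; simp; omega
  · rw [hw, hy]; simp; omega
  · rw [hw, hy]
    exact DelayedFellow_mono (DelayedFellow.of_append hp) (by omega) (by omega)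

variable [DecidableEq D]

/-- Pushing `e` back runs along a strip of squares whose two sides are the old and the new path, so
the paths stay one edge apart. A correction other than `1` can arise only where the strip reaches
the distinguished tree, and the recursion passes it on unchanged. -/
lemma adjacent_act (R : S.Realizes g B) {x : ι → Γ} {code : D → List (Letter ι)} {m : ℕ}
    (hcode : ∀ a, wordVal x (code a) = g a) (hlen : ∀ a, (code a).length = m) :
    ∀ {w : List (Cube D)}, S.Normal w → ∀ e, S.Adjacent g B x code m w (S.act w e) (g e)
  | w, hw, e => by
    have hg : ∀ a, LengthLE x (g a) m := fun a => by
      rw [← hcode a, ← hlen a]; exact lengthLE_wordVal x _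
    by_cases hf : S.Fresh w e
    · rw [act_of_fresh hf]
      refine adjacent_of_append R rfl (v := S.pathWord code w) (p := []) (by simp) rfl ?_ ?_ ?_ <;>
        simp [hlen]
    rcases not_fresh_cases hf with ⟨rfl, hb⟩ | ⟨c, w', rfl, rfl⟩ | ⟨c, w', e', rfl, hc, rfl⟩ |
      ⟨c, d, w', rfl, rfl | rfl⟩
    · simp only [act, hb, if_true]
      refine ⟨_, R.flip_mem _ hb, by simp [pathVal], by simp [pathWord],
        by simp [pathWord, hlen], fun t ht => ⟨t + m, by omega, by omega, ?_⟩⟩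
      simp only [pathWord, List.take_nil, wordVal_nil, List.nil_append]
      rw [List.take_of_length_le (by rw [hlen]; omega), hcode]
      simpa using (hg e).mono (by omega)
    · rw [act_edge_inv]
      refine adjacent_of_append R ?_ (v := S.pathWord code w') (q := []) rfl (by simp) ?_ ?_ ?_
      · simp [pathVal, R.inv]
      all_goals simp [hlen]
      omega
    · by_cases hf' : S.Fresh w' e'
      · rw [act_edge_adj_fresh hc hf']
        -- In the distinguished case the new path is constant and the correction is the diagonal.
        -- The bound `3 * m` is used up here: a prefix of one edge and a diagonal of two edges.
        by_cases hd : w' = [] ∧ S.diag e' c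
        · obtain ⟨rfl, hd'⟩ := hd
          have : S.addSq [] e' c = [] := by simp [addSq, hd']
          rw [this]
          refine ⟨_, R.diag_mem _ _ hd', ?_, ?_, ?_, fun t ht => ⟨0, ?_, by omega, ?_⟩⟩
          · simp [pathVal, R.square _ _ hc]
          · simp [pathWord, hlen]
          · simp [pathWord]
          · simp [pathWord, hlen] at ht; omega
          · have h1 := ((lengthLE_take x (code c) t).inv.mul ((hg e').mul (hg (S.tr e' c))))
            rw [hlen] at h1
            simpa [pathWord, wordVal_nil] using h1.mono (by omega)
        · have h2 : ∃ q, S.pathWord code (S.addSq w' e' c) = S.pathWord code w' ++ q ∧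
              q.length = 2 * m := by
            unfold addSq
            rw [if_neg hd]
            split_ifs
            · exact ⟨_, rfl, by simp [hlen]; omega⟩
            · exact ⟨_, rfl, by simp [hlen]; omega⟩
          obtain ⟨q, hq, hql⟩ := h2
          refine adjacent_of_append R ?_ (v := S.pathWord code w') rfl hq ?_ ?_ ?_
          · rw [R.pathVal_addSq (S.adj_symm _ _ hc) hd, ← R.square _ _ hc]
            simp [pathVal, mul_assoc]
          all_goals simp [hlen]
          all_goals omega
      · rw [act_edge_adj_not_fresh hc hf']
        obtain ⟨h, hB, h1, h2, h3, h4⟩ := adjacent_act R hcode hlen hw.1 e'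
        refine ⟨h, hB, ?_, ?_, ?_, ?_⟩
        · simp only [pathVal]
          rw [mul_assoc, R.square _ _ hc, ← mul_assoc, h1, mul_assoc]
        · simp [pathWord, hlen]; omega
        · simp [pathWord, hlen]; omega
        · refine h4.append (l := m) (j := m) (hlen _).le (by omega) (by omega) ?_ (by omega)
          rw [wordVal_pathWord hcode, wordVal_pathWord hcode, mul_assoc, ← h1]
          simpa using hg e'
    · rw [act_square_left]
      refine adjacent_of_append R ?_ (v := S.pathWord code w') rfl rfl ?_ ?_ ?_
      · simp [pathVal, R.inv, mul_assoc]
      all_goals simp [hlen]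
      omega
    · rw [act_square_right hw.2.2.2.1]
      refine adjacent_of_append R ?_ (v := S.pathWord code w') rfl rfl ?_ ?_ ?_
      · simp [pathVal, R.inv, R.square _ _ hw.2.2.2.1, mul_assoc]
      all_goals simp [hlen]
      omega
  termination_by w => w.length

end Data

end SquareComplex

/-! ### Coset corrections along diagonals of squares. -/

namespace SquareComplex

open AutGroup SquareComplex.Cube

namespace Data

variable {D Γ ι : Type} [Group Γ] {S : Data D} {g : D → Γ} {B : Set Γ} [DecidableEq D]
  {x : ι → Γ} {code : D → List (Letter ι)} {m : ℕ}

/-- The step along `a` only appends an edge and needs no correction, so the correction for the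
diagonal comes from the second step alone. -/
lemma exists_cocycle_square_of_fresh (R : S.Realizes g B)
    (hcode : ∀ a, wordVal x (code a) = g a) (hlen : ∀ a, (code a).length = m)
    {w : List (Cube D)} (hw : S.Normal w) {a b : D} (h : S.adj a b) (ha : S.Fresh w a) :
    ∃ k ∈ B, S.pathVal g w * (g a * g (S.tr a b)) =
      k * S.pathVal g (S.act (S.act w a) (S.tr a b)) := by
  rw [act_of_fresh ha]
  by_cases hb : S.Fresh w b
  · rw [act_edge_adj_fresh h hb, addSq_comm _ (S.adj_symm _ _ h)]
    by_cases hd : w = [] ∧ S.diag a b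
    · refine ⟨_, R.diag_mem _ _ hd.2, ?_⟩
      rw [addSq, if_pos hd, hd.1]
      simp [pathVal]
    · exact ⟨1, R.one_mem, by rw [R.pathVal_addSq h hd, one_mul]⟩
  · rw [act_edge_adj_not_fresh h hb]
    obtain ⟨k, hk, h1, -⟩ := adjacent_act R hcode hlen hw b
    refine ⟨k, hk, ?_⟩
    rw [R.square _ _ h, ← mul_assoc, h1, pathVal, mul_assoc]

/-- Going along the diagonal of a square changes the coset representative by an element of `B`. -/
lemma exists_cocycle_square (R : S.Realizes g B)
    (hcode : ∀ a, wordVal x (code a) = g a) (hlen : ∀ a, (code a).length = m)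
    {w : List (Cube D)} (hw : S.Normal w) {a b : D} (h : S.adj a b) :
    ∃ k ∈ B, S.pathVal g w * (g a * g (S.tr a b)) =
      k * S.pathVal g (S.act (S.act w a) (S.tr a b)) := by
  have hba := S.adj_symm _ _ h
  by_cases ha : S.Fresh w a
  · exact exists_cocycle_square_of_fresh R hcode hlen hw h ha
  by_cases hb : S.Fresh w b
  · rw [R.square _ _ h, act_square hw h]
    exact exists_cocycle_square_of_fresh R hcode hlen hw hba hb
  -- When the first step retraces the last edge of the path, it needs no correction, and only the
  -- second step counts.
  have back : ∀ c w', S.Normal w' → ∀ e, ∃ k ∈ B,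
      S.pathVal g (edge c :: w') * (g (S.inv c) * g e) =
      k * S.pathVal g (S.act (S.act (edge c :: w') (S.inv c)) e) := by
    intro c w' hw' e
    obtain ⟨k, hk, h1, -⟩ := adjacent_act R hcode hlen hw' e
    refine ⟨k, hk, ?_⟩
    rw [act_edge_inv, ← h1, pathVal, R.inv]
    group
  rcases not_fresh_cases ha with ⟨rfl, ha'⟩ | ⟨c, w', rfl, rfl⟩ | ⟨c, w', e', rfl, hc, rfl⟩ |
      ⟨c, d, w', rfl, hcd⟩
  · have hb' : S.entering b := by simpa [Fresh] using hb
    refine ⟨_, R.flip_mem _ ha', ?_⟩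
    rw [S.entering_adj _ _ ha' hb' h, R.inv]
    simp [act, ha', pathVal]
  · exact back c w' hw.1 _
  · rcases not_fresh_cases hb with ⟨h0, -⟩ | ⟨c', w'', h0, rfl⟩ | ⟨c', w'', f', h0, hc', rfl⟩ |
      ⟨c', d', w'', h0, -⟩
    · simp at h0
    · rw [R.square _ _ h, act_square hw h]
      obtain ⟨h1, rfl⟩ := List.cons.inj h0
      obtain rfl := Cube.edge.inj h1
      exact back c w' hw.1 _
    · obtain ⟨h1, rfl⟩ := List.cons.inj h0
      obtain rfl := Cube.edge.inj h1
      exact absurd (S.adj_tr _ _ hc') (S.no_triangle _ _ _ (S.adj_tr _ _ hc) h)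
    · simp at h0
  · have hcd' : S.adj c d := hw.2.2.2.1
    have hb' : b = S.inv (S.tr c d) ∨ b = S.inv (S.tr d c) := by
      by_contra h3
      push Not at h3
      exact hb h3
    have main : ∃ k ∈ B, S.pathVal g (square c d :: w') *
        (g (S.inv (S.tr c d)) * g (S.tr (S.inv (S.tr c d)) (S.inv (S.tr d c)))) =
        k * S.pathVal g (S.act (S.act (square c d :: w') (S.inv (S.tr c d)))
          (S.tr (S.inv (S.tr c d)) (S.inv (S.tr d c)))) := by
      refine ⟨1, R.one_mem, ?_⟩
      rw [act_square_left, tr_far hcd', act_edge_inv, pathVal, R.inv, R.inv]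
      group
    rcases hcd with rfl | rfl <;> rcases hb' with rfl | rfl
    · exact absurd h (adj_irrefl _)
    · exact main
    · rw [R.square _ _ h, act_square hw h]
      exact main
    · exact absurd h (adj_irrefl _)

/-! ### The action of the group on normal cube paths -/

variable (S) in
/-- The normal cube paths. -/
abbrev NormalPath : Type := {w : List (Cube D) // S.Normal w}

/-- The permutation of the normal cube paths that continues each path by `e`. -/
def actEquiv (S : Data D) (e : D) : Equiv.Perm S.NormalPath where
  toFun w := ⟨S.act w.1 e, normal_act w.2 e⟩
  invFun w := ⟨S.act w.1 (S.inv e), normal_act w.2 _⟩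
  left_inv w := Subtype.ext (act_inv w.2 e)
  right_inv w := Subtype.ext (by simpa [S.inv_inv] using act_inv w.2 (S.inv e))

variable (S) in
/-- The constant path. -/
def nilPath : S.NormalPath := ⟨[], trivial⟩

lemma actEquiv_inv (e : D) : S.actEquiv (S.inv e) = (S.actEquiv e)⁻¹ := by
  ext1 w
  exact Subtype.ext rfl

lemma actEquiv_square {a b : D} (h : S.adj a b) :
    S.actEquiv (S.tr a b) * S.actEquiv a = S.actEquiv (S.tr b a) * S.actEquiv b := by
  ext1 w
  exact Subtype.ext (act_square w.2 h)

/-- A right action of the group on the normal cube paths, written as a left action through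
inverses, in which each edge continues the paths. -/
structure IsAction (S : Data D) (g : D → Γ) (ρ : Γ →* Equiv.Perm S.NormalPath) : Prop where
  map_edge : ∀ e, ρ (g e) = (S.actEquiv e)⁻¹

lemma IsAction.apply_edge {ρ : Γ →* Equiv.Perm S.NormalPath} (A : S.IsAction g ρ)
    (w : S.NormalPath) (e : D) : (ρ (g e)⁻¹ w).1 = S.act w.1 e := by
  rw [map_inv, A.map_edge, _root_.inv_inv]; rfl

/-- Each cube of a normal path is fresh, so acting on the constant path rebuilds the path cube by
cube. Thus the path can be read off from its end point. -/
lemma IsAction.apply_pathVal {ρ : Γ →* Equiv.Perm S.NormalPath} (A : S.IsAction g ρ) :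
    ∀ {w : List (Cube D)}, S.Normal w → (ρ (S.pathVal g w)⁻¹ S.nilPath).1 = w
  | [], _ => by simp [pathVal, nilPath]
  | edge a :: w, hw => by
    rw [pathVal, mul_inv_rev, map_mul, Equiv.Perm.mul_apply, A.apply_edge,
      A.apply_pathVal hw.1, act_of_fresh hw.2]
  | square a b :: w, hw => by
    obtain ⟨h1, h2, h3, h4, h5, h6⟩ := hw
    rw [pathVal, mul_inv_rev, mul_inv_rev, map_mul, map_mul, Equiv.Perm.mul_apply,
      Equiv.Perm.mul_apply, A.apply_edge, A.apply_edge, A.apply_pathVal h1, act_of_fresh h2,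
      act_edge_adj_fresh h4 h3, addSq_comm _ (S.adj_symm _ _ h4), addSq,
      if_neg (fun h => h6 h.1 h.2), if_pos h5]

/-- Normal cube paths in the same coset of a subgroup that fixes the constant path agree. -/
lemma IsAction.eq_of_mul_eq {ρ : Γ →* Equiv.Perm S.NormalPath} (A : S.IsAction g ρ)
    {h : Γ} (hh : ρ h S.nilPath = S.nilPath) {w y : List (Cube D)} (hw : S.Normal w)
    (hy : S.Normal y) (e : S.pathVal g w = h * S.pathVal g y) : w = y := by
  have h2 : ρ h⁻¹ S.nilPath = S.nilPath := by
    rw [map_inv, Equiv.Perm.inv_eq_iff_eq, hh]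
  rw [← A.apply_pathVal hw, e, mul_inv_rev, map_mul, Equiv.Perm.mul_apply, h2,
    A.apply_pathVal hy]

end Data

end SquareComplex

namespace Sapir

open AutGroup SquareComplex

/-! ### A square complex for `G` -/

/-- The edges of a nonpositively curved square complex with fundamental group `G`. -/
inductive Edge : Type
  | u | v | b | s | r | q
  deriving DecidableEq

instance : Fintype Edge :=
  ⟨{.u, .v, .b, .s, .r, .q}, fun e => by cases e <;> decide⟩

/-- The oriented edge with the opposite direction. -/
def edgeInv (a : Letter Edge) : Letter Edge := (a.1, !a.2)

/-- The boundary words of the squares. -/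
def squares : List (Letter Edge × Letter Edge × Letter Edge × Letter Edge) :=
  [((.u, true), (.u, true), (.v, false), (.v, false)),
   ((.v, true), (.b, true), (.u, false), (.s, false)),
   ((.s, true), (.s, true), (.b, true), (.b, true)),
   ((.b, true), (.r, true), (.b, false), (.q, false)),
   ((.s, true), (.r, true), (.s, false), (.q, false))]

/-- The corners of the squares: triples `(a, b, c)` where the edges `a` and `b` span a square in
which `c` is opposite to `b`. -/
def corners : List (Letter Edge × Letter Edge × Letter Edge) :=
  squares.flatMap fun (a, b, c, d) =>
    [(a, edgeInv d, b), (edgeInv d, a, edgeInv c), (b, edgeInv a, c), (edgeInv a, b, edgeInv d),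
     (c, edgeInv b, d), (edgeInv b, c, edgeInv a), (d, edgeInv c, a), (edgeInv c, d, edgeInv b)]

/-- The edge opposite to `b` in the square spanned by `a` and `b`, if there is one. -/
def opposite (a b : Letter Edge) : Option (Letter Edge) :=
  (corners.find? fun p => p.1 = a ∧ p.2.1 = b).map fun p => p.2.2

/-- An enumeration of the edges. -/
def edgeIndex : Edge → ℕ
  | .u => 0 | .v => 1 | .b => 2 | .s => 3 | .r => 4 | .q => 5

/-- The edges that point into the beginning of a distinguished diagonal, up to `H`. -/
def edgeFlip : Letter Edge → Letter Edge
  | (.s, c) => (.b, !c)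
  | (e, _) => (e, true)

/-- The diagonal of `uu = vv` arrives at its end along `u` or `v`, and the diagonal of `bs = b⁻¹s⁻¹`
along `s` or `s⁻¹`; these are the reversed last edges. -/
def entering (a : Letter Edge) : Bool :=
  a ∈ [(Edge.u, false), (.v, false), (.s, true), (.s, false)]

/-- The pairs of first edges of the diagonals `uu = vv` and `bs = b⁻¹s⁻¹`. -/
def diag (a b : Letter Edge) : Bool :=
  (a, b) ∈ [((Edge.u, true), (Edge.v, true)), ((.v, true), (.u, true)),
    ((.b, true), (.b, false)), ((.b, false), (.b, true))]

set_option maxRecDepth 100000 in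
/-- The square complex of `G` with the diagonals `u²` and `bs`. -/
def complex : Data (Letter Edge) where
  inv := edgeInv
  adj a b := (opposite a b).isSome
  tr a b := (opposite a b).getD a
  key a := 2 * edgeIndex a.1 + a.2.toNat
  entering := entering
  flip := edgeFlip
  diag := diag
  -- The link condition and the compatibility of the diagonals are finite checks over the twelve
  -- oriented edges.
  inv_inv := by decide
  adj_symm := by decide
  key_inj := by decide
  adj_tr := by decide
  tr_tr := by decide
  tr_tr_inv := by decide
  no_triangle := by decide
  entering_adj := by decide
  entering_flip := by decide
  adj_flip := by decide
  diag_symm := by decide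
  diag_adj := by decide

end Sapir

/-! ### Regular languages -/

namespace AutGroup

section Regular

variable {α β : Type}

/-- A cut through a substituted word hits at most one code word; `s` is the part of it after the
cut. -/
lemma exists_split_flatMap (code : β → List α) : ∀ (l : List β) (x z : List α),
    x ++ z = l.flatMap code → ∃ l₁ l₂ s, l = l₁ ++ l₂ ∧ x ++ s = l₁.flatMap code ∧
      z = s ++ l₂.flatMap code ∧ (s = [] ∨ ∃ b, s <:+ code b)
  | [], x, z, h => by
    simp only [List.flatMap_nil, List.append_eq_nil_iff] at h
    exact ⟨[], [], [], by simp [h]⟩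
  | b :: l, x, z, h => by
    rw [List.flatMap_cons, List.append_eq_append_iff] at h
    rcases h with ⟨s, h1, h2⟩ | ⟨s, h1, h2⟩
    · exact ⟨[b], l, s, rfl, by simp [h1], h2, Or.inr ⟨b, x, h1.symm⟩⟩
    · obtain ⟨l₁, l₂, s', h3, h4, h5, h6⟩ := exists_split_flatMap code l s z h2.symm
      exact ⟨b :: l₁, l₂, s', by simp [h3], by simp [h1, h4], h5, h6⟩

/-- The image of a regular language under a substitution of letters by words is regular. -/
theorem isRegular_image_flatMap [Finite β] (code : β → List α) {M : Language β}
    (hM : M.IsRegular) : Language.IsRegular {w : List α | ∃ l ∈ M, w = l.flatMap code} := by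
  have hsuf : {s : List α | s = [] ∨ ∃ b, s <:+ code b}.Finite := by
    have : {s : List α | s = [] ∨ ∃ b, s <:+ code b} ⊆
        insert [] (⋃ b, {s | s ∈ (code b).tails}) := by
      rintro s (rfl | ⟨b, hb⟩)
      · simp
      · exact Or.inr (Set.mem_iUnion.2 ⟨b, by simpa using hb⟩)
    exact ((Set.finite_iUnion fun b => List.finite_toSet _).insert _).subset this
  have hT := hsuf.prod hM.finite_range_leftQuotient
  -- Myhill–Nerode: the left quotient by `x` is determined by a set of pairs consisting of the rest
  -- of a code word and a left quotient of `M`, and there are finitely many such pairs.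
  refine Language.IsRegular.of_finite_range_leftQuotient
    ((hT.finite_subsets.image fun T : Set (List α × Language β) =>
      ({z | ∃ p ∈ T, ∃ l ∈ p.2, z = p.1 ++ l.flatMap code} : Language α)).subset ?_)
  rintro _ ⟨x, rfl⟩
  refine ⟨{p | (p.1 = [] ∨ ∃ b, p.1 <:+ code b) ∧
    ∃ l, x ++ p.1 = l.flatMap code ∧ p.2 = M.leftQuotient l}, ?_, ?_⟩
  · rintro ⟨s, N⟩ ⟨h1, l, -, h2⟩
    exact ⟨h1, l, h2.symm⟩
  · ext z
    constructor
    · rintro ⟨⟨s, N⟩, ⟨-, l₁, h1, h2⟩, l₂, h3, rfl⟩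
      dsimp only at h1 h2 h3
      rw [h2] at h3
      refine ⟨l₁ ++ l₂, h3, ?_⟩
      rw [List.flatMap_append, ← h1, List.append_assoc]
    · rintro ⟨l, hl, h⟩
      obtain ⟨l₁, l₂, s, rfl, h1, h2, h3⟩ := exists_split_flatMap code l x z h
      exact ⟨(s, M.leftQuotient l₁), ⟨h3, l₁, h1, rfl⟩, l₂, hl, h2⟩

end Regular

/-! ### Fellow travelling coset representatives form an automatic coset system -/

section CosetSystem

variable {ι Γ : Type} [Group Γ] {x : ι → Γ} {H : Subgroup Γ} {L : Language (Letter ι)}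

/-- Words of `L` whose cosets differ by `g` fellow travel. -/
def FellowTravels (x : ι → Γ) (H : Subgroup Γ) (L : Language (Letter ι)) (g : Γ) : Prop :=
  ∃ k : ℕ, ∀ w ∈ L, ∀ y ∈ L, ∀ h ∈ H, wordVal x w * g = h * wordVal x y →
    ∀ t : ℕ, LengthLE x ((wordVal x (w.take t))⁻¹ * h * wordVal x (y.take t)) k

/-- The language contains a representative of each right coset. -/
def MeetsCosets (x : ι → Γ) (H : Subgroup Γ) (L : Language (Letter ι)) : Prop :=
  ∀ g : Γ, ∃ w ∈ L, ∃ h ∈ H, g = h * wordVal x w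

/-- A representative of the intermediate coset is a stop between the two words. This reduces fellow
travelling to generators. -/
lemma FellowTravels.mul (hL : MeetsCosets x H L) {g g' : Γ} (hg : FellowTravels x H L g)
    (hg' : FellowTravels x H L g') : FellowTravels x H L (g * g') := by
  obtain ⟨k, hk⟩ := hg
  obtain ⟨k', hk'⟩ := hg'
  refine ⟨k + k', fun w hw y hy h hh e t => ?_⟩
  obtain ⟨y', hy', h', hh', e'⟩ := hL (wordVal x w * g)
  have h1 := hk w hw y' hy' h' hh' e' t
  have h2 := hk' y' hy' y hy (h'⁻¹ * h) (H.mul_mem (H.inv_mem hh') hh) (by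
    have h3 : wordVal x y' = h'⁻¹ * (wordVal x w * g) := by rw [e', inv_mul_cancel_left]
    rw [h3, mul_assoc h'⁻¹ h, ← e]; group) t
  have := h1.mul h2
  simpa [mul_assoc] using this

/-- The automaton that reads padded pairs of words, runs two copies of `A` and keeps track of the
difference of the two prefixes as long as it stays in `U`. -/
def differenceNFA {Q : Type} (x : ι → Γ) (A : DFA (Letter ι) Q) (H : Subgroup Γ) (U : Set Γ)
    (g : Γ) : NFA (Option (Letter ι) × Option (Letter ι)) ((Bool × Q) × (Bool × Q) × U) where
  step s p := {s' | p ≠ (none, none) ∧ (s.1.1 → p.1 = none) ∧ (s.2.1.1 → p.2 = none) ∧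
    s'.1 = (p.1.isNone, p.1.elim s.1.2 (A.step s.1.2)) ∧
    s'.2.1 = (p.2.isNone, p.2.elim s.2.1.2 (A.step s.2.1.2)) ∧
    s'.2.2.1 = (symbolVal x p.1)⁻¹ * s.2.2.1 * symbolVal x p.2}
  -- The automaton guesses the coset correction `h`; this is where it is nondeterministic.
  start := {s | s.1 = (false, A.start) ∧ s.2.1 = (false, A.start) ∧ s.2.2.1 ∈ H}
  accept := {s | s.1.2 ∈ A.accept ∧ s.2.1.2 ∈ A.accept ∧ s.2.2.1 = g}

variable {Q : Type} {A : DFA (Letter ι) Q} {U : Set Γ} {g : Γ}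

/-- The end flags forbid a letter after a padding symbol, and `(none, none)` is never read, so every
label of a path is the padding of a pair of words. -/
lemma differenceNFA_sound {s s' : (Bool × Q) × (Bool × Q) × U}
    {p : List (Option (Letter ι) × Option (Letter ι))}
    (P : (differenceNFA x A H U g).Path s s' p) :
    ∃ w y, p = paddedPair w y ∧ (s.1.1 → w = []) ∧ (s.2.1.1 → y = []) ∧
      s'.1.2 = A.evalFrom s.1.2 w ∧ s'.2.1.2 = A.evalFrom s.2.1.2 y ∧
      s'.2.2.1 = (wordVal x w)⁻¹ * s.2.2.1 * wordVal x y := by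
  induction P with
  | nil s => exact ⟨[], [], by simp [paddedPair, wordVal_nil]⟩
  | cons t s u a p hs P ih =>
    obtain ⟨w, y, hp, h1, h2, h3, h4, h5⟩ := ih
    obtain ⟨hn, e1, e2, e3, e4, e5⟩ := hs
    obtain ⟨α, β⟩ := a
    rw [h3, h4, h5, e3, e4, e5]
    simp only [e3, e4] at h1 h2
    refine ⟨α.toList ++ w, β.toList ++ y, ?_, ?_, ?_, ?_, ?_, ?_⟩
    · rcases α with _ | α <;> rcases β with _ | β
      · exact absurd rfl hn
      · obtain rfl := h1 rfl
        simp [hp, paddedPair]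
      · obtain rfl := h2 rfl
        simp [hp, paddedPair]
      · simp [hp, paddedPair]
    · intro h
      obtain rfl : α = none := e1 h
      simpa using h1
    · intro h
      obtain rfl : β = none := e2 h
      simpa using h2
    · cases α <;> rfl
    · cases β <;> rfl
    · cases α <;> cases β <;> simp [symbolVal, wordVal_cons, mul_assoc]

lemma differenceNFA_complete : ∀ (w y : List (Letter ι)) (s : (Bool × Q) × (Bool × Q) × U),
    (s.1.1 → w = []) → (s.2.1.1 → y = []) →
    (∀ t, (wordVal x (w.take t))⁻¹ * s.2.2.1 * wordVal x (y.take t) ∈ U) →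
    ∃ s', Nonempty ((differenceNFA x A H U g).Path s s' (paddedPair w y)) ∧
      s'.1.2 = A.evalFrom s.1.2 w ∧ s'.2.1.2 = A.evalFrom s.2.1.2 y ∧
      s'.2.2.1 = (wordVal x w)⁻¹ * s.2.2.1 * wordVal x y
  | [], [], s, _, _, _ => by
    rw [paddedPair]
    exact ⟨s, ⟨.nil s⟩, by simp [wordVal_nil]⟩
  | a :: w, [], s, h1, h2, h3 => by
    have h4 := fun t => h3 (t + 1)
    obtain ⟨s', ⟨P⟩, h5, h6, h7⟩ := differenceNFA_complete w [] ((false, A.step s.1.2 a),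
      (true, s.2.1.2), ⟨(letterVal x a)⁻¹ * s.2.2.1, by simpa [wordVal] using h4 0⟩)
      (by simp) (by simp) (fun t => by simpa [wordVal_cons, mul_assoc] using h4 t)
    rw [paddedPair]
    refine ⟨s', ⟨.cons _ _ _ _ _ ?_ P⟩, h5, h6, by rw [h7]; simp [wordVal_cons, mul_assoc]⟩
    refine ⟨by simp, fun h => by simpa using h1 h, fun _ => rfl, rfl, rfl, by simp [symbolVal]⟩
  | [], b :: y, s, h1, h2, h3 => by
    have h4 := fun t => h3 (t + 1)
    obtain ⟨s', ⟨P⟩, h5, h6, h7⟩ := differenceNFA_complete [] y ((true, s.1.2),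
      (false, A.step s.2.1.2 b), ⟨s.2.2.1 * letterVal x b, by simpa [wordVal] using h4 0⟩)
      (by simp) (by simp) (fun t => by simpa [wordVal_cons, mul_assoc] using h4 t)
    rw [paddedPair]
    refine ⟨s', ⟨.cons _ _ _ _ _ ?_ P⟩, h5, h6, by rw [h7]; simp [wordVal_cons, mul_assoc]⟩
    refine ⟨by simp, fun _ => rfl, fun h => by simpa using h2 h, rfl, rfl, by simp [symbolVal]⟩
  | a :: w, b :: y, s, h1, h2, h3 => by
    have h4 := fun t => h3 (t + 1)
    obtain ⟨s', ⟨P⟩, h5, h6, h7⟩ := differenceNFA_complete w y ((false, A.step s.1.2 a),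
      (false, A.step s.2.1.2 b),
      ⟨(letterVal x a)⁻¹ * s.2.2.1 * letterVal x b, by simpa [wordVal] using h4 0⟩)
      (by simp) (by simp) (fun t => by simpa [wordVal_cons, mul_assoc] using h4 t)
    rw [paddedPair]
    refine ⟨s', ⟨.cons _ _ _ _ _ ?_ P⟩, h5, h6, by rw [h7]; simp [wordVal_cons, mul_assoc]⟩
    refine ⟨by simp, fun h => by simpa using h1 h, fun h => by simpa using h2 h, rfl, rfl,
      by simp [symbolVal]⟩

lemma rightCoset_eq_iff_exists {a b : Γ} :
    MulOpposite.op a • (H : Set Γ) = MulOpposite.op b • (H : Set Γ) ↔ ∃ h ∈ H, a = h * b := by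
  rw [rightCoset_eq_iff]
  constructor
  · intro h
    exact ⟨_, H.inv_mem h, by simp⟩
  · rintro ⟨h, hh, rfl⟩
    simpa using hh

/-- A regular language of coset representatives with the fellow traveller property is a strong
automatic coset system. -/
theorem isStrongAutomaticCosetSystem_of_fellowTravels [Finite ι] (hL : L.IsRegular)
    (hH : MeetsCosets x H L) (hF : ∀ g, FellowTravels x H L g) :
    IsStrongAutomaticCosetSystem x H L := by
  refine ⟨⟨hL, fun g => ?_, fun a => ?_⟩, ?_⟩
  · obtain ⟨w, hw, h, hh, rfl⟩ := hH g
    refine ⟨w, hw, h⁻¹, H.inv_mem hh, by simp⟩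
  · obtain ⟨Q, _, A, rfl⟩ := hL
    obtain ⟨k, hk⟩ := hF (symbolVal x a)
    have : Finite {g | LengthLE x g k} := finite_setOf_lengthLE x k
    let N := differenceNFA x A H {g | LengthLE x g k} (symbolVal x a)
    refine ⟨_, Fintype.ofFinite _, N.toDFA, ?_⟩
    rw [NFA.toDFA_correct]
    ext p
    rw [NFA.accepts_iff_exists_path]
    constructor
    · rintro ⟨s, ⟨hs1, hs2, hs3⟩, s', ⟨ha1, ha2, ha3⟩, ⟨P⟩⟩
      obtain ⟨w, y, rfl, -, -, h1, h2, h3⟩ := differenceNFA_sound P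
      rw [h1, hs1] at ha1
      rw [h2, hs2] at ha2
      refine ⟨w, ha1, y, ha2, rfl, rightCoset_eq_iff_exists.2 ⟨_, hs3, ?_⟩⟩
      rw [← ha3, h3]
      group
    · rintro ⟨w, hw, y, hy, rfl, h⟩
      obtain ⟨h, hh, e⟩ := rightCoset_eq_iff_exists.1 h
      have h1 := hk w hw y hy h hh e
      -- At `t = 0` the fellow traveller bound applies to `h` itself, so `h` is an admissible guess.
      obtain ⟨s', P, h2, h3, h4⟩ := differenceNFA_complete (U := {g | LengthLE x g k})
        (g := symbolVal x a) (A := A) (H := H) w y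
        ((false, A.start), (false, A.start), ⟨h, by simpa [wordVal_nil] using h1 0⟩)
        (by simp) (by simp) h1
      refine ⟨_, ⟨rfl, rfl, hh⟩, s', ⟨?_, ?_, ?_⟩, P⟩
      · rw [h2]; exact hw
      · rw [h3]; exact hy
      · rw [h4, mul_assoc, ← e]; group
  · choose k hk using hF
    have : Finite (Letter ι) := inferInstance
    obtain ⟨m, hm⟩ := (Set.finite_range fun a : Letter ι => k (letterVal x a)).bddAbove
    exact ⟨m, fun w hw y hy a h hh e t => (hk _ w hw y hy h hh e t).mono (hm ⟨a, rfl⟩)⟩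

end CosetSystem

end AutGroup

/-! ### The language of normal cube paths. -/

namespace SquareComplex

open AutGroup SquareComplex.Cube

namespace Data

variable {D : Type} {S : Data D}

instance [Finite D] : Finite (Cube D) := by
  refine Finite.of_injective (β := D × Option D)
    (fun c => match c with | edge a => (a, none) | square a b => (a, some b)) ?_
  rintro (_ | _) (_ | _) <;> simp

/-- The cube `c` continues the cube path `w` to a normal cube path. -/
def Continues (S : Data D) (w : List (Cube D)) : Cube D → Prop
  | edge a => S.Fresh w a
  | square a b => S.Fresh w a ∧ S.Fresh w b ∧ S.adj a b ∧ S.key a < S.key b ∧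
      (w = [] → ¬ S.diag a b)

/-- Whether a cube may follow depends only on the last cube of the path, or on there being none;
hence normality is recognized with finite memory. -/
lemma continues_head (c : Cube D) (w : List (Cube D)) :
    S.Continues w.head?.toList c ↔ S.Continues w c := by
  rcases w with _ | ⟨_ | _, w⟩ <;> rcases c with a | ⟨a, b⟩ <;> simp [Continues, Fresh]

lemma normal_cons_iff (c : Cube D) (w : List (Cube D)) :
    S.Normal (c :: w) ↔ S.Normal w ∧ S.Continues w.head?.toList c := by
  rw [continues_head]
  cases c <;> rfl

open Classical in
/-- The automaton that recognizes normal cube paths by comparing consecutive cubes. -/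
noncomputable def normalDFA (S : Data D) : DFA (Cube D) (Option (Option (Cube D))) where
  step o c := o.bind fun o => if S.Continues o.toList c then some (some c) else none
  start := some none
  accept := {o | o ≠ none}

open Classical in
lemma eval_normalDFA (l : List (Cube D)) :
    S.normalDFA.eval l = if S.Normal l.reverse then some l.reverse.head? else none := by
  induction l using List.reverseRecOn with
  | nil => simp [Normal, normalDFA]
  | append_singleton l c ih =>
    rw [DFA.eval_append_singleton, ih, List.reverse_append, List.reverse_singleton,
      List.singleton_append]
    by_cases h : S.Normal l.reverse
    · rw [if_pos h, List.head?_cons]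
      simp only [normalDFA, Option.bind_some]
      simp [normal_cons_iff, h]
    · rw [if_neg h, if_neg (fun h3 => h ((normal_cons_iff _ _).1 h3).1)]
      rfl

/-- Paths are stored with the last cube first, whereas the automaton reads them from their
beginning; hence the reversal. -/
lemma isRegular_normal [Finite D] :
    Language.IsRegular {l : List (Cube D) | S.Normal l.reverse} := by
  refine ⟨_, Fintype.ofFinite _, S.normalDFA, ?_⟩
  ext l
  rw [DFA.mem_accepts, eval_normalDFA]
  change _ ≠ none ↔ S.Normal l.reverse
  split_ifs with h <;> simp [h]

variable {ι : Type}

/-- The language of the words that are read along normal cube paths. -/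
def pathLanguage (S : Data D) (code : D → List (Letter ι)) : Language (Letter ι) :=
  {w | ∃ p, S.Normal p ∧ w = S.pathWord code p}

lemma isRegular_pathLanguage [Finite D] (code : D → List (Letter ι)) :
    (S.pathLanguage code).IsRegular := by
  let f : Cube D → List (Letter ι) := fun c => S.pathWord code [c]
  have hf : ∀ p : List (Cube D), S.pathWord code p = p.reverse.flatMap f := by
    intro p
    induction p with
    | nil => rfl
    | cons c p ih => rcases c with a | ⟨a, b⟩ <;> simp [pathWord, ih, f]
  have h := isRegular_image_flatMap f (isRegular_normal (S := S))
  refine Eq.subst (motive := Language.IsRegular) ?_ h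
  ext w
  constructor
  · rintro ⟨l, hl, rfl⟩
    exact ⟨l.reverse, hl, by simp [hf]⟩
  · rintro ⟨p, hp, rfl⟩
    exact ⟨p.reverse, by rw [← p.reverse_reverse] at hp; exact hp, hf p⟩

variable {Γ : Type} [Group Γ]

lemma closure_induction_right {g : D → Γ} (hg : Subgroup.closure (Set.range g) = ⊤)
    (hinv : ∀ a, g (S.inv a) = (g a)⁻¹) {P : Γ → Prop} (one : P 1)
    (mul : ∀ γ δ, P γ → P δ → P (γ * δ)) (edge : ∀ a, P (g a)) (γ : Γ) : P γ := by
  have h : γ ∈ Subgroup.closure (Set.range g) := hg ▸ Subgroup.mem_top γ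
  rw [← Subgroup.mem_toSubmonoid, Subgroup.closure_toSubmonoid] at h
  induction h using Submonoid.closure_induction with
  | mem γ h =>
    rcases h with ⟨a, rfl⟩ | ⟨a, ha⟩
    · exact edge a
    · rw [← _root_.inv_inv γ, ← ha, ← hinv]; exact edge _
  | one => exact one
  | mul γ δ _ _ h1 h2 => exact mul γ δ h1 h2

variable [DecidableEq D] {g : D → Γ} {B : Set Γ} {x : ι → Γ} {code : D → List (Letter ι)}
  {m : ℕ} {H : Subgroup Γ} {ρ : Γ →* Equiv.Perm S.NormalPath}

lemma meetsCosets_pathLanguage (R : S.Realizes g B) (hBH : B ⊆ H)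
    (hg : Subgroup.closure (Set.range g) = ⊤)
    (hcode : ∀ a, wordVal x (code a) = g a) (hlen : ∀ a, (code a).length = m) :
    MeetsCosets x H (S.pathLanguage code) := by
  have key : ∀ γ : Γ, ∀ w, S.Normal w → ∃ y, S.Normal y ∧ ∃ h ∈ H,
      S.pathVal g w * γ = h * S.pathVal g y := by
    refine closure_induction_right hg R.inv ?_ ?_ ?_
    · exact fun w hw => ⟨w, hw, 1, H.one_mem, by simp⟩
    · intro γ δ h1 h2 w hw
      obtain ⟨y, hy, h, hh, e⟩ := h1 w hw
      obtain ⟨y', hy', h', hh', e'⟩ := h2 y hy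
      exact ⟨y', hy', h * h', H.mul_mem hh hh', by rw [← mul_assoc, e, mul_assoc, e', mul_assoc]⟩
    · intro a w hw
      obtain ⟨h, hh, e, -⟩ := adjacent_act R hcode hlen hw a
      exact ⟨_, normal_act hw a, h, hBH hh, e⟩
  intro γ
  obtain ⟨y, hy, h, hh, e⟩ := key γ [] trivial
  exact ⟨_, ⟨y, hy, rfl⟩, h, hh, by rw [wordVal_pathWord hcode, ← e]; simp [pathVal]⟩

lemma pathLanguage_unique (A : S.IsAction g ρ) (hH : ∀ h ∈ H, ρ h S.nilPath = S.nilPath)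
    (hcode : ∀ a, wordVal x (code a) = g a) {w y : List (Letter ι)}
    (hw : w ∈ S.pathLanguage code) (hy : y ∈ S.pathLanguage code) {h : Γ} (hh : h ∈ H)
    (e : wordVal x w = h * wordVal x y) : w = y := by
  obtain ⟨p, hp, rfl⟩ := hw
  obtain ⟨q, hq, rfl⟩ := hy
  rw [wordVal_pathWord hcode, wordVal_pathWord hcode] at e
  rw [A.eq_of_mul_eq (hH h hh) hp hq e]

/-- For an edge `a`, uniqueness of normal paths identifies `q` with `act p a` and `h` with the
correction supplied by `adjacent_act`, whose bounds then apply. -/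
lemma fellowTravels_pathLanguage (R : S.Realizes g B) (hBH : B ⊆ H)
    (hg : Subgroup.closure (Set.range g) = ⊤) (A : S.IsAction g ρ)
    (hH : ∀ h ∈ H, ρ h S.nilPath = S.nilPath)
    (hcode : ∀ a, wordVal x (code a) = g a) (hlen : ∀ a, (code a).length = m) (γ : Γ) :
    FellowTravels x H (S.pathLanguage code) γ := by
  refine closure_induction_right hg R.inv ?_
    (fun _ _ => FellowTravels.mul (meetsCosets_pathLanguage R hBH hg hcode hlen)) ?_ γ
  · refine ⟨0, fun w hw y hy h hh e t => ?_⟩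
    rw [mul_one] at e
    obtain rfl := pathLanguage_unique A hH hcode hw hy hh e
    obtain rfl : h = 1 := by simpa using e
    simpa using LengthLE.one x 0
  · refine fun a => ⟨3 * m + 2 * (3 * m), ?_⟩
    rintro _ ⟨p, hp, rfl⟩ _ ⟨q, hq, rfl⟩ h hh e t
    rw [wordVal_pathWord hcode, wordVal_pathWord hcode] at e
    obtain ⟨k, hk, e2, h1, h2, h3⟩ := adjacent_act R hcode hlen hp a
    have h4 : S.act p a = q := by
      refine A.eq_of_mul_eq (hH _ (H.mul_mem (H.inv_mem (hBH hk)) hh)) (normal_act hp a) hq ?_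
      rw [mul_assoc, ← e, e2, inv_mul_cancel_left]
    rw [h4] at e2 h1 h2 h3
    obtain rfl : h = k := mul_right_cancel (e.symm.trans e2)
    exact h3.fellow (by omega) t

/-- Efficiency in geometric form: multiplication by a diagonal of any square changes the coset
representative by a correction in `B`. It applies to `Y` because its elements are diagonals. -/
lemma efficient_pathLanguage (R : S.Realizes g B) (hBH : B ⊆ H) (A : S.IsAction g ρ)
    (hH : ∀ h ∈ H, ρ h S.nilPath = S.nilPath)
    (hcode : ∀ a, wordVal x (code a) = g a) (hlen : ∀ a, (code a).length = m) {a b : D}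
    (hab : S.adj a b) {w y : List (Letter ι)} (hw : w ∈ S.pathLanguage code)
    (hy : y ∈ S.pathLanguage code) {h : Γ} (hh : h ∈ H)
    (e : wordVal x w * (g a * g (S.tr a b)) = h * wordVal x y) : h ∈ B := by
  obtain ⟨p, hp, rfl⟩ := hw
  obtain ⟨q, hq, rfl⟩ := hy
  rw [wordVal_pathWord hcode, wordVal_pathWord hcode] at e
  obtain ⟨k, hk, e2⟩ := exists_cocycle_square R hcode hlen hp hab
  have h4 : S.act (S.act p a) (S.tr a b) = q := by
    refine A.eq_of_mul_eq (hH _ (H.mul_mem (H.inv_mem (hBH hk)) hh))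
      (normal_act (normal_act hp _) _) hq ?_
    rw [mul_assoc, ← e, e2, inv_mul_cancel_left]
  rw [h4] at e2
  obtain rfl : h = k := mul_right_cancel (e.symm.trans e2)
  exact hk

end Data

end SquareComplex

namespace Sapir

open AutGroup SquareComplex

/-! ### The coset system of `G` -/

section EdgeValues

variable {Γ : Type} [Group Γ]

/-- The edges of the square complex as elements of a group generated by `u`, `v`, `b`, `r`. -/
def edgeWord : Edge → List (Letter GGen)
  -- Trivial factors `bb⁻¹` pad the words to the common length five that the path lemmas require.
  | .u => [(.u, true), (.b, true), (.b, false), (.b, true), (.b, false)]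
  | .v => [(.v, true), (.b, true), (.b, false), (.b, true), (.b, false)]
  | .b => [(.b, true), (.b, true), (.b, false), (.b, true), (.b, false)]
  | .s => [(.v, true), (.b, true), (.u, false), (.b, true), (.b, false)]
  | .r => [(.u, true), (.r, true), (.u, false), (.b, true), (.b, false)]
  | .q => [(.b, true), (.u, true), (.r, true), (.u, false), (.b, false)]

/-- The word for an oriented edge. -/
def code : Letter Edge → List (Letter GGen)
  | (e, true) => edgeWord e
  | (e, false) => ((edgeWord e).map fun a => (a.1, !a.2)).reverse

lemma length_code : ∀ a, (code a).length = 5 := by decide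

/-- The element of `G` that an oriented edge stands for. -/
def edgeVal (a : Letter Edge) : G := wordVal gGen (code a)

lemma edgeVal_inv : ∀ a, edgeVal (complex.inv a) = (edgeVal a)⁻¹
  | (e, c) => by
    cases e <;> cases c <;>
      simp [edgeVal, complex, edgeInv, code, edgeWord, wordVal, letterVal, mul_assoc]

end EdgeValues

lemma relation_uv : gGen .u ^ 2 = gGen .v ^ 2 := by
  have h : PresentedGroup.mk gRels (FreeGroup.of .u ^ 2 * (FreeGroup.of .v ^ 2)⁻¹) = 1 :=
    PresentedGroup.one_of_mem (by simp [gRels])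
  rw [map_mul, map_inv, map_pow, map_pow, mul_inv_eq_one] at h
  exact h

lemma relation_ubv : gGen .b * gGen .v * gGen .b * gGen .u =
    (gGen .b)⁻¹ * gGen .u * (gGen .b)⁻¹ * gGen .v := by
  have h : PresentedGroup.mk gRels _ = 1 := PresentedGroup.one_of_mem
    (show (FreeGroup.of .b * FreeGroup.of .v * FreeGroup.of .b * FreeGroup.of .u) *
      ((FreeGroup.of .b)⁻¹ * FreeGroup.of .u * (FreeGroup.of .b)⁻¹ * FreeGroup.of .v)⁻¹ ∈ gRels by
      simp [gRels])
  simp only [map_mul, map_inv] at h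
  exact mul_inv_eq_one.1 h

lemma relation_r : (gGen .u)⁻¹ * (gGen .b)⁻¹ * gGen .v * gGen .b * gGen .r =
    gGen .r * (gGen .u)⁻¹ * (gGen .b)⁻¹ * gGen .v * gGen .b := by
  have h : PresentedGroup.mk gRels _ = 1 := PresentedGroup.one_of_mem
    (show ((FreeGroup.of .u)⁻¹ * (FreeGroup.of .b)⁻¹ * FreeGroup.of .v * FreeGroup.of .b *
        FreeGroup.of .r) *
      (FreeGroup.of .r * (FreeGroup.of .u)⁻¹ * (FreeGroup.of .b)⁻¹ * FreeGroup.of .v *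
        FreeGroup.of .b)⁻¹ ∈ gRels by simp [gRels])
  simp only [map_mul, map_inv] at h
  exact mul_inv_eq_one.1 h

section Squares

variable {Γ : Type} [Group Γ] {P : Letter Edge → Γ}

lemma prod_eq_one_of_rotation {a b c d : Γ} (h : a * b * c * d = 1) : b * c * d * a = 1 := by
  rw [mul_assoc, mul_assoc, mul_eq_one_iff_eq_inv] at h
  rw [h]; group

/-- The cyclic rotations of the boundary words of the squares. -/
def rotatedSquares : List (Letter Edge × Letter Edge × Letter Edge × Letter Edge) :=
  squares.flatMap fun (a, b, c, d) => [(a, b, c, d), (b, c, d, a), (c, d, a, b), (d, a, b, c)]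

/-- The boundary of the square spanned by `a` and `b` is a rotation of a boundary word. -/
def cornerMem (a b : Letter Edge) : Bool :=
  (a, complex.tr a b, edgeInv (complex.tr b a), edgeInv b) ∈ rotatedSquares

set_option maxRecDepth 100000 in
lemma cornerMem_of_adj : ∀ a b, complex.adj a b → cornerMem a b || cornerMem b a := by
  decide

/-- The relations of the squares, at all of their corners. -/
lemma square_relation (hinv : ∀ a, P (edgeInv a) = (P a)⁻¹)
    (h : ∀ p ∈ squares, P p.1 * P p.2.1 * P p.2.2.1 * P p.2.2.2 = 1) (a b : Letter Edge)
    (hab : complex.adj a b) : P a * P (complex.tr a b) = P b * P (complex.tr b a) := by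
  have key : ∀ q ∈ rotatedSquares, P q.1 * P q.2.1 * P q.2.2.1 * P q.2.2.2 = 1 := by
    intro q hq
    obtain ⟨p, hp, hq⟩ := List.mem_flatMap.1 hq
    have h1 := h _ hp
    have h2 := prod_eq_one_of_rotation h1
    have h3 := prod_eq_one_of_rotation h2
    have h4 := prod_eq_one_of_rotation h3
    simp only [List.mem_cons, List.not_mem_nil, or_false] at hq
    rcases hq with rfl | rfl | rfl | rfl <;> assumption
  rcases Bool.or_eq_true_iff.1 (cornerMem_of_adj a b hab) with h1 | h1 <;>
    have h5 := key _ (of_decide_eq_true h1) <;>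
    dsimp only at h5 <;> rw [hinv, hinv, mul_assoc _ (P _)⁻¹, ← mul_inv_rev, mul_inv_eq_one] at h5
  · exact h5
  · exact h5.symm

end Squares

lemma edgeVal_u : edgeVal (.u, true) = gGen .u := by
  simp [edgeVal, code, edgeWord, wordVal, letterVal]

lemma edgeVal_v : edgeVal (.v, true) = gGen .v := by
  simp [edgeVal, code, edgeWord, wordVal, letterVal]

lemma edgeVal_b : edgeVal (.b, true) = gGen .b := by
  simp [edgeVal, code, edgeWord, wordVal, letterVal]

lemma edgeVal_s : edgeVal (.s, true) = gGen .v * gGen .b * (gGen .u)⁻¹ := by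
  simp [edgeVal, code, edgeWord, wordVal, letterVal, mul_assoc]

lemma edgeVal_r : edgeVal (.r, true) = gGen .u * gGen .r * (gGen .u)⁻¹ := by
  simp [edgeVal, code, edgeWord, wordVal, letterVal, mul_assoc]

lemma edgeVal_q : edgeVal (.q, true) =
    gGen .b * (gGen .u * gGen .r * (gGen .u)⁻¹) * (gGen .b)⁻¹ := by
  simp [edgeVal, code, edgeWord, wordVal, letterVal, mul_assoc]

/-- The second and fourth squares are the definitions of `s` and `q`; the first, third and fifth
squares express the three relators of `G`. -/
lemma edgeVal_squares : ∀ p ∈ squares,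
    edgeVal p.1 * edgeVal p.2.1 * edgeVal p.2.2.1 * edgeVal p.2.2.2 = 1 := by
  have hinv : ∀ e, edgeVal (e, false) = (edgeVal (e, true))⁻¹ := fun e => edgeVal_inv (e, true)
  have h1 := relation_uv
  have h2 := relation_ubv
  have h3 := relation_r
  simp only [squares, List.forall_mem_cons, List.not_mem_nil, false_imp_iff, implies_true,
    and_true, hinv, edgeVal_u, edgeVal_v, edgeVal_b, edgeVal_s, edgeVal_r, edgeVal_q]
  generalize gGen .u = u at *
  generalize gGen .v = v at *
  generalize gGen .b = b at *
  generalize gGen .r = r at *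
  refine ⟨?_, ?_, ?_, ?_, ?_⟩
  · rw [pow_two, pow_two] at h1
    rw [h1]; group
  · group
  · have h4 : u⁻¹ * v = u * v⁻¹ := by
      rw [inv_mul_eq_iff_eq_mul, ← mul_assoc, ← pow_two, h1, pow_two, mul_inv_cancel_right]
    have h5 : b * (v * b * u⁻¹) = b⁻¹ * u * b⁻¹ * v⁻¹ := by
      have : b * (v * b * u⁻¹) = b * v * b * u * (u ^ 2)⁻¹ := by group
      rw [this, h2, h1]; group
    calc v * b * u⁻¹ * (v * b * u⁻¹) * b * b
        = b⁻¹ * (b * (v * b * u⁻¹)) * (v * b * u⁻¹) * b * b := by group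
      _ = 1 := by rw [h5]; group
  · group
  · have h4 : b⁻¹ * (v * b * u⁻¹) = u * (u⁻¹ * b⁻¹ * v * b) * u⁻¹ := by group
    have h5 : v * b * u⁻¹ * (u * r * u⁻¹) =
        b * (u * (u⁻¹ * b⁻¹ * v * b * r) * u⁻¹) := by group
    rw [h5, h3]; group

end Sapir

/-! ### The universal property of `G` in terms of the square complex. -/

namespace Sapir

open AutGroup SquareComplex

section Lift

variable {Γ : Type} [Group Γ]

/-- Elements of a group that satisfy the relations of `G` determine a homomorphism. -/
def lift (u v b r : Γ) (h₁ : u ^ 2 = v ^ 2) (h₂ : b * v * b * u = b⁻¹ * u * b⁻¹ * v)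
    (h₃ : u⁻¹ * b⁻¹ * v * b * r = r * u⁻¹ * b⁻¹ * v * b) : G →* Γ :=
  PresentedGroup.toGroup (f := fun i => match i with | .u => u | .v => v | .b => b | .r => r) (by
    simp only [gRels, Set.mem_insert_iff, Set.mem_singleton_iff]
    rintro _ (rfl | rfl | rfl) <;>
      simpa [mul_inv_eq_one, ← mul_assoc, -mul_inv_rev])

variable {u v b r : Γ} {h₁ : u ^ 2 = v ^ 2} {h₂ : b * v * b * u = b⁻¹ * u * b⁻¹ * v}
  {h₃ : u⁻¹ * b⁻¹ * v * b * r = r * u⁻¹ * b⁻¹ * v * b}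

@[simp] lemma lift_u : lift u v b r h₁ h₂ h₃ (gGen .u) = u := PresentedGroup.toGroup.of _
@[simp] lemma lift_v : lift u v b r h₁ h₂ h₃ (gGen .v) = v := PresentedGroup.toGroup.of _
@[simp] lemma lift_b : lift u v b r h₁ h₂ h₃ (gGen .b) = b := PresentedGroup.toGroup.of _
@[simp] lemma lift_r : lift u v b r h₁ h₂ h₃ (gGen .r) = r := PresentedGroup.toGroup.of _

/-- `G` is the fundamental group of the square complex. -/
lemma exists_hom_of_squares {P : Letter Edge → Γ} (hinv : ∀ a, P (edgeInv a) = (P a)⁻¹)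
    (h : ∀ p ∈ squares, P p.1 * P p.2.1 * P p.2.2.1 * P p.2.2.2 = 1) :
    ∃ f : G →* Γ, ∀ a, f (edgeVal a) = P a := by
  have hinv' : ∀ e, P (e, false) = (P (e, true))⁻¹ := fun e => hinv (e, true)
  simp only [squares, List.forall_mem_cons, List.not_mem_nil, false_imp_iff, implies_true,
    and_true, hinv'] at h
  obtain ⟨h1, h2, h3, h4, h5⟩ := h
  have main : ∀ u v b s r q : Γ, u * u * v⁻¹ * v⁻¹ = 1 → v * b * u⁻¹ * s⁻¹ = 1 →
      s * s * b * b = 1 → b * r * b⁻¹ * q⁻¹ = 1 → s * r * s⁻¹ * q⁻¹ = 1 →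
      ∃ f : G →* Γ, f (gGen .u) = u ∧ f (gGen .v) = v ∧ f (gGen .b) = b ∧
        f (gGen .u * gGen .r * (gGen .u)⁻¹) = r ∧ s = v * b * u⁻¹ ∧ q = b * r * b⁻¹ := by
    intro u v b s r q h1 h2 h3 h4 h5
    rw [mul_inv_eq_one] at h2 h4 h5
    -- The second and fourth squares eliminate `s` and `q`.
    subst h2 h4
    have e1 : u ^ 2 = v ^ 2 := by
      rw [pow_two, pow_two, ← mul_inv_eq_one, mul_inv_rev, ← mul_assoc, h1]
    have e2 : b * v * b * u = b⁻¹ * u * b⁻¹ * v := by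
      have e3 : b * (v * b * u⁻¹) = b⁻¹ * (v * b * u⁻¹)⁻¹ := by
        generalize v * b * u⁻¹ = s at h3 ⊢
        have e4 : b * b = (s * s)⁻¹ := by
          rw [eq_inv_iff_mul_eq_one, mul_eq_one_comm, ← mul_assoc, h3]
        calc b * s = b⁻¹ * (b * b) * s := by group
          _ = b⁻¹ * s⁻¹ := by rw [e4]; group
      calc b * v * b * u = b * (v * b * u⁻¹) * u ^ 2 := by group
        _ = b⁻¹ * u * b⁻¹ * v := by rw [e3, e1]; group
    have e3 : u⁻¹ * b⁻¹ * v * b * (u⁻¹ * r * u) = u⁻¹ * r * u * u⁻¹ * b⁻¹ * v * b := by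
      have e4 : b⁻¹ * (v * b * u⁻¹) * r = r * (b⁻¹ * (v * b * u⁻¹)) := by
        rw [mul_inv_eq_iff_eq_mul] at h5
        rw [mul_assoc, h5]; group
      calc u⁻¹ * b⁻¹ * v * b * (u⁻¹ * r * u) = u⁻¹ * (b⁻¹ * (v * b * u⁻¹) * r) * u := by group
        _ = u⁻¹ * r * u * u⁻¹ * b⁻¹ * v * b := by rw [e4]; group
    exact ⟨lift u v b (u⁻¹ * r * u) e1 e2 e3, by simp, by simp, by simp, by simp [mul_assoc],
      rfl, rfl⟩
  obtain ⟨f, hu, hv, hb, hr, hs, hq⟩ := main _ _ _ _ _ _ h1 h2 h3 h4 h5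
  have key : ∀ e, f (edgeVal (e, true)) = P (e, true) := by
    intro e
    cases e
    · rw [edgeVal_u, hu]
    · rw [edgeVal_v, hv]
    · rw [edgeVal_b, hb]
    · rw [edgeVal_s, hs, map_mul, map_mul, map_inv, hu, hv, hb]
    · rw [edgeVal_r, hr]
    · rw [edgeVal_q, hq, map_mul, map_mul, map_inv, hb, hr]
  refine ⟨f, ?_⟩
  rintro ⟨e, _ | _⟩
  · rw [hinv', ← key, ← map_inv, ← edgeVal_inv]; rfl
  · exact key e

end Lift

/-! ### The coset system of `G` from its action on normal cube paths. -/

lemma squares_corner : ∀ p ∈ squares, complex.adj p.1 (edgeInv p.2.2.2) ∧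
    complex.tr p.1 (edgeInv p.2.2.2) = p.2.1 ∧
    complex.tr (edgeInv p.2.2.2) p.1 = edgeInv p.2.2.1 := by
  simp only [squares, List.forall_mem_cons, List.not_mem_nil, false_imp_iff, implies_true, and_true]
  exact ⟨⟨rfl, rfl, rfl⟩, ⟨rfl, rfl, rfl⟩, ⟨rfl, rfl, rfl⟩, ⟨rfl, rfl, rfl⟩, ⟨rfl, rfl, rfl⟩⟩

/-- Continuing paths is a right action, so inverses are taken to get a homomorphism; the square
relations for it are `actEquiv_square`. -/
lemma exists_isAction : ∃ ρ : G →* Equiv.Perm complex.NormalPath, complex.IsAction edgeVal ρ := by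
  have hinv : ∀ a, (complex.actEquiv (edgeInv a))⁻¹ = ((complex.actEquiv a)⁻¹)⁻¹ := fun a =>
    congrArg _ (Data.actEquiv_inv a)
  obtain ⟨ρ, hρ⟩ := exists_hom_of_squares (P := fun a => (complex.actEquiv a)⁻¹) hinv (by
    intro p hp
    obtain ⟨h1, h2, h3⟩ := squares_corner p hp
    have h4 := Data.actEquiv_square h1
    have h5 : ∀ a, complex.actEquiv (edgeInv a) = (complex.actEquiv a)⁻¹ := Data.actEquiv_inv
    rw [h2, h3, h5, h5] at h4
    have h6 : (complex.actEquiv p.1)⁻¹ * (complex.actEquiv p.2.1)⁻¹ =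
        complex.actEquiv p.2.2.2 * complex.actEquiv p.2.2.1 := by
      rw [← mul_inv_rev, h4]; group
    rw [h6]; group)
  exact ⟨ρ, ⟨hρ⟩⟩

lemma diagonal_t : edgeVal (.u, true) * edgeVal (complex.tr (.u, true) (.v, true)) =
    gGen .u ^ 2 := by
  rw [show complex.tr (.u, true) (.v, true) = (.u, true) from rfl, edgeVal_u, pow_two]

lemma diagonal_p : edgeVal (.b, true) * edgeVal (complex.tr (.b, true) (.b, false)) =
    gGen .b * gGen .v * gGen .b * (gGen .u)⁻¹ := by
  rw [show complex.tr (.b, true) (.b, false) = (.s, true) from rfl, edgeVal_b, edgeVal_s]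
  group

lemma edgeVal_square (a b : Letter Edge) (h : complex.adj a b) :
    edgeVal a * edgeVal (complex.tr a b) = edgeVal b * edgeVal (complex.tr b a) :=
  square_relation edgeVal_inv edgeVal_squares a b h

lemma realizes : complex.Realizes edgeVal (Y ∪ Y⁻¹ ∪ {1}) := by
  have ht : gGen .u ^ 2 ∈ Y ∪ Y⁻¹ ∪ {1} := by simp [Y]
  have hp : gGen .b * gGen .v * gGen .b * (gGen .u)⁻¹ ∈ Y ∪ Y⁻¹ ∪ {1} := by simp [Y]
  have hinv : ∀ y ∈ Y ∪ Y⁻¹ ∪ {1}, y⁻¹ ∈ Y ∪ Y⁻¹ ∪ {1} := by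
    rintro y ((h | h) | h)
    · exact Or.inl (Or.inr (by simpa using h))
    · exact Or.inl (Or.inl h)
    · rw [Set.mem_singleton_iff.1 h, inv_one]; exact Or.inr rfl
  have hdiag : ∀ a b, complex.diag a b →
      edgeVal a * edgeVal (complex.tr a b) ∈ Y ∪ Y⁻¹ ∪ {1} := by
    intro a b h
    have h0 : (a, b) ∈ [((Edge.u, true), (Edge.v, true)), ((.v, true), (.u, true)),
      ((.b, true), (.b, false)), ((.b, false), (.b, true))] := of_decide_eq_true h
    simp only [List.mem_cons, Prod.mk.injEq, List.not_mem_nil, or_false] at h0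
    rcases h0 with ⟨rfl, rfl⟩ | ⟨rfl, rfl⟩ | ⟨rfl, rfl⟩ | ⟨rfl, rfl⟩
    · rwa [diagonal_t]
    · rw [edgeVal_square _ _ (by decide)]
      rwa [diagonal_t]
    · rwa [diagonal_p]
    · rw [edgeVal_square _ _ (by decide)]
      rwa [diagonal_p]
  refine ⟨edgeVal_inv, edgeVal_square, Or.inr rfl, fun a ha => ?_, hdiag⟩
  -- The edges `a` and `flip a` differ by the inverse of a distinguished diagonal.
  obtain ⟨h1, h2⟩ := complex.adj_flip a ha
  have h3 := hinv _ (hdiag _ _ h2)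
  rwa [Data.tr_inv_tr h1, edgeVal_inv, mul_inv_rev, inv_inv] at h3

lemma closure_Y : Subgroup.closure Y = H := by
  apply le_antisymm
  · rw [Subgroup.closure_le]
    rintro _ (rfl | rfl)
    · exact Subgroup.subset_closure (by simp)
    · have h1 : gGen .u ^ 2 ∈ H := Subgroup.subset_closure (by simp)
      have h2 : gGen .b * gGen .v * gGen .b * gGen .u ∈ H := Subgroup.subset_closure (by simp)
      have h3 := H.mul_mem h2 (H.inv_mem h1)
      rw [SetLike.mem_coe]
      convert h3 using 1
      group
  · rw [H, Subgroup.closure_le]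
    rintro _ (rfl | rfl)
    · exact Subgroup.subset_closure (by simp [Y])
    · have h1 : gGen .u ^ 2 ∈ Subgroup.closure Y := Subgroup.subset_closure (by simp [Y])
      have h2 : gGen .b * gGen .v * gGen .b * (gGen .u)⁻¹ ∈ Subgroup.closure Y :=
        Subgroup.subset_closure (by simp [Y])
      have h3 := mul_mem h2 h1
      rw [SetLike.mem_coe]
      convert h3 using 1
      group

lemma Y_subset_H : Y ∪ Y⁻¹ ∪ {1} ⊆ (H : Set G) := by
  have h : ∀ y ∈ Y, y ∈ H := fun y hy => closure_Y ▸ Subgroup.subset_closure hy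
  rintro y ((hy | hy) | rfl)
  · exact h y hy
  · exact inv_inv y ▸ H.inv_mem (h _ hy)
  · exact H.one_mem

lemma closure_range_gGen : Subgroup.closure (Set.range gGen) = ⊤ := by
  have : (gGen : GGen → G) = fun i => PresentedGroup.of i := rfl
  exact PresentedGroup.closure_range_of gRels

lemma closure_range_edgeVal : Subgroup.closure (Set.range edgeVal) = ⊤ := by
  rw [eq_top_iff, ← closure_range_gGen, Subgroup.closure_le]
  have h : ∀ a, edgeVal a ∈ Subgroup.closure (Set.range edgeVal) := fun a =>
    Subgroup.subset_closure ⟨a, rfl⟩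
  rintro _ ⟨_ | _ | _ | _, rfl⟩
  · rw [← edgeVal_u]; exact h _
  · rw [← edgeVal_v]; exact h _
  · rw [← edgeVal_b]; exact h _
  · have := mul_mem (mul_mem (inv_mem (h (.u, true))) (h (.r, true))) (h (.u, true))
    rw [edgeVal_u, edgeVal_r] at this
    rw [SetLike.mem_coe]
    convert this using 1
    group

/-- Walking along `u, u` or `b, s` from the constant path completes a distinguished square, which
collapses; so the generators in `Y` fix the constant path. -/
lemma apply_nilPath {ρ : G →* Equiv.Perm complex.NormalPath} (A : complex.IsAction edgeVal ρ) :
    ∀ h ∈ H, ρ h complex.nilPath = complex.nilPath := by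
  have h0 : H ≤ (MulAction.stabilizer (Equiv.Perm complex.NormalPath) complex.nilPath).comap ρ := by
    rw [← closure_Y, Subgroup.closure_le]
    have key : ∀ a b, complex.act (complex.act [] a) b = [] →
        ρ (edgeVal a * edgeVal b) complex.nilPath = complex.nilPath := by
      intro a b h
      rw [← Equiv.Perm.eq_inv_iff_eq, ← map_inv, mul_inv_rev, map_mul, Equiv.Perm.mul_apply]
      apply Subtype.ext
      rw [A.apply_edge, A.apply_edge]
      exact h.symm
    rintro _ (rfl | rfl)
    · rw [← diagonal_t]; exact key _ _ (by decide)
    · rw [← diagonal_p]; exact key _ _ (by decide)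
  exact fun h hh => h0 hh

/-- The language of coset representatives. -/
def cosetLanguage : Language (Letter GGen) := complex.pathLanguage code

lemma isRegular_cosetLanguage : cosetLanguage.IsRegular := Data.isRegular_pathLanguage code

lemma meetsCosets : MeetsCosets gGen H cosetLanguage :=
  Data.meetsCosets_pathLanguage realizes Y_subset_H closure_range_edgeVal (fun _ => rfl)
    length_code

lemma fellowTravels (γ : G) : FellowTravels gGen H cosetLanguage γ := by
  obtain ⟨ρ, A⟩ := exists_isAction
  exact Data.fellowTravels_pathLanguage realizes Y_subset_H closure_range_edgeVal A
    (apply_nilPath A) (fun _ => rfl) length_code γ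

lemma cosetLanguage_unique {w y : List (Letter GGen)} (hw : w ∈ cosetLanguage)
    (hy : y ∈ cosetLanguage) {h : G} (hh : h ∈ H)
    (e : wordVal gGen w = h * wordVal gGen y) : w = y := by
  obtain ⟨ρ, A⟩ := exists_isAction
  exact Data.pathLanguage_unique A (apply_nilPath A) (fun _ => rfl) hw hy hh e

lemma efficient {w y : List (Letter GGen)} (hw : w ∈ cosetLanguage)
    (hy : y ∈ cosetLanguage) {b : G} (hb : b ∈ Y ∪ Y⁻¹) {h : G} (hh : h ∈ H)
    (e : wordVal gGen w * b = h * wordVal gGen y) : h = 1 ∨ h ∈ Y ∪ Y⁻¹ := by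
  obtain ⟨ρ, A⟩ := exists_isAction
  have key : ∀ b' ∈ Y, ∀ w ∈ cosetLanguage, ∀ y ∈ cosetLanguage, ∀ h ∈ H,
      wordVal gGen w * b' = h * wordVal gGen y → h ∈ Y ∪ Y⁻¹ ∪ {1} := by
    rintro _ (rfl | rfl) w hw y hy h hh e
    · rw [← diagonal_t] at e
      exact Data.efficient_pathLanguage realizes Y_subset_H A (apply_nilPath A) (fun _ => rfl)
        length_code (by decide) hw hy hh e
    · rw [← diagonal_p] at e
      exact Data.efficient_pathLanguage realizes Y_subset_H A (apply_nilPath A) (fun _ => rfl)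
        length_code (by decide) hw hy hh e
  have h1 : h ∈ Y ∪ Y⁻¹ ∪ {1} := by
    rcases hb with hb | hb
    · exact key b hb w hw y hy h hh e
    -- For the inverse of an element of `Y` the words `w` and `y` exchange roles, and `h` becomes
    -- `h⁻¹`.
    · have := key _ hb y hy w hw h⁻¹ (H.inv_mem hh) (by
        rw [eq_inv_mul_iff_mul_eq, ← mul_assoc, ← e, mul_inv_cancel_right])
      rcases this with (h2 | h2) | h2
      · exact Or.inl (Or.inr h2)
      · exact Or.inl (Or.inl (by simpa using h2))
      · exact Or.inr (by simpa using h2)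
  rcases h1 with h1 | h1
  · exact Or.inr h1
  · exact Or.inl h1

instance : Finite GGen :=
  Finite.of_injective (β := Fin 4)
    (fun
      | .u => 0
      | .v => 1
      | .b => 2
      | .r => 3)
    (by rintro (_ | _) (_ | _) <;> simp)

theorem isStrongAutomaticCosetSystem : IsStrongAutomaticCosetSystem gGen H cosetLanguage :=
  isStrongAutomaticCosetSystem_of_fellowTravels isRegular_cosetLanguage meetsCosets fellowTravels

theorem isEfficient : IsEfficient gGen H cosetLanguage Y :=
  ⟨by simp [Y], closure_Y, fun _ hw _ hy _ hb _ hh e => efficient hw hy hb hh e⟩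

end Sapir

namespace Sapir

open AutGroup

/-! ### `H` is free of rank 2 -/

section Free

/-- The free basis `Y` of `H` as a family. -/
def yFamily : Fin 2 → G :=
  ![gGen .u ^ 2, gGen .b * gGen .v * gGen .b * (gGen .u)⁻¹]

/-- The homomorphism from the free group of rank 2 that sends the generators to `Y`. -/
def freeHom : FreeGroup (Fin 2) →* G :=
  FreeGroup.lift yFamily

lemma freeHom_zero : freeHom (FreeGroup.of 0) = gGen .u ^ 2 := by simp [freeHom, yFamily]

lemma freeHom_one : freeHom (FreeGroup.of 1) = gGen .b * gGen .v * gGen .b * (gGen .u)⁻¹ := by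
  simp [freeHom, yFamily]

/-- A permutation of four copies of the free group whose square translates the first copy. -/
def permU : Equiv.Perm (FreeGroup (Fin 2) × Fin 4) where
  toFun
    | (f, 0) => (f, 1)
    | (f, 1) => (FreeGroup.of 0 * f, 0)
    | (f, 2) => (f, 3)
    | (f, 3) => (f, 2)
  invFun
    | (f, 0) => ((FreeGroup.of 0)⁻¹ * f, 1)
    | (f, 1) => (f, 0)
    | (f, 2) => (f, 3)
    | (f, 3) => (f, 2)
  left_inv := by rintro ⟨f, i⟩; fin_cases i <;> simp
  right_inv := by rintro ⟨f, i⟩; fin_cases i <;> simp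

/-- An involution of four copies of the free group. -/
def permB : Equiv.Perm (FreeGroup (Fin 2) × Fin 4) :=
  Function.Involutive.toPerm
    (fun
      | (f, 0) => ((FreeGroup.of 0)⁻¹ * (FreeGroup.of 1)⁻¹ * f, 3)
      | (f, 1) => (f, 2)
      | (f, 2) => (f, 1)
      | (f, 3) => (FreeGroup.of 1 * FreeGroup.of 0 * f, 0))
    (by rintro ⟨f, i⟩; fin_cases i <;> simp [mul_assoc])

lemma permB_inv : permB⁻¹ = permB := rfl

/-- An action of `G` in which `H` acts on one orbit as the free group. -/
def freeAction : G →* Equiv.Perm (FreeGroup (Fin 2) × Fin 4) :=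
  -- With `u` and `v` acting alike, `b` as an involution and `r` trivially, all relations of `G` are
  -- immediate.
  lift permU permU permB 1 rfl (by rw [permB_inv]) (by simp)

/-- The element `u²` returns to copy `0` with a factor `of 0`, while `bvbu⁻¹` visits the copies `0,
1, 2, 3, 0` and leaves the factor `of 1`. So `w` can be read off from its action on `(1, 0)`. -/
lemma freeAction_freeHom (w f : FreeGroup (Fin 2)) :
    freeAction (freeHom w) (f, 0) = (w * f, 0) := by
  induction w using FreeGroup.induction_on generalizing f with
  | C1 => simp
  | of i =>
    fin_cases i
    · change freeAction (freeHom (FreeGroup.of 0)) (f, 0) = _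
      rw [freeHom_zero, pow_two, map_mul, Equiv.Perm.mul_apply]
      simp only [freeAction, lift_u]
      rfl
    · change freeAction (freeHom (FreeGroup.of 1)) (f, 0) = (FreeGroup.of 1 * f, 0)
      rw [freeHom_one]
      simp only [freeAction, map_mul, map_inv, Equiv.Perm.mul_apply, lift_u, lift_v, lift_b]
      change (FreeGroup.of 1 * FreeGroup.of 0 * ((FreeGroup.of 0)⁻¹ * f), (0 : Fin 4)) = _
      simp [mul_assoc]
  | inv_of i h =>
    rw [map_inv, map_inv, Equiv.Perm.inv_eq_iff_eq, h, mul_inv_cancel_left]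
  | mul v w h1 h2 => rw [map_mul, map_mul, Equiv.Perm.mul_apply, h2, h1, mul_assoc]

lemma freeHom_injective : Function.Injective freeHom := by
  intro v w h
  have h1 := freeAction_freeHom v 1
  rw [h, freeAction_freeHom] at h1
  simpa using (Prod.mk.inj h1).1.symm

lemma range_freeHom : freeHom.range = H := by
  rw [← closure_Y, freeHom, FreeGroup.range_lift_eq_closure]
  congr 1
  simp [Y, yFamily, Set.pair_comm]

/-- `H` is free on `Y`. -/
noncomputable def freeEquiv : FreeGroup (Fin 2) ≃* H :=
  (MonoidHom.ofInjective freeHom_injective).trans (MulEquiv.subgroupCongr range_freeHom)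

end Free

/-! ### `K` is an HNN extension of `G` -/

section HNN

lemma relation_a : kGen .x * kGen .a * kGen .x * kGen .a = kGen .t := by
  have h : PresentedGroup.mk kRels _ = 1 := PresentedGroup.one_of_mem
    (show (FreeGroup.of .x * FreeGroup.of .a * FreeGroup.of .x * FreeGroup.of .a) *
      (FreeGroup.of .t)⁻¹ ∈ kRels by simp [kRels])
  simp only [map_mul, map_inv] at h
  exact mul_inv_eq_one.1 h

lemma relation_b : kGen .b * kGen .x * kGen .b * kGen .x = kGen .t := by
  have h : PresentedGroup.mk kRels _ = 1 := PresentedGroup.one_of_mem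
    (show (FreeGroup.of .b * FreeGroup.of .x * FreeGroup.of .b * FreeGroup.of .x) *
      (FreeGroup.of .t)⁻¹ ∈ kRels by simp [kRels])
  simp only [map_mul, map_inv] at h
  exact mul_inv_eq_one.1 h

lemma relation_ab : kGen .b * kGen .b * kGen .t * kGen .a * kGen .a = kGen .t := by
  have h : PresentedGroup.mk kRels _ = 1 := PresentedGroup.one_of_mem
    (show (FreeGroup.of .b * FreeGroup.of .b * FreeGroup.of .t * FreeGroup.of .a *
      FreeGroup.of .a) * (FreeGroup.of .t)⁻¹ ∈ kRels by simp [kRels])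
  simp only [map_mul, map_inv] at h
  exact mul_inv_eq_one.1 h

lemma relation_abr : (kGen .a)⁻¹ * kGen .b * kGen .r = kGen .r * (kGen .a)⁻¹ * kGen .b := by
  have h : PresentedGroup.mk kRels _ = 1 := PresentedGroup.one_of_mem
    (show ((FreeGroup.of .a)⁻¹ * FreeGroup.of .b * FreeGroup.of .r) *
      (FreeGroup.of .r * (FreeGroup.of .a)⁻¹ * FreeGroup.of .b)⁻¹ ∈ kRels by simp [kRels])
  simp only [map_mul, map_inv] at h
  exact mul_inv_eq_one.1 h

lemma relation_zt : kGen .z * kGen .t = kGen .t * kGen .z := by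
  have h : PresentedGroup.mk kRels _ = 1 := PresentedGroup.one_of_mem
    (show (FreeGroup.of .z * FreeGroup.of .t) * (FreeGroup.of .t * FreeGroup.of .z)⁻¹ ∈ kRels by
      simp [kRels])
  simp only [map_mul, map_inv] at h
  exact mul_inv_eq_one.1 h

lemma relation_z : kGen .b * kGen .t * kGen .a * kGen .z =
    kGen .z * kGen .b * kGen .t * kGen .a := by
  have h : PresentedGroup.mk kRels _ = 1 := PresentedGroup.one_of_mem
    (show (FreeGroup.of .b * FreeGroup.of .t * FreeGroup.of .a * FreeGroup.of .z) *
      (FreeGroup.of .z * FreeGroup.of .b * FreeGroup.of .t * FreeGroup.of .a)⁻¹ ∈ kRels by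
      simp [kRels])
  simp only [map_mul, map_inv] at h
  exact mul_inv_eq_one.1 h

/-- The HNN extension of `G` in which the stable letter centralizes `H`. -/
abbrev Ext : Type := HNNExtension G H H (MulEquiv.refl H)

lemma ext_t_mul_of {h : G} (hh : h ∈ H) :
    (HNNExtension.t : Ext) * HNNExtension.of h = HNNExtension.of h * HNNExtension.t :=
  HNNExtension.t_mul_of (⟨h, hh⟩ : H)

/-- The images of the generators of `K` in the HNN extension. -/
def extGen : KGen → Ext
  | .a => HNNExtension.of ((gGen .v)⁻¹ * gGen .b * gGen .u)
  | .b => HNNExtension.of (gGen .b)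
  | .r => HNNExtension.of (gGen .r)
  | .t => HNNExtension.of (gGen .u ^ 2)
  | .x => HNNExtension.of ((gGen .b)⁻¹ * gGen .v)
  | .z => HNNExtension.t

lemma u_sq_mem : gGen .u ^ 2 ∈ H := Subgroup.subset_closure (by simp)

lemma bvbu_mem : gGen .b * gGen .v * gGen .b * gGen .u ∈ H := Subgroup.subset_closure (by simp)

/-- The substitution is `t = u²`, `x = b⁻¹v`, `a = v⁻¹bu`. The last identity says that `bta` becomes
the generator `bvbu` of `H`, so the relations of `z` become centralization of `H`. -/
lemma kRelations_of_gRelations {Γ : Type} [Group Γ] {u v b r : Γ} (h₁ : u ^ 2 = v ^ 2)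
    (h₂ : b * v * b * u = b⁻¹ * u * b⁻¹ * v)
    (h₃ : u⁻¹ * b⁻¹ * v * b * r = r * u⁻¹ * b⁻¹ * v * b) :
    b⁻¹ * v * (v⁻¹ * b * u) * (b⁻¹ * v) * (v⁻¹ * b * u) = u ^ 2 ∧
    b * (b⁻¹ * v) * b * (b⁻¹ * v) = u ^ 2 ∧
    b * b * u ^ 2 * (v⁻¹ * b * u) * (v⁻¹ * b * u) = u ^ 2 ∧
    (v⁻¹ * b * u)⁻¹ * b * r = r * (v⁻¹ * b * u)⁻¹ * b ∧
    b * u ^ 2 * (v⁻¹ * b * u) = b * v * b * u := by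
  refine ⟨by rw [pow_two]; group, by rw [h₁, pow_two]; group, ?_, ?_, by rw [h₁]; group⟩
  · calc b * b * u ^ 2 * (v⁻¹ * b * u) * (v⁻¹ * b * u)
        = b * (b * v * b * u) * (v⁻¹ * b * u) := by rw [h₁]; group
      _ = u ^ 2 := by rw [h₂, pow_two]; group
  · calc (v⁻¹ * b * u)⁻¹ * b * r = u⁻¹ * b⁻¹ * v * b * r := by group
      _ = r * (v⁻¹ * b * u)⁻¹ * b := by rw [h₃]; group

/-- The homomorphism from `K` to the HNN extension. -/
def toExt : K →* Ext :=
  PresentedGroup.toGroup (f := extGen) (by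
    obtain ⟨h1, h2, h3, h4, h5⟩ := kRelations_of_gRelations relation_uv relation_ubv relation_r
    have h6 := ext_t_mul_of bvbu_mem
    simp only [kRels, Set.mem_insert_iff, Set.mem_singleton_iff]
    rintro _ (rfl | rfl | rfl | rfl | rfl | rfl) <;>
      simp only [map_mul, map_inv, FreeGroup.lift_apply_of, mul_inv_eq_one] <;>
      simp only [extGen] <;> try simp only [← map_mul, ← map_inv]
    · rw [h1]
    · rw [h2]
    · rw [h3]
    · rw [h4]
    · exact ext_t_mul_of u_sq_mem
    · rw [h5, ← h6, ← h5]
      simp only [map_mul, mul_assoc])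

lemma toExt_kGen (i : KGen) : toExt (kGen i) = extGen i := PresentedGroup.toGroup.of _

/-- The homomorphism from `G` to `K`. -/
def gToK : G →* K :=
  lift (kGen .x * kGen .a) (kGen .b * kGen .x) (kGen .b) (kGen .r)
    (by rw [pow_two, pow_two, ← mul_assoc, ← mul_assoc, relation_a, relation_b])
    (by
      calc kGen .b * (kGen .b * kGen .x) * kGen .b * (kGen .x * kGen .a)
          = kGen .b * (kGen .b * kGen .x * kGen .b * kGen .x) * kGen .a := by group
        _ = (kGen .b)⁻¹ * (kGen .b * kGen .b * kGen .t * kGen .a * kGen .a) * (kGen .a)⁻¹ := by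
          rw [relation_b]; group
        _ = _ := by rw [relation_ab, ← relation_a]; group)
    (by
      calc (kGen .x * kGen .a)⁻¹ * (kGen .b)⁻¹ * (kGen .b * kGen .x) * kGen .b * kGen .r
          = (kGen .a)⁻¹ * kGen .b * kGen .r := by group
        _ = _ := by rw [relation_abr]; group)

lemma z_mul_gToK {h : G} (hh : h ∈ H) : kGen .z * gToK h = gToK h * kGen .z := by
  have h0 : H ≤ (Subgroup.centralizer {kGen .z}).comap gToK := by
    rw [H, Subgroup.closure_le]
    rintro _ (rfl | rfl) <;>
      rw [SetLike.mem_coe, Subgroup.mem_comap, Subgroup.mem_centralizer_singleton_iff]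
    · have : gToK (gGen .u ^ 2) = kGen .t := by
        simp only [gToK, map_pow, lift_u]
        rw [pow_two, ← mul_assoc, relation_a]
      rw [this, relation_zt]
    · have : gToK (gGen .b * gGen .v * gGen .b * gGen .u) = kGen .b * kGen .t * kGen .a := by
        simp only [gToK, map_mul, lift_u, lift_v, lift_b]
        rw [← relation_b]; group
      rw [this, relation_z]; group
  have h1 := h0 hh
  rw [Subgroup.mem_comap, Subgroup.mem_centralizer_singleton_iff] at h1
  first | exact h1 | exact h1.symm

/-- The homomorphism from the HNN extension to `K`. -/
def ofExt : Ext →* K := HNNExtension.lift gToK (kGen .z) (fun h => z_mul_gToK h.2)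

lemma ofExt_of (g : G) : ofExt (HNNExtension.of g) = gToK g := HNNExtension.lift_of _ _ _ _

lemma ofExt_t : ofExt HNNExtension.t = kGen .z := HNNExtension.lift_t _ _ _

/-- `K` is the HNN extension of `G` in which the stable letter centralizes `H`. -/
def kEquiv : K ≃* Ext :=
  MonoidHom.toMulEquiv toExt ofExt
    (by
      refine PresentedGroup.ext fun i => ?_
      change ofExt (toExt (kGen i)) = kGen i
      rw [toExt_kGen]
      cases i <;> simp only [extGen, ofExt_of, ofExt_t, gToK, map_mul, map_inv, map_pow, lift_u,
        lift_v, lift_b, lift_r]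
      · group
      · rw [pow_two, ← mul_assoc, relation_a]
      · group)
    (by
      have hx : toExt (kGen .x) = _ := toExt_kGen .x
      have ha : toExt (kGen .a) = _ := toExt_kGen .a
      have hb : toExt (kGen .b) = _ := toExt_kGen .b
      have hr : toExt (kGen .r) = _ := toExt_kGen .r
      refine HNNExtension.hom_ext (PresentedGroup.ext fun i => ?_) ?_
      · change toExt (ofExt (HNNExtension.of (gGen i))) = HNNExtension.of (gGen i)
        rw [ofExt_of]
        cases i <;> simp only [gToK, lift_u, lift_v, lift_b, lift_r, map_mul, hx, ha, hb, hr]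
        · simp only [extGen, ← map_mul]; congr 1; group
        · simp only [extGen, ← map_mul]; congr 1; group
        · rfl
        · rfl
      · change toExt (ofExt HNNExtension.t) = HNNExtension.t
        rw [ofExt_t, toExt_kGen]; rfl)

theorem kEquiv_apply (k : K) : kEquiv k = toExt k := rfl

end HNN

end Sapir

namespace AutGroup

/-! ### Asynchronous automata that synchronize at separating letters -/

section Async

variable {J E Q : Type} [Group E]

/-- The phases of an automaton that reads two tapes alternately, where the tape that reaches a
separating letter first waits until the other tape reaches one as well. -/
inductive Phase : Type
  | left
  | right
  | waitLeft
  | waitRight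

instance : Finite Phase :=
  Finite.of_injective (β := Bool × Bool)
    (fun
      | .left => (true, true)
      | .right => (true, false)
      | .waitLeft => (false, true)
      | .waitRight => (false, false))
    (by rintro (_ | _) (_ | _) <;> simp)

/-- The tape that is read in a phase. -/
def Phase.side : Phase → Side
  | .left => .left
  | .waitRight => .left
  | .right => .right
  | .waitLeft => .right

/-- The next phase, depending on whether the letter is separating. -/
def Phase.next : Phase → Bool → Phase
  | .left, false => .right
  | .left, true => .waitLeft
  | .right, false => .left
  | .right, true => .waitRight
  | .waitLeft, false => .waitLeft
  | .waitLeft, true => .left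
  | .waitRight, false => .waitRight
  | .waitRight, true => .left

/-- The tape that is read when the end markers on the tapes of `l`, `r` have been read. -/
def Phase.turn (p : Phase) (l r : Bool) : Side :=
  if l then .right else if r then .left else p.side

/-- The alternating reading of two tapes keeps the difference of the prefixes in `U`.  A tape is
`none` after its end marker has been read. -/
inductive Stays (x : J → E) (sep : J → Bool) (U : Set E) :
    Phase → Option (List (Letter J)) → Option (List (Letter J)) → E → Prop
  | done (p : Phase) (d : E) : Stays x sep U p none none d
  | leftEnd (p : Phase) (r : Option (List (Letter J))) (d : E) :
      p.turn false r.isNone = .left → Stays x sep U p none r d → Stays x sep U p (some []) r d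
  | rightEnd (p : Phase) (l : Option (List (Letter J))) (d : E) :
      p.turn l.isNone false = .right → Stays x sep U p l none d → Stays x sep U p l (some []) d
  | leftLetter (p : Phase) (a : Letter J) (w : List (Letter J)) (r : Option (List (Letter J)))
      (d : E) : p.turn false r.isNone = .left → (letterVal x a)⁻¹ * d ∈ U →
      Stays x sep U (p.next (sep a.1)) (some w) r ((letterVal x a)⁻¹ * d) →
      Stays x sep U p (some (a :: w)) r d
  | rightLetter (p : Phase) (a : Letter J) (w : List (Letter J)) (l : Option (List (Letter J)))
      (d : E) : p.turn l.isNone false = .right → d * letterVal x a ∈ U →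
      Stays x sep U (p.next (sep a.1)) l (some w) (d * letterVal x a) →
      Stays x sep U p l (some (a :: w)) d

/-- A state of the alternating automaton: the states of two copies of a finite automaton, the
phase, whether the end markers have been read, and the difference of the prefixes. -/
structure AltState (Q : Type) (U : Set E) : Type where
  fst : Q
  snd : Q
  phase : Phase
  fstEnd : Bool
  sndEnd : Bool
  diff : U

instance {U : Set E} [Finite Q] [Finite U] : Finite (AltState Q U) :=
  Finite.of_injective (fun s => (s.fst, s.snd, s.phase, s.fstEnd, s.sndEnd, s.diff)) (by
    rintro ⟨⟩ ⟨⟩ h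
    simpa using h)

open Classical in
/-- The alternating automaton. -/
noncomputable def altAutomaton (x : J → E) (sep : J → Bool) (U : Set E) (A : DFA (Letter J) Q)
    (one_mem : 1 ∈ U) (g : E) : AsyncDFA (Letter J) (Option (AltState Q U)) where
  side
    | none => .left
    | some s => s.phase.turn s.fstEnd s.sndEnd
  step
    | none, _ => none
    | some s, none =>
      match s.phase.turn s.fstEnd s.sndEnd with
      | .left => some { s with fstEnd := true }
      | .right => some { s with sndEnd := true }
    | some s, some a =>
      match s.phase.turn s.fstEnd s.sndEnd with
      | .left =>
        if h : (letterVal x a)⁻¹ * s.diff.1 ∈ U then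
          some { s with fst := A.step s.fst a, phase := s.phase.next (sep a.1), diff := ⟨_, h⟩ }
        else none
      | .right =>
        if h : s.diff.1 * letterVal x a ∈ U then
          some { s with snd := A.step s.snd a, phase := s.phase.next (sep a.1), diff := ⟨_, h⟩ }
        else none
  start := some ⟨A.start, A.start, .left, false, false, ⟨1, one_mem⟩⟩
  accept := {s | ∃ t ∈ s, t.fst ∈ A.accept ∧ t.snd ∈ A.accept ∧ t.diff.1 = g}

lemma AsyncDFA.evalFrom_left {α σ : Type} (M : AsyncDFA α σ) {s : σ} (h : M.side s = .left)
    (c : Option α) (p q : List (Option α)) :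
    M.evalFrom s (c :: p) q = M.evalFrom (M.step s c) p q := by
  cases q with
  | nil => rw [evalFrom]
  | cons d q => rw [evalFrom, h]

lemma AsyncDFA.evalFrom_right {α σ : Type} (M : AsyncDFA α σ) {s : σ} (h : M.side s = .right)
    (d : Option α) (p q : List (Option α)) :
    M.evalFrom s p (d :: q) = M.evalFrom (M.step s d) p q := by
  cases p with
  | nil => rw [evalFrom]
  | cons c p => rw [evalFrom, h]

/-- The remaining contents of a tape. -/
def restTape {α : Type} : Option (List α) → List (Option α)
  | none => []
  | some w => tape w

variable {x : J → E} {sep : J → Bool} {U : Set E} {A : DFA (Letter J) Q} {one_mem : 1 ∈ U} {g : E}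

lemma altAutomaton_evalFrom_none (p q : List (Option (Letter J))) :
    (altAutomaton x sep U A one_mem g).evalFrom none p q = none := by
  induction p with
  | nil =>
    induction q with
    | nil => rw [AsyncDFA.evalFrom]
    | cons d q ih => rw [AsyncDFA.evalFrom]; exact ih
  | cons c p ih => rw [AsyncDFA.evalFrom_left _ rfl]; exact ih

/-- The word that is left on a tape. -/
abbrev restWord {α : Type} (l : Option (List α)) : List α := l.getD []

/-- Induction on the number of unread symbols. A run whose difference leaves `U` falls into the
absorbing state `none`, so a surviving run has computed the true difference. -/
lemma altAutomaton_sound (n : ℕ) : ∀ (l r : Option (List (Letter J))) (s : AltState Q U)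
    (s' : AltState Q U), (restTape l).length + (restTape r).length = n →
    s.fstEnd = l.isNone → s.sndEnd = r.isNone →
    (altAutomaton x sep U A one_mem g).evalFrom (some s) (restTape l) (restTape r) = some s' →
    s'.fst = A.evalFrom s.fst (restWord l) ∧ s'.snd = A.evalFrom s.snd (restWord r) ∧
      s'.diff.1 = (wordVal x (restWord l))⁻¹ * s.diff.1 * wordVal x (restWord r) := by
  induction n with
  | zero =>
    rintro (_ | w) (_ | y) s s' hn h1 h2 h3 <;> simp [restTape, tape] at hn
    simp only [restTape] at h3
    rw [AsyncDFA.evalFrom] at h3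
    obtain rfl := Option.some.inj h3
    simp [wordVal_nil]
  | succ n ih =>
    intro l r s s' hn h1 h2 h3
    rcases ht : s.phase.turn s.fstEnd s.sndEnd with _ | _
    · rcases l with _ | _ | ⟨a, w⟩
      · simp [h1, Phase.turn] at ht
      · have h4 := (AsyncDFA.evalFrom_left (altAutomaton x sep U A one_mem g) (s := some s) ht none
          [] (restTape r)).symm.trans h3
        simp only [altAutomaton, ht] at h4
        simpa using ih none r { s with fstEnd := true } s' (by
          simp [restTape, tape] at hn ⊢; omega) rfl h2 h4
      · have h4 := (AsyncDFA.evalFrom_left (altAutomaton x sep U A one_mem g) (s := some s) ht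
          (some a) (tape w) (restTape r)).symm.trans h3
        by_cases hU : (letterVal x a)⁻¹ * s.diff.1 ∈ U
        · have h5 : (altAutomaton x sep U A one_mem g).step (some s) (some a) =
              some { s with fst := A.step s.fst a, phase := s.phase.next (sep a.1)
                            diff := ⟨_, hU⟩ } := by
            simp only [altAutomaton, ht, dif_pos hU]
          rw [h5] at h4
          obtain ⟨e1, e2, e3⟩ := ih (some w) r
            { s with fst := A.step s.fst a, phase := s.phase.next (sep a.1), diff := ⟨_, hU⟩ } s' (by
            simp [restTape, tape] at hn ⊢; omega) h1 h2 h4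
          refine ⟨e1, e2, ?_⟩
          rw [e3]
          simp [wordVal_cons, mul_assoc]
        · have h5 : (altAutomaton x sep U A one_mem g).step (some s) (some a) = none := by
            simp only [altAutomaton, ht, dif_neg hU]
          rw [h5, altAutomaton_evalFrom_none] at h4
          simp at h4
    · rcases r with _ | _ | ⟨a, w⟩
      · rcases l with _ | l
        · simp [restTape] at hn
        · simp [h1, h2, Phase.turn] at ht
      · have h4 := (AsyncDFA.evalFrom_right (altAutomaton x sep U A one_mem g) (s := some s) ht none
          (restTape l) []).symm.trans h3
        simp only [altAutomaton, ht] at h4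
        simpa using ih l none { s with sndEnd := true } s' (by
          simp [restTape, tape] at hn ⊢; omega) h1 rfl h4
      · have h4 := (AsyncDFA.evalFrom_right (altAutomaton x sep U A one_mem g) (s := some s) ht
          (some a) (restTape l) (tape w)).symm.trans h3
        by_cases hU : s.diff.1 * letterVal x a ∈ U
        · have h5 : (altAutomaton x sep U A one_mem g).step (some s) (some a) =
              some { s with snd := A.step s.snd a, phase := s.phase.next (sep a.1)
                            diff := ⟨_, hU⟩ } := by
            simp only [altAutomaton, ht, dif_pos hU]
          rw [h5] at h4
          obtain ⟨e1, e2, e3⟩ := ih l (some w)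
            { s with snd := A.step s.snd a, phase := s.phase.next (sep a.1), diff := ⟨_, hU⟩ } s' (by
            simp [restTape, tape] at hn ⊢; omega) h1 h2 h4
          refine ⟨e1, e2, ?_⟩
          rw [e3]
          simp [wordVal_cons, mul_assoc]
        · have h5 : (altAutomaton x sep U A one_mem g).step (some s) (some a) = none := by
            simp only [altAutomaton, ht, dif_neg hU]
          rw [h5, altAutomaton_evalFrom_none] at h4
          simp at h4

/-- `Stays` is the trace of the automaton: its constructors are the transitions that do not fail. -/
lemma altAutomaton_complete {p : Phase} {l r : Option (List (Letter J))} {d : E}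
    (h : Stays x sep U p l r d) : ∀ s : AltState Q U, s.phase = p → s.fstEnd = l.isNone →
      s.sndEnd = r.isNone → s.diff.1 = d → ∃ s' : AltState Q U,
      (altAutomaton x sep U A one_mem g).evalFrom (some s) (restTape l) (restTape r) =
        some s' := by
  induction h with
  | done p d =>
    intro s _ _ _ _
    exact ⟨s, by simp only [restTape]; rw [AsyncDFA.evalFrom]⟩
  | leftEnd p r d ht _ ih =>
    rintro s rfl h1 h2 rfl
    replace ht : s.phase.turn s.fstEnd s.sndEnd = .left := by rw [h1, h2]; exact ht
    obtain ⟨s', hs'⟩ := ih { s with fstEnd := true } rfl rfl h2 rfl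
    refine ⟨s', ?_⟩
    refine (AsyncDFA.evalFrom_left _ (s := some s) ht none [] (restTape r)).trans ?_
    simp only [altAutomaton, ht]
    exact hs'
  | rightEnd p l d ht _ ih =>
    rintro s rfl h1 h2 rfl
    replace ht : s.phase.turn s.fstEnd s.sndEnd = .right := by rw [h1, h2]; exact ht
    obtain ⟨s', hs'⟩ := ih { s with sndEnd := true } rfl h1 rfl rfl
    refine ⟨s', ?_⟩
    refine (AsyncDFA.evalFrom_right _ (s := some s) ht none (restTape l) []).trans ?_
    simp only [altAutomaton, ht]
    exact hs'
  | leftLetter p a w r d ht hU _ ih =>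
    rintro s rfl h1 h2 rfl
    replace ht : s.phase.turn s.fstEnd s.sndEnd = .left := by rw [h1, h2]; exact ht
    obtain ⟨s', hs'⟩ := ih { s with fst := A.step s.fst a, phase := s.phase.next (sep a.1)
                                    diff := ⟨_, hU⟩ } rfl h1 h2 rfl
    refine ⟨s', ?_⟩
    refine (AsyncDFA.evalFrom_left _ (s := some s) ht (some a) (tape w) (restTape r)).trans ?_
    simp only [altAutomaton, ht, dif_pos hU]
    exact hs'
  | rightLetter p a w l d ht hU _ ih =>
    rintro s rfl h1 h2 rfl
    replace ht : s.phase.turn s.fstEnd s.sndEnd = .right := by rw [h1, h2]; exact ht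
    obtain ⟨s', hs'⟩ := ih { s with snd := A.step s.snd a, phase := s.phase.next (sep a.1)
                                    diff := ⟨_, hU⟩ } rfl h1 h2 rfl
    refine ⟨s', ?_⟩
    refine (AsyncDFA.evalFrom_right _ (s := some s) ht (some a) (restTape l) (tape w)).trans ?_
    simp only [altAutomaton, ht, dif_pos hU]
    exact hs'

/-- A regular language of normal forms in which the multipliers keep the differences of the
alternating reading bounded is an asynchronously automatic structure. -/
theorem isAsynchronouslyAutomaticWith_of_stays [Finite J] (sep : J → Bool)
    {M : Language (Letter J)} (hM : M.IsRegular) (hsurj : ∀ g, ∃ w ∈ M, wordVal x w = g)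
    (h : ∀ a, ∃ k, ∀ w ∈ M, ∀ y ∈ M, wordVal x w * symbolVal x a = wordVal x y →
      Stays x sep {g | LengthLE x g k} .left (some w) (some y) 1) :
    IsAsynchronouslyAutomaticWith x := by
  refine ⟨M, hM, hsurj, fun a => ?_⟩
  obtain ⟨Q, _, A, rfl⟩ := hM
  obtain ⟨k, hk⟩ := h a
  have : Finite {g | LengthLE x g k} := finite_setOf_lengthLE x k
  refine ⟨_, Fintype.ofFinite _, altAutomaton x sep {g | LengthLE x g k} A (LengthLE.one x k)
    (symbolVal x a), fun w y => ?_⟩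
  constructor
  · rintro ⟨s', hs', h1, h2, h3⟩
    obtain ⟨e1, e2, e3⟩ := altAutomaton_sound _ (some w) (some y) _ s' rfl rfl rfl hs'
    rw [e1] at h1
    rw [e2] at h2
    refine ⟨h1, h2, ?_⟩
    rw [← h3, e3]
    simp
  · rintro ⟨h1, h2, h3⟩
    obtain ⟨s', hs'⟩ := altAutomaton_complete (A := A) (one_mem := LengthLE.one x k)
      (g := symbolVal x a) (hk w h1 y h2 h3)
      ⟨A.start, A.start, .left, false, false, ⟨1, LengthLE.one x k⟩⟩ rfl rfl rfl rfl
    obtain ⟨e1, e2, e3⟩ := altAutomaton_sound _ (some w) (some y) _ s' rfl rfl rfl hs'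
    refine ⟨s', hs', ?_, ?_, ?_⟩
    · rw [e1]; exact h1
    · rw [e2]; exact h2
    · rw [e3]; simp [← h3]

end Async

end AutGroup

namespace AutGroup

/-! ### Normal forms in an HNN extension whose stable letter centralizes a subgroup -/

section Centralizing

variable {ι Γ : Type} [Group Γ]

/-- The HNN extension in which the stable letter centralizes `H`. -/
abbrev CentralizingExt (Γ : Type) [Group Γ] (H : Subgroup Γ) : Type :=
  HNNExtension Γ H H (MulEquiv.refl H)

/-- The generators of the base group together with the stable letter. -/
def extFamily (x : ι → Γ) (H : Subgroup Γ) : Option ι → CentralizingExt Γ H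
  | some i => HNNExtension.of (x i)
  | none => HNNExtension.t

/-- A word in the generators of the base group as a word in the generators of the extension. -/
def baseWord (w : List (Letter ι)) : List (Letter (Option ι)) := w.map (Prod.map some id)

/-- The word `z^e₁ w₁ z^e₂ w₂ ⋯`, where `z` is the stable letter. -/
def tailWord (T : List (Bool × List (Letter ι))) : List (Letter (Option ι)) :=
  T.flatMap fun p => (none, p.1) :: baseWord p.2

/-- The words `w₁, w₂, …` lie in `L`, and there are no factors `z z⁻¹` or `z⁻¹ z`. -/
def IsTail (L : Language (Letter ι)) (T : List (Bool × List (Letter ι))) : Prop :=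
  (∀ p ∈ T, p.2 ∈ L) ∧ T.IsChain fun p q => p.2 = [] → p.1 = q.1

/-- The language of the words `w₀ z^e₁ w₁ z^e₂ w₂ ⋯` with `w₀ ∈ L₀` and `w₁, w₂, … ∈ L`, without
factors `z z⁻¹` or `z⁻¹ z`. -/
def normalWords (L₀ L : Language (Letter ι)) : Language (Letter (Option ι)) :=
  {W | ∃ w ∈ L₀, ∃ T, IsTail L T ∧ W = baseWord w ++ tailWord T}

variable {x : ι → Γ} {H : Subgroup Γ} {L₀ L : Language (Letter ι)}

lemma tailWord_cons (p : Bool × List (Letter ι)) (T : List (Bool × List (Letter ι))) :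
    tailWord (p :: T) = (none, p.1) :: (baseWord p.2 ++ tailWord T) := by simp [tailWord]

lemma letterVal_extFamily_some (i : ι) (c : Bool) :
    letterVal (extFamily x H) (some i, c) = HNNExtension.of (letterVal x (i, c)) := by
  cases c <;> simp [letterVal, extFamily]

lemma wordVal_baseWord (w : List (Letter ι)) :
    wordVal (extFamily x H) (baseWord w) = HNNExtension.of (wordVal x w) := by
  induction w with
  | nil => simp [baseWord, wordVal]
  | cons a w ih =>
    rw [wordVal_cons, map_mul, ← ih, baseWord, List.map_cons, wordVal_cons]
    exact congrArg (· * _) (letterVal_extFamily_some a.1 a.2)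

lemma LengthLE.of {g : Γ} {k : ℕ} (h : LengthLE x g k) :
    LengthLE (extFamily x H) (HNNExtension.of g) k := by
  obtain ⟨p, hp, rfl⟩ := h
  exact ⟨baseWord p, by simpa [baseWord] using hp, wordVal_baseWord p⟩

lemma stable_mul_of (e : Bool) {h : Γ} (hh : h ∈ H) :
    letterVal (extFamily x H) (none, e) * HNNExtension.of h =
      HNNExtension.of h * letterVal (extFamily x H) (none, e) := by
  have h1 : (HNNExtension.t : CentralizingExt Γ H) * HNNExtension.of h =
    HNNExtension.of h * HNNExtension.t := HNNExtension.t_mul_of (⟨h, hh⟩ : H)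
  cases e
  · change HNNExtension.t⁻¹ * _ = _ * HNNExtension.t⁻¹
    rw [inv_mul_eq_iff_eq_mul, ← mul_assoc, h1, mul_inv_cancel_right]
  · exact h1

/-! ### Reading two normal forms alternately -/

section Stays

variable {J E : Type} [Group E] {X : J → E} {sep : J → Bool} {U : Set E}

lemma Stays.right_of_ended : ∀ (y : List (Letter J)) (p : Phase) (d : E),
    (∀ t, d * wordVal X (y.take t) ∈ U) → Stays X sep U p none (some y) d
  | [], p, d, _ => .rightEnd _ _ _ rfl (.done _ _)
  | a :: y, p, d, h => by
    refine .rightLetter _ _ _ _ _ rfl (by simpa [wordVal_cons, wordVal_nil] using h 1) ?_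
    exact right_of_ended y _ _ fun t => by simpa [wordVal_cons, mul_assoc] using h (t + 1)

lemma Stays.left_of_ended : ∀ (w : List (Letter J)) (p : Phase) (d : E),
    (∀ t, (wordVal X (w.take t))⁻¹ * d ∈ U) → Stays X sep U p (some w) none d
  | [], p, d, _ => .leftEnd _ _ _ rfl (.done _ _)
  | a :: w, p, d, h => by
    refine .leftLetter _ _ _ _ _ rfl (by simpa [wordVal_cons, wordVal_nil] using h 1) ?_
    exact left_of_ended w _ _ fun t => by simpa [wordVal_cons, mul_assoc] using h (t + 1)

/-- On equal prefixes the reading stays in lockstep, also through a separating letter, and the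
difference is alternately `a⁻¹` and `1`. -/
lemma Stays.common_prefix (hU : ∀ a, (letterVal X a)⁻¹ ∈ U) (h1 : 1 ∈ U)
    {l r : List (Letter J)} (h : Stays X sep U .left (some l) (some r) 1) :
    ∀ w : List (Letter J), Stays X sep U .left (some (w ++ l)) (some (w ++ r)) 1
  | [] => h
  | a :: w => by
    refine .leftLetter _ _ _ _ _ rfl (by simpa using hU a) ?_
    rcases ha : sep a.1 with _ | _ <;>
      refine .rightLetter _ _ _ _ _ rfl (by simpa using h1) ?_ <;>
      simpa [ha, Phase.next] using common_prefix hU h1 h w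

end Stays

/-- The letters on which the alternating reading synchronizes. -/
abbrev isStable : Option ι → Bool := Option.isNone

section Syllables

variable {k : ℕ}

/-- The ball of radius `k` in the extension. -/
abbrev extBall (x : ι → Γ) (H : Subgroup Γ) (k : ℕ) : Set (CentralizingExt Γ H) :=
  {g | LengthLE (extFamily x H) g k}

/-- The left tape has passed its stable letter and the right tape completes the syllable `y`. The
unmatched stable letter accounts for the radius `k + 1`, reading its partner for `k + 2`. -/
lemma stays_waitLeft (e : Bool) {l r : List (Letter (Option ι))} :
    ∀ (y : List (Letter ι)) (d : CentralizingExt Γ H),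
    (∀ t, LengthLE (extFamily x H) (d * HNNExtension.of (wordVal x (y.take t))) (k + 1)) →
    Stays (extFamily x H) isStable (extBall x H (k + 2)) .left (some l) (some r)
      (d * HNNExtension.of (wordVal x y) * letterVal (extFamily x H) (none, e)) →
    Stays (extFamily x H) isStable (extBall x H (k + 2)) .waitLeft (some l)
      (some (baseWord y ++ (none, e) :: r)) d
  | [], d, h1, h2 => by
    refine .rightLetter _ _ _ _ _ rfl ?_ (by simpa [wordVal_nil, Phase.next] using h2)
    have := (h1 0).mul (lengthLE_letterVal (extFamily x H) (none, e))
    simpa [wordVal_nil] using this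
  | (i, c) :: y, d, h1, h2 => by
    refine .rightLetter _ (some i, c) _ _ _ rfl ?_ ?_
    · have := (h1 1).mono (Nat.le_succ _)
      simpa [wordVal_cons, wordVal_nil, ← letterVal_extFamily_some (H := H)] using this
    · refine stays_waitLeft e y _ (fun t => ?_) ?_
      · simpa [wordVal_cons, letterVal_extFamily_some, mul_assoc] using h1 (t + 1)
      · simpa [wordVal_cons, letterVal_extFamily_some, mul_assoc] using h2

lemma stays_waitRight (e : Bool) {l r : List (Letter (Option ι))} :
    ∀ (w : List (Letter ι)) (d : CentralizingExt Γ H),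
    (∀ t, LengthLE (extFamily x H) ((HNNExtension.of (wordVal x (w.take t)))⁻¹ * d) (k + 1)) →
    Stays (extFamily x H) isStable (extBall x H (k + 2)) .left (some l) (some r)
      ((letterVal (extFamily x H) (none, e))⁻¹ * ((HNNExtension.of (wordVal x w))⁻¹ * d)) →
    Stays (extFamily x H) isStable (extBall x H (k + 2)) .waitRight (some (baseWord w ++ (none, e) :: l))
      (some r) d
  | [], d, h1, h2 => by
    refine .leftLetter _ _ _ _ _ rfl ?_ (by simpa [wordVal_nil, Phase.next] using h2)
    have := (lengthLE_letterVal (extFamily x H) (none, e)).inv.mul (h1 0)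
    rw [add_comm] at this
    simpa [wordVal_nil] using this
  | (i, c) :: w, d, h1, h2 => by
    refine .leftLetter _ (some i, c) _ _ _ rfl ?_ ?_
    · have := (h1 1).mono (Nat.le_succ _)
      simpa [wordVal_cons, wordVal_nil, ← letterVal_extFamily_some (H := H)] using this
    · refine stays_waitRight e w _ (fun t => ?_) ?_
      · simpa [wordVal_cons, letterVal_extFamily_some, mul_assoc] using h1 (t + 1)
      · simpa [wordVal_cons, letterVal_extFamily_some, mul_assoc] using h2

/-- The words `w` and `y` fellow travel, where the second one starts at `γ`. -/
def Fellow (x : ι → Γ) (k : ℕ) (w : List (Letter ι)) (γ : Γ) (y : List (Letter ι)) : Prop :=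
  ∀ t, LengthLE x ((wordVal x (w.take t))⁻¹ * γ * wordVal x (y.take t)) k

lemma Fellow.cons_nil {γ : Γ} {a : Letter ι} {w : List (Letter ι)}
    (h : Fellow x k (a :: w) γ []) : Fellow x k w ((letterVal x a)⁻¹ * γ) [] := fun t => by
  simpa [wordVal_cons, mul_assoc] using h (t + 1)

lemma Fellow.cons_cons {γ : Γ} {a b : Letter ι} {w y : List (Letter ι)}
    (h : Fellow x k (a :: w) γ (b :: y)) :
    Fellow x k w ((letterVal x a)⁻¹ * γ * letterVal x b) y := fun t => by
  simpa [wordVal_cons, mul_assoc] using h (t + 1)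

lemma Fellow.zero {γ : Γ} {w y : List (Letter ι)} (h : Fellow x k w γ y) : LengthLE x γ k := by
  simpa [wordVal_nil] using h 0

/-- Reading two syllables that are followed by the stable letter. -/
lemma stays_syllable (e : Bool) {l r : List (Letter (Option ι))} :
    ∀ (w y : List (Letter ι)) (γ : Γ), Fellow x k w γ y →
    (wordVal x w)⁻¹ * γ * wordVal x y ∈ H →
    Stays (extFamily x H) isStable (extBall x H (k + 2)) .left (some l) (some r)
      (HNNExtension.of ((wordVal x w)⁻¹ * γ * wordVal x y)) →
    Stays (extFamily x H) isStable (extBall x H (k + 2)) .left (some (baseWord w ++ (none, e) :: l))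
      (some (baseWord y ++ (none, e) :: r)) (HNNExtension.of γ)
  | [], y, γ, h, hH, h2 => by
    refine .leftLetter _ _ _ _ _ rfl ?_ (stays_waitLeft e y _ (fun t => ?_) ?_)
    · have := (lengthLE_letterVal (extFamily x H) (none, e)).inv.mul h.zero.of
      exact this.mono (by omega)
    · have := (lengthLE_letterVal (extFamily x H) (none, e)).inv.mul (h t).of
      rw [add_comm] at this
      simpa [wordVal_nil, mul_assoc] using this
    -- The difference at the end of the syllables lies in `H`, so the two stable letters cancel
    -- across it.
    · simp only [wordVal_nil, inv_one, one_mul] at h2 hH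
      rw [mul_assoc _ (HNNExtension.of γ), ← map_mul, mul_assoc, ← stable_mul_of e hH,
        inv_mul_cancel_left]
      exact h2
  | (i, c) :: w, [], γ, h, hH, h2 => by
    refine .leftLetter _ (some i, c) _ _ _ rfl ?_ ?_
    · rw [letterVal_extFamily_some, ← map_inv, ← map_mul]
      exact h.cons_nil.zero.of.mono (by omega)
    · refine .rightLetter _ _ _ _ _ rfl ?_ (stays_waitRight e w _ (fun t => ?_) ?_)
      · rw [letterVal_extFamily_some, ← map_inv, ← map_mul]
        exact (h.cons_nil.zero.of.mul
          (lengthLE_letterVal (extFamily x H) (none, e))).mono (by omega)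
      · rw [letterVal_extFamily_some, ← map_inv _ (letterVal x (i, c)), ← map_mul, ← map_inv,
          ← mul_assoc, ← map_mul]
        refine LengthLE.mul ?_ (lengthLE_letterVal _ _)
        simpa [wordVal_nil] using (h.cons_nil t).of (H := H)
      · have h3 : (wordVal x w)⁻¹ * ((letterVal x (i, c))⁻¹ * γ) ∈ H := by
          simpa [wordVal_nil, wordVal_cons, mul_assoc] using hH
        rw [letterVal_extFamily_some, ← map_inv _ (letterVal x (i, c)), ← map_mul, ← map_inv,
          ← mul_assoc (HNNExtension.of _), ← map_mul, ← stable_mul_of e h3, inv_mul_cancel_left]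
        simpa [wordVal_nil, wordVal_cons, mul_assoc] using h2
  | (i, c) :: w, (j, c') :: y, γ, h, hH, h2 => by
    refine .leftLetter _ (some i, c) _ _ _ rfl ?_ (.rightLetter _ (some j, c') _ _ _ rfl ?_ ?_)
    · rw [letterVal_extFamily_some, ← map_inv, ← map_mul]
      refine LengthLE.of ?_
      rw [add_comm]
      exact ((lengthLE_letterVal x _).inv.mul h.zero).mono (by omega)
    · rw [letterVal_extFamily_some, letterVal_extFamily_some, ← map_inv, ← map_mul, ← map_mul]
      exact h.cons_cons.zero.of.mono (by omega)
    · rw [letterVal_extFamily_some, letterVal_extFamily_some, ← map_inv, ← map_mul, ← map_mul]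
      refine stays_syllable e w y _ h.cons_cons ?_ ?_
      · simpa [wordVal_cons, mul_assoc] using hH
      · simpa [wordVal_cons, mul_assoc] using h2

/-- Reading the last syllables. -/
lemma stays_last : ∀ (w y : List (Letter ι)) (γ : Γ), Fellow x k w γ y →
    Stays (extFamily x H) isStable (extBall x H (k + 2)) .left (some (baseWord w)) (some (baseWord y))
      (HNNExtension.of γ)
  | [], y, γ, h => by
    refine .leftEnd _ _ _ rfl (Stays.right_of_ended _ _ _ fun t => ?_)
    have := (h t).of (H := H)
    rw [baseWord, ← List.map_take, ← baseWord, wordVal_baseWord, ← map_mul]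
    simpa [wordVal_nil] using this.mono (Nat.le_add_right k 2)
  | (i, c) :: w, [], γ, h => by
    refine .leftLetter _ (some i, c) _ _ _ rfl ?_
      (.rightEnd _ _ _ rfl (Stays.left_of_ended _ _ _ fun t => ?_))
    · rw [letterVal_extFamily_some, ← map_inv, ← map_mul]
      exact h.cons_nil.zero.of.mono (by omega)
    · have := (h.cons_nil t).of (H := H)
      change LengthLE _ ((wordVal _ ((baseWord w).take t))⁻¹ * _) _
      rw [letterVal_extFamily_some, baseWord, ← List.map_take, ← baseWord, wordVal_baseWord,
        ← map_inv, ← map_inv, ← map_mul, ← map_mul]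
      simpa [wordVal_nil] using this.mono (Nat.le_add_right k 2)
  | (i, c) :: w, (j, c') :: y, γ, h => by
    refine .leftLetter _ (some i, c) _ _ _ rfl ?_ (.rightLetter _ (some j, c') _ _ _ rfl ?_ ?_)
    · rw [letterVal_extFamily_some, ← map_inv, ← map_mul]
      refine LengthLE.of ?_
      exact ((lengthLE_letterVal x _).inv.mul h.zero).mono (by omega)
    · rw [letterVal_extFamily_some, letterVal_extFamily_some, ← map_inv, ← map_mul, ← map_mul]
      exact h.cons_cons.zero.of.mono (by omega)
    · rw [letterVal_extFamily_some, letterVal_extFamily_some, ← map_inv, ← map_mul, ← map_mul]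
      exact stays_last w y _ h.cons_cons

end Syllables

end Centralizing

end AutGroup

namespace AutGroup

/-! ### Multiplying normal forms by generators -/

section NormalForms

variable {ι Γ : Type} [Group Γ]

/-- `L₀` is a fellow travelling language of unique representatives of the elements of `Γ`, and `L`
is a fellow travelling language of unique representatives of the cosets of `H`, for which
right multiplication by a fixed element leads to finitely many coset corrections. -/
structure NormalFormSystem (x : ι → Γ) (H : Subgroup Γ) (L₀ L : Language (Letter ι)) : Prop where
  nil_mem : [] ∈ L
  unique : ∀ w ∈ L, ∀ y ∈ L, ∀ h ∈ H, wordVal x w = h * wordVal x y → w = y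
  meets : MeetsCosets x H L
  fellow : ∀ g, FellowTravels x H L g
  finite : ∀ g, ∃ B : Set Γ, B.Finite ∧ B ⊆ H ∧ ∀ γ ∈ insert g B, ∀ w ∈ L, ∀ y ∈ L, ∀ h ∈ H,
    wordVal x w * γ = h * wordVal x y → h ∈ B
  unique_base : ∀ w ∈ L₀, ∀ y ∈ L₀, wordVal x w = wordVal x y → w = y
  surj_base : ∀ g, ∃ w ∈ L₀, wordVal x w = g
  fellow_base : ∀ g, FellowTravels x ⊥ L₀ g

variable {x : ι → Γ} {H : Subgroup Γ} {L₀ L : Language (Letter ι)}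

lemma FellowTravels.exists_uniform {S : Set Γ} (hS : S.Finite)
    (h : ∀ g, FellowTravels x H L g) : ∃ k, ∀ γ ∈ S, ∀ w ∈ L, ∀ y ∈ L, ∀ h ∈ H,
      wordVal x w * γ = h * wordVal x y → Fellow x k w h y := by
  choose k hk using h
  obtain ⟨m, hm⟩ := (hS.image k).bddAbove
  exact ⟨m, fun γ hγ w hw y hy h hh e t => (hk γ w hw y hy h hh e t).mono (hm ⟨γ, hγ, rfl⟩)⟩

lemma IsTail.of_cons {p : Bool × List (Letter ι)} {T : List (Bool × List (Letter ι))}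
    (h : IsTail L (p :: T)) : IsTail L T :=
  ⟨fun q hq => h.1 q (List.mem_cons_of_mem _ hq), (List.isChain_cons.1 h.2).2⟩

/-- The factor travels from right to left through the tail, replaced at each syllable by the
correction of its coset representative. Since `B` absorbs these corrections, one constant `k` serves
tails of every length. -/
lemma exists_tail_mul (D : NormalFormSystem x H L₀ L) {g : Γ} {B : Set Γ} (hBH : B ⊆ H)
    (hB : ∀ γ ∈ insert g B, ∀ w ∈ L, ∀ y ∈ L, ∀ h ∈ H,
      wordVal x w * γ = h * wordVal x y → h ∈ B) {k : ℕ}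
    (hk : ∀ γ ∈ insert g B, ∀ w ∈ L, ∀ y ∈ L, ∀ h ∈ H,
      wordVal x w * γ = h * wordVal x y → Fellow x k w h y)
    (T : List (Bool × List (Letter ι))) (hT : IsTail L T) :
    ∃ T' γ, γ ∈ insert g B ∧ (T ≠ [] → γ ∈ B) ∧ IsTail L T' ∧ T'.map Prod.fst = T.map Prod.fst ∧
      wordVal (extFamily x H) (tailWord T) * HNNExtension.of g =
        HNNExtension.of γ * wordVal (extFamily x H) (tailWord T') ∧
      ∀ w y η, Fellow x k w η y → wordVal x w * γ = η * wordVal x y →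
        Stays (extFamily x H) isStable (extBall x H (k + 2)) .left (some (baseWord w ++ tailWord T))
          (some (baseWord y ++ tailWord T')) (HNNExtension.of η) := by
  induction T with
  | nil =>
    refine ⟨[], g, Set.mem_insert _ _, by simp, ⟨by simp, List.isChain_nil⟩, rfl,
      by simp [tailWord, wordVal_nil], fun w y η h _ => ?_⟩
    simpa [tailWord] using stays_last w y η h
  | cons p T ih =>
    obtain ⟨e, w⟩ := p
    obtain ⟨T', γ, hγ, hγB, hT', hfst, hval, hstays⟩ := ih hT.of_cons
    have hw : w ∈ L := hT.1 _ (List.mem_cons_self ..)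
    obtain ⟨y, hy, h, hh, hwy⟩ := D.meets (wordVal x w * γ)
    have hhB := hB γ hγ w hw y hy h hh hwy
    refine ⟨(e, y) :: T', h, Set.mem_insert_of_mem _ hhB, fun _ => hhB, ⟨?_, ?_⟩, by simp [hfst],
      ?_, fun v v' η hη hv => ?_⟩
    · rintro q hq
      rcases List.mem_cons.1 hq with rfl | hq
      · exact hy
      · exact hT'.1 q hq
    · refine List.isChain_cons.2 ⟨fun q hq => ?_, hT'.2⟩
      rintro rfl
      obtain ⟨q', hq', hqq⟩ : ∃ q' ∈ T.head?, q'.1 = q.1 := by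
        have := congrArg List.head? hfst
        rw [List.head?_map, List.head?_map, Option.mem_def.1 hq] at this
        exact Option.map_eq_some_iff.1 this.symm
      have hne : T ≠ [] := by rintro rfl; simp at hq'
      -- An empty new syllable comes from an empty old one, so no new factor `z z⁻¹` arises. This
      -- needs `γ ∈ H`, which holds because another syllable follows.
      have hw1 : w = [] := by
        refine D.unique w hw [] hy (h * γ⁻¹) (H.mul_mem hh (H.inv_mem (hBH (hγB hne)))) ?_
        rw [wordVal_nil, mul_one] at hwy ⊢
        rw [← hwy, mul_inv_cancel_right]
      exact ((List.isChain_cons.1 hT.2).1 q' hq' hw1).trans hqq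
    · rw [tailWord_cons, tailWord_cons, wordVal_cons, wordVal_cons, wordVal_append,
        wordVal_append, wordVal_baseWord, wordVal_baseWord, mul_assoc, mul_assoc, hval,
        ← mul_assoc (HNNExtension.of (wordVal x w)), ← map_mul, hwy, map_mul, mul_assoc,
        ← mul_assoc, stable_mul_of e hh, mul_assoc]
    · rw [tailWord_cons, tailWord_cons]
      have e1 : (wordVal x v)⁻¹ * η * wordVal x v' = h := by rw [mul_assoc, ← hv]; group
      refine stays_syllable e v v' η hη (e1 ▸ hh) ?_
      rw [e1]
      exact hstays w y h (hk γ hγ w hw y hy h hh hwy) hwy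

/-- Right multiplication of normal forms by an element of the base group. -/
lemma exists_normalWord_mul_of (D : NormalFormSystem x H L₀ L) (g : Γ) :
    ∃ K, ∀ W ∈ normalWords L₀ L, ∃ Y ∈ normalWords L₀ L,
      wordVal (extFamily x H) W * HNNExtension.of g = wordVal (extFamily x H) Y ∧
      Stays (extFamily x H) isStable (extBall x H K) .left (some W) (some Y) 1 := by
  obtain ⟨B, hBf, hBH, hB⟩ := D.finite g
  obtain ⟨k₁, hk₁⟩ := FellowTravels.exists_uniform (hBf.insert g) D.fellow
  obtain ⟨k₂, hk₂⟩ := FellowTravels.exists_uniform (hBf.insert g) D.fellow_base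
  refine ⟨max k₁ k₂ + 2, ?_⟩
  rintro _ ⟨w, hw, T, hT, rfl⟩
  obtain ⟨T', γ, hγ, -, hT', -, hval, hstays⟩ := exists_tail_mul D hBH hB (k := max k₁ k₂)
    (fun γ hγ w hw y hy h hh e t => (hk₁ γ hγ w hw y hy h hh e t).mono (le_max_left _ _)) T hT
  obtain ⟨y, hy, hwy⟩ := D.surj_base (wordVal x w * γ)
  refine ⟨_, ⟨y, hy, T', hT', rfl⟩, ?_, ?_⟩
  · rw [wordVal_append, wordVal_append, wordVal_baseWord, wordVal_baseWord, hwy, mul_assoc, hval,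
      map_mul, mul_assoc]
  · rw [← map_one (HNNExtension.of (φ := MulEquiv.refl H))]
    exact hstays w y 1 (fun t => (hk₂ γ hγ w hw y hy 1 (Subgroup.one_mem _) (by rw [hwy, one_mul])
      t).mono (le_max_right _ _)) (by rw [hwy, one_mul])

/-- Right multiplication of normal forms by the stable letter or its inverse. -/
lemma exists_normalWord_mul_stable (D : NormalFormSystem x H L₀ L) (e : Bool) :
    ∀ W ∈ normalWords L₀ L, ∃ Y ∈ normalWords L₀ L,
      wordVal (extFamily x H) W * letterVal (extFamily x H) (none, e) =
        wordVal (extFamily x H) Y ∧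
      Stays (extFamily x H) isStable (extBall x H 1) .left (some W) (some Y) 1 := by
  have hU : ∀ a, (letterVal (extFamily x H) a)⁻¹ ∈ extBall x H 1 :=
    fun a => (lengthLE_letterVal _ a).inv
  have h1 : (1 : CentralizingExt Γ H) ∈ extBall x H 1 := LengthLE.one _ _
  rintro _ ⟨w, hw, T, hT, rfl⟩
  by_cases h : ∃ T', T = T' ++ [(!e, [])]
  · obtain ⟨T', rfl⟩ := h
    refine ⟨_, ⟨w, hw, T', ⟨fun p hp => hT.1 p (by simp [hp]), (List.isChain_append.1 hT.2).1⟩,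
      rfl⟩, ?_, ?_⟩
    · simp [tailWord, baseWord, wordVal_append, wordVal_cons, wordVal_nil, letterVal_not,
        mul_assoc]
    · have h2 := Stays.common_prefix (sep := isStable) hU h1 (l := [(none, !e)]) (r := [])
        (.leftLetter _ _ _ _ _ rfl (by simpa using hU _)
          (.rightEnd _ _ _ rfl (.leftEnd _ _ _ rfl (.done _ _)))) (baseWord w ++ tailWord T')
      simpa [tailWord, baseWord] using h2
  · refine ⟨_, ⟨w, hw, T ++ [(e, [])], ⟨?_, ?_⟩, rfl⟩, ?_, ?_⟩
    · intro p hp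
      rcases List.mem_append.1 hp with hp | hp
      · exact hT.1 p hp
      · rw [List.mem_singleton.1 hp]; exact D.nil_mem
    · refine List.isChain_append.2 ⟨hT.2, List.isChain_singleton _, ?_⟩
      rintro ⟨e', v⟩ hp q hq rfl
      obtain rfl : (e, []) = q := by simpa using hq
      by_contra hne
      obtain ⟨T', hT'⟩ := List.getLast?_eq_some_iff.1 hp
      refine h ⟨T', ?_⟩
      rw [hT']
      cases e <;> cases e' <;> simp_all
    · simp [tailWord, baseWord, wordVal_append, wordVal_cons, wordVal_nil, mul_assoc]
    · have h2 := Stays.common_prefix (sep := isStable) hU h1 (l := []) (r := [(none, e)])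
        (.leftEnd _ _ _ rfl (.rightLetter _ _ _ _ _ rfl
          (by simpa using lengthLE_letterVal (extFamily x H) (none, e))
          (.rightEnd _ _ _ rfl (.done _ _)))) (baseWord w ++ tailWord T)
      simpa [tailWord, baseWord] using h2

lemma exists_normalWord_eq (D : NormalFormSystem x H L₀ L) (g : CentralizingExt Γ H) :
    ∃ W ∈ normalWords L₀ L, wordVal (extFamily x H) W = g := by
  have key : (∀ W ∈ normalWords L₀ L, ∃ Y ∈ normalWords L₀ L,
      wordVal (extFamily x H) W * g = wordVal (extFamily x H) Y) ∧
      ∀ W ∈ normalWords L₀ L, ∃ Y ∈ normalWords L₀ L,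
      wordVal (extFamily x H) W * g⁻¹ = wordVal (extFamily x H) Y := by
    induction g using HNNExtension.induction_on with
    | of g =>
      refine ⟨fun W hW => ?_, fun W hW => ?_⟩
      · obtain ⟨K, hK⟩ := exists_normalWord_mul_of D g
        obtain ⟨Y, hY, e, -⟩ := hK W hW
        exact ⟨Y, hY, e⟩
      · obtain ⟨K, hK⟩ := exists_normalWord_mul_of D g⁻¹
        obtain ⟨Y, hY, e, -⟩ := hK W hW
        exact ⟨Y, hY, by rw [← map_inv, e]⟩
    | t =>
      refine ⟨fun W hW => ?_, fun W hW => ?_⟩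
      · obtain ⟨Y, hY, e, -⟩ := exists_normalWord_mul_stable D true W hW
        exact ⟨Y, hY, e⟩
      · obtain ⟨Y, hY, e, -⟩ := exists_normalWord_mul_stable D false W hW
        exact ⟨Y, hY, e⟩
    | mul g g' h h' =>
      refine ⟨fun W hW => ?_, fun W hW => ?_⟩
      · obtain ⟨Y, hY, e⟩ := h.1 W hW
        obtain ⟨Z, hZ, e'⟩ := h'.1 Y hY
        exact ⟨Z, hZ, by rw [← mul_assoc, e, e']⟩
      · obtain ⟨Y, hY, e⟩ := h'.2 W hW
        obtain ⟨Z, hZ, e'⟩ := h.2 Y hY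
        exact ⟨Z, hZ, by rw [mul_inv_rev, ← mul_assoc, e, e']⟩
    | inv g h => exact ⟨h.2, by rw [inv_inv]; exact h.1⟩
  obtain ⟨w, hw, e⟩ := D.surj_base 1
  obtain ⟨Y, hY, e'⟩ := key.1 _ ⟨w, hw, [], ⟨by simp, List.isChain_nil⟩, rfl⟩
  refine ⟨Y, hY, ?_⟩
  rw [← e', wordVal_append, wordVal_baseWord, e]
  simp [tailWord, wordVal_nil]

/-! ### Uniqueness of normal forms -/

lemma NormalFormSystem.isComplement (D : NormalFormSystem x H L₀ L) :
    Subgroup.IsComplement (H : Set Γ) (wordVal x '' {w | w ∈ L}) := by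
  rw [Subgroup.isComplement_iff_existsUnique_mul_inv_mem]
  intro g
  obtain ⟨w, hw, h, hh, rfl⟩ := D.meets g
  refine ⟨⟨_, w, hw, rfl⟩, by simpa using hh, ?_⟩
  rintro ⟨_, y, hy, rfl⟩ h1
  have h2 := D.unique w hw y hy _ (H.mul_mem (H.inv_mem hh) h1) (by simp [mul_assoc])
  simp [h2]

/-- The transversals for the stable letter and its inverse. -/
def NormalFormSystem.transversalPair (D : NormalFormSystem x H L₀ L) :
    HNNExtension.NormalWord.TransversalPair Γ H H where
  set _ := wordVal x '' {w | w ∈ L}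
  compl u := by
    rw [HNNExtension.toSubgroup, ite_self]
    exact D.isComplement

/-- The exponent of a letter. -/
def exponent : Bool → ℤˣ
  | true => 1
  | false => -1

lemma exponent_injective : Function.Injective exponent := by
  rintro (_ | _) (_ | _) <;> decide

/-- The normal form in the HNN extension. -/
def NormalFormSystem.normalWord (D : NormalFormSystem x H L₀ L) (w : List (Letter ι))
    {T : List (Bool × List (Letter ι))} (hT : IsTail L T) :
    HNNExtension.NormalWord D.transversalPair where
  head := wordVal x w
  toList := T.map fun p => (exponent p.1, wordVal x p.2)
  chain := by
    rw [List.isChain_map]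
    -- A coset representative whose value lies in `H` is the empty word.
    refine hT.2.imp_of_mem_imp fun p q hp _ hpq h => congrArg exponent (hpq ?_)
    rw [HNNExtension.toSubgroup, ite_self] at h
    exact D.unique _ (hT.1 p hp) _ D.nil_mem _ h (by simp [wordVal_nil])
  mem_set u g h := by
    obtain ⟨p, hp, e⟩ := List.mem_map.1 h
    exact ⟨p.2, hT.1 p hp, congrArg Prod.snd e⟩

lemma NormalFormSystem.prod_normalWord (D : NormalFormSystem x H L₀ L) (w : List (Letter ι))
    {T : List (Bool × List (Letter ι))} (hT : IsTail L T) :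
    (D.normalWord w hT).prod (MulEquiv.refl H) =
      wordVal (extFamily x H) (baseWord w ++ tailWord T) := by
  rw [wordVal_append, wordVal_baseWord]
  refine congrArg (HNNExtension.of (wordVal x w) * ·) ?_
  simp only [NormalFormSystem.normalWord]
  clear hT
  induction T with
  | nil => simp [tailWord, wordVal_nil]
  | cons p T ih =>
    rw [tailWord_cons, wordVal_cons, wordVal_append, wordVal_baseWord, List.map_cons,
      List.map_cons, List.prod_cons, ih, ← mul_assoc]
    refine congrArg (· * _ * _) ?_
    obtain ⟨_ | _, v⟩ := p <;> simp [exponent, letterVal, extFamily]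

/-- The normal form theorem for HNN extensions recovers the values of all syllables and the
exponents; uniqueness of representatives then recovers the words. -/
lemma normalWords_unique (D : NormalFormSystem x H L₀ L) {W Y : List (Letter (Option ι))}
    (hW : W ∈ normalWords L₀ L) (hY : Y ∈ normalWords L₀ L)
    (e : wordVal (extFamily x H) W = wordVal (extFamily x H) Y) : W = Y := by
  obtain ⟨w, hw, T, hT, rfl⟩ := hW
  obtain ⟨y, hy, S, hS, rfl⟩ := hY
  rw [← D.prod_normalWord w hT, ← D.prod_normalWord y hS] at e
  have e1 := HNNExtension.NormalWord.prod_injective (MulEquiv.refl H) D.transversalPair e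
  obtain rfl := D.unique_base w hw y hy (congrArg (fun n => n.head) e1)
  have e2 : T.map (fun p => (exponent p.1, wordVal x p.2)) =
    S.map fun p => (exponent p.1, wordVal x p.2) := congrArg (fun n => n.toList) e1
  have e3 : T = S := by
    have hT1 := hT.1
    have hS1 := hS.1
    clear e e1 hT hS
    induction T generalizing S with
    | nil => simpa using e2.symm
    | cons p T ih =>
      rcases S with _ | ⟨q, S⟩
      · simp at e2
      · simp only [List.map_cons, List.cons.injEq, Prod.mk.injEq] at e2
        rw [ih S e2.2 (fun r hr => hT1 r (by simp [hr])) (fun r hr => hS1 r (by simp [hr]))]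
        refine congrArg (· :: S) (Prod.ext (exponent_injective e2.1.1) ?_)
        exact D.unique _ (hT1 p (by simp)) _ (hS1 q (by simp)) 1 H.one_mem (by simpa using e2.1.2)
  rw [e3]

/-- An HNN extension whose stable letter centralizes `H` is asynchronously automatic if there is a
system of normal forms and the language of normal forms is regular. -/
theorem NormalFormSystem.isAsynchronouslyAutomaticWith [Finite ι]
    (D : NormalFormSystem x H L₀ L) (h : (normalWords L₀ L).IsRegular) :
    IsAsynchronouslyAutomaticWith (extFamily x H) := by
  refine isAsynchronouslyAutomaticWith_of_stays isStable h (exists_normalWord_eq D) ?_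
  rintro (_ | ⟨_ | i, c⟩)
  · obtain ⟨K, hK⟩ := exists_normalWord_mul_of D 1
    refine ⟨K, fun W hW Y hY e => ?_⟩
    obtain ⟨Y', hY', e', hs⟩ := hK W hW
    rw [map_one] at e'
    rwa [normalWords_unique D hY hY' (e.symm.trans e')]
  · refine ⟨1, fun W hW Y hY e => ?_⟩
    obtain ⟨Y', hY', e', hs⟩ := exists_normalWord_mul_stable D c W hW
    rwa [normalWords_unique D hY hY' (e.symm.trans e')]
  · obtain ⟨K, hK⟩ := exists_normalWord_mul_of D (letterVal x (i, c))
    refine ⟨K, fun W hW Y hY e => ?_⟩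
    obtain ⟨Y', hY', e', hs⟩ := hK W hW
    rw [← letterVal_extFamily_some] at e'
    rwa [normalWords_unique D hY hY' (e.symm.trans e')]

end NormalForms

end AutGroup

namespace AutGroup

/-! ### Regularity of the language of normal forms -/

section RegularNormalWords

variable {ι Q : Type}

open Classical in
/-- The automaton that runs `A` on the syllables, restarts it in the state `s` at each stable letter,
and remembers a stable letter that has just been read. -/
noncomputable def syllableDFA (A : DFA (Letter ι) Q) (s : Q) :
    DFA (Letter (Option ι)) (Option (Q × Option Bool)) where
  step
    | none, _ => none
    | some (q, _), (some i, c) => some (A.step q (i, c), none)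
    | some (q, o), (none, e) =>
      if q ∈ A.accept ∧ ∀ e' ∈ o, e' = e then some (s, some e) else none
  start := some (A.start, none)
  accept := {t | ∃ p ∈ t, p.1 ∈ A.accept}

variable {A : DFA (Letter ι) Q} {s : Q}

lemma syllableDFA_evalFrom_none (W : List (Letter (Option ι))) :
    (syllableDFA A s).evalFrom none W = none := by
  induction W with
  | nil => rfl
  | cons a W ih => exact ih

/-- The memory `o` restricts the next stable letter only if the current syllable is empty; this is
the local form of the ban on `z z⁻¹`. -/
lemma mem_acceptsFrom_syllableDFA (W : List (Letter (Option ι))) (q : Q) (o : Option Bool) :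
    (syllableDFA A s).evalFrom (some (q, o)) W ∈ (syllableDFA A s).accept ↔
      ∃ w T, A.evalFrom q w ∈ A.accept ∧ IsTail (A.acceptsFrom s) T ∧
        (w = [] → ∀ e ∈ o, ∀ p ∈ T.head?, e = p.1) ∧ W = baseWord w ++ tailWord T := by
  induction W generalizing q o with
  | nil =>
    constructor
    · rintro ⟨p, hp, h⟩
      obtain rfl : (q, o) = p := by simpa using hp
      exact ⟨[], [], h, ⟨by simp, List.isChain_nil⟩, by simp, rfl⟩
    · rintro ⟨w, T, h1, h2, h3, h4⟩
      obtain ⟨hw, -⟩ := List.append_eq_nil_iff.1 h4.symm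
      obtain rfl : w = [] := by simpa [baseWord] using hw
      exact ⟨_, rfl, h1⟩
  | cons a W ih =>
    rw [DFA.evalFrom_cons]
    obtain ⟨_ | i, c⟩ := a
    · by_cases hq : q ∈ A.accept ∧ ∀ e' ∈ o, e' = c
      · have h1 : (syllableDFA A s).step (some (q, o)) (none, c) = some (s, some c) := by
          simp only [syllableDFA, if_pos hq]
        rw [h1, ih]
        constructor
        · rintro ⟨w, T, h2, h3, h4, rfl⟩
          refine ⟨[], (c, w) :: T, hq.1, ⟨?_, List.isChain_cons.2 ⟨?_, h3.2⟩⟩, ?_, ?_⟩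
          · rintro p hp
            rcases List.mem_cons.1 hp with rfl | hp
            · exact h2
            · exact h3.1 p hp
          · exact fun p hp hw => h4 hw c rfl p hp
          · rintro - e he p hp
            obtain rfl : (c, w) = p := by simpa using hp
            exact hq.2 e he
          · rw [tailWord_cons]; rfl
        · rintro ⟨w, T, h2, h3, h4, h5⟩
          rcases w with _ | ⟨b, w⟩
          · rcases T with _ | ⟨⟨e, w⟩, T⟩
            · simp [baseWord, tailWord] at h5
            · rw [tailWord_cons] at h5
              simp only [baseWord, List.map_nil, List.nil_append, List.cons.injEq,
                Prod.mk.injEq, true_and] at h5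
              obtain ⟨rfl, rfl⟩ := h5
              refine ⟨w, T, h3.1 _ (List.mem_cons_self ..), h3.of_cons, ?_, rfl⟩
              rintro hw e' he' p hp
              obtain rfl : c = e' := by simpa using he'
              exact (List.isChain_cons.1 h3.2).1 p hp hw
          · simp [baseWord, Prod.ext_iff] at h5
      · have h1 : (syllableDFA A s).step (some (q, o)) (none, c) = none := by
          simp only [syllableDFA, if_neg hq]
        rw [h1, syllableDFA_evalFrom_none]
        constructor
        · rintro ⟨p, hp, -⟩
          simp at hp
        · rintro ⟨w, T, h2, h3, h4, h5⟩
          rcases w with _ | ⟨b, w⟩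
          · rcases T with _ | ⟨⟨e, w⟩, T⟩
            · simp [baseWord, tailWord] at h5
            · rw [tailWord_cons] at h5
              simp only [baseWord, List.map_nil, List.nil_append, List.cons.injEq,
                Prod.mk.injEq, true_and] at h5
              obtain ⟨rfl, rfl⟩ := h5
              exact absurd ⟨h2, fun e' he' => h4 rfl e' he' _ rfl⟩ hq
          · simp [baseWord, Prod.ext_iff] at h5
    · change (syllableDFA A s).evalFrom (some (A.step q (i, c), none)) W ∈ _ ↔ _
      rw [ih]
      constructor
      · rintro ⟨w, T, h2, h3, -, rfl⟩
        exact ⟨(i, c) :: w, T, h2, h3, by simp, rfl⟩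
      · rintro ⟨w, T, h2, h3, h4, h5⟩
        rcases w with _ | ⟨b, w⟩
        · rcases T with _ | ⟨⟨e, w⟩, T⟩
          · simp [baseWord, tailWord] at h5
          · simp [baseWord, tailWord] at h5
        · simp only [baseWord, List.map_cons, List.cons_append, List.cons.injEq] at h5
          obtain ⟨h6, rfl⟩ := h5
          obtain rfl : (i, c) = b := by
            obtain ⟨j, c'⟩ := b
            simpa using h6
          exact ⟨w, T, h2, h3, by simp, rfl⟩

/-- The automaton that runs one of two automata. -/
def sumDFA {α Q₁ Q₂ : Type} (A₁ : DFA α Q₁) (A₂ : DFA α Q₂) : DFA α (Q₁ ⊕ Q₂) where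
  step t a := t.map (A₁.step · a) (A₂.step · a)
  start := .inl A₁.start
  accept := {t | t.elim (· ∈ A₁.accept) (· ∈ A₂.accept)}

lemma sumDFA_evalFrom {α Q₁ Q₂ : Type} (A₁ : DFA α Q₁) (A₂ : DFA α Q₂) (t : Q₁ ⊕ Q₂)
    (w : List α) : (sumDFA A₁ A₂).evalFrom t w = t.map (A₁.evalFrom · w) (A₂.evalFrom · w) := by
  induction w generalizing t with
  | nil => cases t <;> rfl
  | cons a w ih =>
    rw [DFA.evalFrom_cons, ih]
    cases t <;> rfl

lemma isRegular_normalWords {L₀ L : Language (Letter ι)} (h₀ : L₀.IsRegular) (h : L.IsRegular) :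
    (normalWords L₀ L).IsRegular := by
  classical
  obtain ⟨Q₁, _, A₁, rfl⟩ := h₀
  obtain ⟨Q₂, _, A₂, rfl⟩ := h
  -- The sum starts in the automaton of `L₀`, and each stable letter restarts it in that of `L`.
  refine ⟨_, inferInstance, syllableDFA (sumDFA A₁ A₂) (.inr A₂.start), ?_⟩
  have h2 : (sumDFA A₁ A₂).acceptsFrom (.inr A₂.start) = A₂.accepts := by
    ext w
    rw [DFA.mem_acceptsFrom, sumDFA_evalFrom]
    rfl
  ext W
  refine (mem_acceptsFrom_syllableDFA W _ _).trans ?_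
  rw [h2]
  constructor
  · rintro ⟨w, T, h3, h4, -, e⟩
    rw [sumDFA_evalFrom] at h3
    exact ⟨w, h3, T, h4, e⟩
  · rintro ⟨w, h3, T, h4, e⟩
    refine ⟨w, T, ?_, h4, by simp, e⟩
    rw [sumDFA_evalFrom]
    exact h3

end RegularNormalWords

end AutGroup

namespace AutGroup

/-! ### Normal forms over a free subgroup -/

section FreeSubgroup

/-- Two reduced words agree up to suffixes that are bounded by the norm of their quotient. -/
lemma exists_common_prefix {κ : Type} [DecidableEq κ] : ∀ f f' : List (κ × Bool),
    FreeGroup.IsReduced f → FreeGroup.IsReduced f' → ∃ p s s', f = p ++ s ∧ f' = p ++ s' ∧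
      s.length + s'.length ≤ ((FreeGroup.mk f)⁻¹ * FreeGroup.mk f').norm
  | [], f', _, h' => ⟨[], [], f', rfl, rfl, by
      rw [← FreeGroup.one_eq_mk, inv_one, one_mul, FreeGroup.norm, FreeGroup.toWord_mk,
        h'.reduce_eq]
      simp⟩
  | a :: f, [], h, _ => ⟨[], a :: f, [], rfl, rfl, by
      rw [← FreeGroup.one_eq_mk, mul_one, FreeGroup.norm_inv_eq, FreeGroup.norm,
        FreeGroup.toWord_mk, h.reduce_eq]
      simp⟩
  | a :: f, b :: f', h, h' => by
    by_cases hab : a = b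
    · subst hab
      obtain ⟨p, s, s', rfl, rfl, h3⟩ := exists_common_prefix f f' (List.isChain_cons.1 h).2
        (List.isChain_cons.1 h').2
      refine ⟨a :: p, s, s', rfl, rfl, h3.trans (le_of_eq (congrArg _ ?_))⟩
      have h4 : ∀ q : List (κ × Bool), FreeGroup.mk (a :: q) = FreeGroup.mk [a] * FreeGroup.mk q :=
        fun q => by rw [FreeGroup.mul_mk]; rfl
      rw [h4 (p ++ s), h4 (p ++ s'), mul_inv_rev, mul_assoc, inv_mul_cancel_left]
    -- The first letters differ, so nothing cancels in the product of the inverse of one word with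
    -- the other.
    · refine ⟨[], a :: f, b :: f', rfl, rfl, ?_⟩
      have h1 : FreeGroup.IsReduced (FreeGroup.invRev (a :: f)) :=
        FreeGroup.IsReduced.of_reduce_eq (by rw [FreeGroup.reduce_invRev, h.reduce_eq])
      have h2 : FreeGroup.IsReduced (FreeGroup.invRev (a :: f) ++ b :: f') := by
        refine List.isChain_append.2 ⟨h1, h', ?_⟩
        rintro c hc d hd
        obtain rfl : b = d := by simpa using hd
        obtain rfl : (a.1, !a.2) = c := by
          simpa [FreeGroup.invRev] using hc
        intro e
        by_contra h3
        exact hab (Prod.ext e (by simpa using h3))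
      rw [FreeGroup.inv_mk, FreeGroup.mul_mk, FreeGroup.norm, FreeGroup.toWord_mk, h2.reduce_eq,
        List.length_append, FreeGroup.invRev_length]

variable {κ ι Γ : Type} [Group Γ]

/-- A word in the second alphabet as a word in both alphabets. -/
def rightWord (w : List (Letter ι)) : List (Letter (κ ⊕ ι)) := w.map (Prod.map .inr id)

/-- A word in the first alphabet as a word in both alphabets. -/
def leftWord (f : List (Letter κ)) : List (Letter (κ ⊕ ι)) := f.map (Prod.map .inl id)

/-- The language `L` over the larger alphabet. -/
def rightLanguage (κ : Type) (L : Language (Letter ι)) : Language (Letter (κ ⊕ ι)) :=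
  {W | ∃ w ∈ L, rightWord w = W}

/-- The words that consist of a reduced word in the first alphabet and a word of `L`. -/
def reducedLanguage (κ : Type) (L : Language (Letter ι)) : Language (Letter (κ ⊕ ι)) :=
  {W | ∃ f, FreeGroup.IsReduced f ∧ ∃ w ∈ L, leftWord f ++ rightWord w = W}

variable {y : κ → Γ} {x : ι → Γ} {H : Subgroup Γ} {L : Language (Letter ι)}

lemma wordVal_rightWord (w : List (Letter ι)) :
    wordVal (Sum.elim y x) (rightWord w) = wordVal x w := by
  rw [wordVal, rightWord, List.map_map, wordVal]
  exact congrArg List.prod (List.map_congr_left fun a _ => by obtain ⟨i, _ | _⟩ := a <;> rfl)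

lemma wordVal_leftWord (f : List (Letter κ)) :
    wordVal (Sum.elim y x) (leftWord f) = wordVal y f := by
  rw [wordVal, leftWord, List.map_map, wordVal]
  exact congrArg List.prod (List.map_congr_left fun a _ => by obtain ⟨i, _ | _⟩ := a <;> rfl)

lemma leftWord_append (f f' : List (Letter κ)) :
    (leftWord (f ++ f') : List (Letter (κ ⊕ ι))) = leftWord f ++ leftWord f' := List.map_append

lemma take_rightWord (w : List (Letter ι)) (t : ℕ) :
    (rightWord w : List (Letter (κ ⊕ ι))).take t = rightWord (w.take t) := List.map_take.symm

lemma LengthLE.sumElim {g : Γ} {k : ℕ} (h : LengthLE x g k) : LengthLE (Sum.elim y x) g k := by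
  obtain ⟨p, hp, rfl⟩ := h
  exact ⟨rightWord p, by simpa [rightWord] using hp, wordVal_rightWord p⟩

lemma wordVal_eq_lift (f : List (Letter κ)) : wordVal y f = FreeGroup.lift y (FreeGroup.mk f) := by
  rw [FreeGroup.lift_mk, wordVal]
  exact congrArg List.prod (List.map_congr_left fun a _ => by obtain ⟨i, _ | _⟩ := a <;> rfl)

lemma wordVal_mem (hy : (FreeGroup.lift y).range = H) (f : List (Letter κ)) : wordVal y f ∈ H := by
  rw [wordVal_eq_lift, ← hy]
  exact ⟨_, rfl⟩

/-- A ball is finite, so its elements in `H` have bounded length over `y`; no control of distortion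
is needed. -/
lemma exists_length_bound [Finite ι] (hy : (FreeGroup.lift y).range = H) (k : ℕ) :
    ∃ m, ∀ h ∈ H, LengthLE x h k → LengthLE y h m := by
  have h1 : ∀ h : Γ, ∃ m, h ∈ H → LengthLE y h m := by
    intro h
    by_cases hh : h ∈ H
    · rw [← hy] at hh
      obtain ⟨f, rfl⟩ := hh
      obtain ⟨f, rfl⟩ := Quot.exists_rep f
      exact ⟨f.length, fun _ => ⟨f, le_rfl, wordVal_eq_lift f⟩⟩
    · exact ⟨0, fun h => absurd h hh⟩
  choose m hm using h1
  obtain ⟨M, hM⟩ := ((finite_setOf_lengthLE x k).image m).bddAbove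
  exact ⟨M, fun h hh hk => (hm h hh).mono (hM ⟨h, hk, rfl⟩)⟩

/-- Efficiency applied letter by letter: the correction is no longer than `p`. Hence balls of `H`
over `y` are closed under passing to corrections. -/
lemma lengthLE_of_efficient (hL : MeetsCosets x H L)
    (he : ∀ w ∈ L, ∀ v ∈ L, ∀ a, ∀ h ∈ H, wordVal x w * letterVal y a = h * wordVal x v →
      LengthLE y h 1)
    (hu : ∀ w ∈ L, ∀ v ∈ L, ∀ h ∈ H, wordVal x w = h * wordVal x v → w = v)
    (p : List (Letter κ)) : ∀ w ∈ L, ∀ v ∈ L, ∀ h ∈ H,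
      wordVal x w * wordVal y p = h * wordVal x v → LengthLE y h p.length := by
  induction p with
  | nil =>
    intro w hw v hv h hh e
    rw [wordVal_nil, mul_one] at e
    obtain rfl := hu w hw v hv h hh e
    obtain rfl : h = 1 := by simpa using e
    exact LengthLE.one _ _
  | cons a p ih =>
    intro w hw v hv h hh e
    obtain ⟨v', hv', h', hh', e'⟩ := hL (wordVal x w * letterVal y a)
    have h1 := he w hw v' hv' a h' hh' e'
    have h2 := ih v' hv' v hv (h'⁻¹ * h) (H.mul_mem (H.inv_mem hh') hh) (by
      rw [wordVal_cons, ← mul_assoc, e', mul_assoc] at e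
      rw [mul_assoc, ← e, inv_mul_cancel_left])
    have := h1.mul h2
    rw [mul_inv_cancel_left] at this
    exact this.mono (by simp [add_comm])

lemma lengthLE_take_append (x : ι → Γ) (w y : List (Letter ι)) (t : ℕ) :
    LengthLE x ((wordVal x ((w ++ y).take t))⁻¹ * (wordVal x w * wordVal x (y.take t)))
      (2 * w.length) := by
  rcases le_total t w.length with h | h
  · rw [List.take_append_of_le_length h]
    have h1 := lengthLE_take_take x w h (c := w.length) (by simp)
    rw [List.take_length] at h1
    have h2 : LengthLE x (wordVal x (y.take t)) w.length :=
      (lengthLE_wordVal x _).mono ((List.length_take_le ..).trans h)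
    rw [← mul_assoc]
    exact (h1.mul h2).mono (by omega)
  · rw [List.take_append, List.take_of_length_le h, wordVal_append, mul_inv_rev, mul_assoc,
      inv_mul_cancel_left]
    exact (lengthLE_take_take x y (by omega) (by omega)).mono (by omega : w.length ≤ _)

/-- Up to their common prefix the words agree. The remaining suffixes over `y` are short, since
their quotient is a coset correction for `g`; beyond them the coset representatives fellow travel.
-/
lemma fellowTravels_reducedLanguage [Finite ι] [DecidableEq κ]
    (hinj : Function.Injective (FreeGroup.lift y)) (hy : (FreeGroup.lift y).range = H) {g : Γ}
    (hg : FellowTravels x H L g) :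
    FellowTravels (Sum.elim y x) ⊥ (reducedLanguage κ L) g := by
  obtain ⟨k, hk⟩ := hg
  obtain ⟨m, hm⟩ := exists_length_bound (x := x) hy k
  -- Each suffix of length at most `m` shifts its coset representative, which costs `2 * m` on
  -- either side.
  refine ⟨2 * m + k + 2 * m, ?_⟩
  rintro _ ⟨f, hf, w, hw, rfl⟩ _ ⟨f', hf', v, hv, rfl⟩ h hh e t
  obtain rfl := Subgroup.mem_bot.1 hh
  obtain ⟨p, s, s', rfl, rfl, hs⟩ := exists_common_prefix f f' hf hf'
  have e1 : wordVal x w * g = ((wordVal y s)⁻¹ * wordVal y s') * wordVal x v := by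
    simp only [wordVal_append, wordVal_leftWord, wordVal_rightWord, one_mul, mul_assoc] at e
    rw [mul_left_cancel_iff] at e
    rw [mul_assoc, ← e, inv_mul_cancel_left]
  have hH := H.mul_mem (H.inv_mem (wordVal_mem hy s)) (wordVal_mem hy s')
  have h1 := hk w hw v hv _ hH e1
  have h2 : s.length + s'.length ≤ m := by
    obtain ⟨q, hq, hqe⟩ := hm _ hH (by simpa [wordVal_nil] using h1 0)
    refine hs.trans (le_trans (le_of_eq_of_le (congrArg _ ?_) FreeGroup.norm_mk_le) hq)
    apply hinj
    rw [← wordVal_eq_lift, hqe, map_mul, map_inv, ← wordVal_eq_lift, ← wordVal_eq_lift,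
      wordVal_append, wordVal_append]
    group
  rw [leftWord_append, leftWord_append, List.append_assoc, List.append_assoc, mul_one]
  rcases le_total t (leftWord (ι := ι) p).length with h3 | h3
  · rw [List.take_append_of_le_length h3, List.take_append_of_le_length h3, inv_mul_cancel]
    exact LengthLE.one _ _
  · have h4 : ∀ l, (leftWord p ++ l).take t = leftWord p ++ l.take (t - (leftWord (ι := ι) p).length) :=
      fun l => by rw [List.take_append, List.take_of_length_le h3]
    rw [h4, h4, wordVal_append, wordVal_append, mul_inv_rev, mul_assoc, inv_mul_cancel_left]
    generalize t - _ = τ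
    have h4 := lengthLE_take_append (Sum.elim y x) (leftWord s) (rightWord w) τ
    have h5 := (lengthLE_take_append (Sum.elim y x) (leftWord s') (rightWord v) τ).inv
    have h6 := (h1 τ).sumElim (y := y)
    have h7 := (h4.mul h6).mul h5
    simp only [take_rightWord, wordVal_rightWord, wordVal_leftWord] at h7
    have h8 := h7.mono (l := 2 * m + k + 2 * m) (by simp [leftWord]; omega)
    simpa [mul_assoc] using h8

/-- A system of normal forms of the HNN extension along a free subgroup that has an efficient free
basis. -/
theorem normalFormSystem_of_efficient [Finite ι] [Finite κ] [DecidableEq κ]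
    (hinj : Function.Injective (FreeGroup.lift y)) (hy : (FreeGroup.lift y).range = H)
    (hnil : [] ∈ L) (hL : MeetsCosets x H L) (hF : ∀ g, FellowTravels x H L g)
    (hu : ∀ w ∈ L, ∀ v ∈ L, ∀ h ∈ H, wordVal x w = h * wordVal x v → w = v)
    (he : ∀ w ∈ L, ∀ v ∈ L, ∀ a, ∀ h ∈ H, wordVal x w * letterVal y a = h * wordVal x v →
      LengthLE y h 1) :
    NormalFormSystem (Sum.elim y x) H (reducedLanguage κ L) (rightLanguage κ L) where
  nil_mem := ⟨[], hnil, rfl⟩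
  unique := by
    rintro _ ⟨w, hw, rfl⟩ _ ⟨v, hv, rfl⟩ h hh e
    rw [wordVal_rightWord, wordVal_rightWord] at e
    rw [hu w hw v hv h hh e]
  meets g := by
    obtain ⟨w, hw, h, hh, e⟩ := hL g
    exact ⟨_, ⟨w, hw, rfl⟩, h, hh, by rw [wordVal_rightWord, e]⟩
  fellow g := by
    obtain ⟨k, hk⟩ := hF g
    refine ⟨k, ?_⟩
    rintro _ ⟨w, hw, rfl⟩ _ ⟨v, hv, rfl⟩ h hh e t
    rw [wordVal_rightWord, wordVal_rightWord] at e
    have := (hk w hw v hv h hh e t).sumElim (y := y)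
    rw [take_rightWord, take_rightWord, wordVal_rightWord, wordVal_rightWord]
    exact this
  finite g := by
    obtain ⟨k, hk⟩ := hF g
    obtain ⟨m, hm⟩ := exists_length_bound (x := x) hy k
    -- The ball contains the corrections for `g` by fellow travelling at time `0`, and those for its
    -- own elements by efficiency.
    refine ⟨{γ | LengthLE y γ m}, finite_setOf_lengthLE y m, ?_, ?_⟩
    · rintro _ ⟨p, -, rfl⟩
      exact wordVal_mem hy p
    · rintro γ hγ _ ⟨w, hw, rfl⟩ _ ⟨v, hv, rfl⟩ h hh e
      rw [wordVal_rightWord, wordVal_rightWord] at e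
      rcases hγ with rfl | ⟨p, hp, rfl⟩
      · exact hm h hh (by simpa [wordVal_nil] using hk w hw v hv h hh e 0)
      · exact (lengthLE_of_efficient hL he hu p w hw v hv h hh e).mono hp
  unique_base := by
    rintro _ ⟨f, hf, w, hw, rfl⟩ _ ⟨f', hf', v, hv, rfl⟩ e
    simp only [wordVal_append, wordVal_leftWord, wordVal_rightWord] at e
    obtain rfl := hu w hw v hv ((wordVal y f)⁻¹ * wordVal y f')
      (H.mul_mem (H.inv_mem (wordVal_mem hy f)) (wordVal_mem hy f'))
      (by rw [mul_assoc, ← e, inv_mul_cancel_left])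
    have h1 := mul_right_cancel e
    rw [wordVal_eq_lift, wordVal_eq_lift] at h1
    have h2 := congrArg FreeGroup.toWord (hinj h1)
    rw [FreeGroup.toWord_mk, FreeGroup.toWord_mk, hf.reduce_eq, hf'.reduce_eq] at h2
    rw [h2]
  surj_base g := by
    obtain ⟨w, hw, h, hh, rfl⟩ := hL g
    rw [← hy] at hh
    obtain ⟨f, rfl⟩ := hh
    refine ⟨_, ⟨f.toWord, FreeGroup.isReduced_toWord, w, hw, rfl⟩, ?_⟩
    rw [wordVal_append, wordVal_leftWord, wordVal_rightWord, wordVal_eq_lift,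
      FreeGroup.mk_toWord]
  fellow_base g := fellowTravels_reducedLanguage hinj hy (hF g)

/-! ### Regularity -/

lemma isRegular_rightLanguage [Finite ι] (hL : L.IsRegular) : (rightLanguage κ L).IsRegular := by
  have h := isRegular_image_flatMap (fun a : Letter ι => [Prod.map (Sum.inr : ι → κ ⊕ ι) id a]) hL
  refine Eq.subst (motive := Language.IsRegular) ?_ h
  ext W
  constructor
  · rintro ⟨w, hw, rfl⟩
    exact ⟨w, hw, by simp [rightWord, List.map_eq_flatMap]⟩
  · rintro ⟨w, hw, rfl⟩
    exact ⟨w, hw, by simp [rightWord, List.map_eq_flatMap]⟩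

open Classical in
/-- The automaton that reads a reduced word in the first alphabet, remembering the last letter, and
then runs `A`. -/
noncomputable def reducedDFA {Q : Type} (κ : Type) (A : DFA (Letter ι) Q) :
    DFA (Letter (κ ⊕ ι)) (Option (Option (Letter κ) ⊕ Q)) where
  step
    | some (.inl o), (.inl i, c) =>
      if ∀ a ∈ o, a.1 = i → a.2 = c then some (.inl (some (i, c))) else none
    | some (.inl _), (.inr i, c) => some (.inr (A.step A.start (i, c)))
    | some (.inr q), (.inr i, c) => some (.inr (A.step q (i, c)))
    | _, _ => none
  start := some (.inl none)
  accept := {t | ∃ s ∈ t, s.elim (fun _ => A.start) id ∈ A.accept}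

variable {Q : Type} {A : DFA (Letter ι) Q}

lemma reducedDFA_evalFrom_none (W : List (Letter (κ ⊕ ι))) :
    (reducedDFA κ A).evalFrom none W = none := by
  induction W with
  | nil => rfl
  | cons a W ih => exact ih

lemma reducedDFA_evalFrom_inr (W : List (Letter (κ ⊕ ι))) (q : Q) :
    (reducedDFA κ A).evalFrom (some (.inr q)) W ∈ (reducedDFA κ A).accept ↔
      ∃ w, A.evalFrom q w ∈ A.accept ∧ rightWord w = W := by
  induction W generalizing q with
  | nil =>
    constructor
    · rintro ⟨s, hs, h⟩
      obtain rfl := Option.some.inj hs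
      exact ⟨[], h, rfl⟩
    · rintro ⟨w, h, h'⟩
      obtain rfl : w = [] := by simpa [rightWord] using h'
      exact ⟨_, rfl, h⟩
  | cons a W ih =>
    obtain ⟨i | i, c⟩ := a
    · constructor
      · rintro ⟨s, hs, -⟩
        have h1 := (reducedDFA_evalFrom_none (A := A) W).symm.trans hs
        simp at h1
      · rintro ⟨_ | ⟨b, w⟩, -, h⟩ <;> simp [rightWord, Prod.ext_iff] at h
    · refine (ih (A.step q (i, c))).trans ?_
      constructor
      · rintro ⟨w, h, rfl⟩
        exact ⟨(i, c) :: w, h, rfl⟩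
      · rintro ⟨_ | ⟨⟨j, c'⟩, w⟩, h, h'⟩
        · simp [rightWord] at h'
        · simp only [rightWord, List.map_cons, List.cons.injEq, Prod.map_apply, Prod.mk.injEq,
            Sum.inr.injEq, id] at h'
          obtain ⟨⟨rfl, rfl⟩, rfl⟩ := h'
          exact ⟨w, h, rfl⟩

lemma reducedDFA_evalFrom_inl (W : List (Letter (κ ⊕ ι))) (o : Option (Letter κ)) :
    (reducedDFA κ A).evalFrom (some (.inl o)) W ∈ (reducedDFA κ A).accept ↔
      ∃ f, FreeGroup.IsReduced f ∧ (∀ a ∈ o, ∀ b ∈ f.head?, a.1 = b.1 → a.2 = b.2) ∧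
        ∃ w ∈ A.accepts, leftWord f ++ rightWord w = W := by
  induction W generalizing o with
  | nil =>
    constructor
    · rintro ⟨s, hs, h⟩
      obtain rfl := Option.some.inj hs
      exact ⟨[], List.isChain_nil, by simp, [], h, rfl⟩
    · rintro ⟨f, -, -, w, h, h'⟩
      obtain ⟨-, h2⟩ := List.append_eq_nil_iff.1 h'
      obtain rfl : w = [] := by simpa [rightWord] using h2
      exact ⟨_, rfl, h⟩
  | cons a W ih =>
    obtain ⟨i | i, c⟩ := a
    · by_cases ho : ∀ a ∈ o, a.1 = i → a.2 = c
      · have h1 : (reducedDFA κ A).step (some (.inl o)) (.inl i, c) =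
            some (.inl (some (i, c))) := by
          simp only [reducedDFA, if_pos ho]
        rw [DFA.evalFrom_cons, h1, ih]
        constructor
        · rintro ⟨f, hf, hfo, w, hw, rfl⟩
          refine ⟨(i, c) :: f, List.isChain_cons.2 ⟨fun b hb => hfo _ rfl b hb, hf⟩, ?_, w, hw, rfl⟩
          rintro a ha b hb
          obtain rfl : (i, c) = b := by simpa using hb
          exact ho a ha
        · rintro ⟨_ | ⟨⟨j, c'⟩, f⟩, hf, hfo, w, hw, h⟩
          · rcases w with _ | ⟨b, w⟩ <;> simp [leftWord, rightWord, Prod.ext_iff] at h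
          · simp only [leftWord, List.map_cons, List.cons_append, List.cons.injEq, Prod.map_apply,
              Prod.mk.injEq, Sum.inl.injEq, id] at h
            obtain ⟨⟨rfl, rfl⟩, rfl⟩ := h
            obtain ⟨h2, h3⟩ := List.isChain_cons.1 hf
            refine ⟨f, h3, ?_, w, hw, rfl⟩
            rintro a ha b hb
            obtain rfl : (j, c') = a := by simpa using ha
            exact h2 b hb
      · have h1 : (reducedDFA κ A).step (some (.inl o)) (.inl i, c) = none := by
          simp only [reducedDFA, if_neg ho]
        rw [DFA.evalFrom_cons, h1, reducedDFA_evalFrom_none]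
        constructor
        · rintro ⟨s, hs, -⟩
          simp at hs
        · rintro ⟨_ | ⟨⟨j, c'⟩, f⟩, hf, hfo, w, hw, h⟩
          · rcases w with _ | ⟨b, w⟩ <;> simp [leftWord, rightWord, Prod.ext_iff] at h
          · simp only [leftWord, List.map_cons, List.cons_append, List.cons.injEq, Prod.map_apply,
              Prod.mk.injEq, Sum.inl.injEq, id] at h
            obtain ⟨⟨rfl, rfl⟩, rfl⟩ := h
            exact absurd (fun a ha => hfo a ha _ rfl) ho
    · refine (reducedDFA_evalFrom_inr (κ := κ) W (A.step A.start (i, c))).trans ?_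
      constructor
      · rintro ⟨w, h, rfl⟩
        exact ⟨[], List.isChain_nil, by simp, (i, c) :: w, h, rfl⟩
      · rintro ⟨_ | ⟨b, f⟩, hf, hfo, w, hw, h⟩
        · rcases w with _ | ⟨⟨j, c'⟩, w⟩
          · simp [leftWord, rightWord] at h
          · simp only [leftWord, rightWord, List.map_nil, List.nil_append, List.map_cons,
              List.cons.injEq, Prod.map_apply, Prod.mk.injEq, Sum.inr.injEq, id] at h
            obtain ⟨⟨rfl, rfl⟩, rfl⟩ := h
            exact ⟨w, hw, rfl⟩
        · simp [leftWord, Prod.ext_iff] at h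

lemma isRegular_reducedLanguage [Finite κ] (hL : L.IsRegular) :
    (reducedLanguage κ L).IsRegular := by
  obtain ⟨Q, _, A, rfl⟩ := hL
  refine ⟨_, Fintype.ofFinite _, reducedDFA κ A, ?_⟩
  ext W
  refine (reducedDFA_evalFrom_inl W none).trans ?_
  constructor
  · rintro ⟨f, hf, -, h⟩
    exact ⟨f, hf, h⟩
  · rintro ⟨f, hf, h⟩
    exact ⟨f, hf, by simp, h⟩

end FreeSubgroup

end AutGroup

namespace AutGroup

/-! ### Changing the generating family -/

section Transport

variable {ι κ Γ Δ : Type} [Group Γ] [Group Δ]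

/-- The automaton that translates its input before it is read. -/
def AsyncDFA.comap {α β σ : Type} (f : α → β) (M : AsyncDFA β σ) : AsyncDFA α σ where
  side := M.side
  step s a := M.step s (a.map f)
  start := M.start
  accept := M.accept

lemma AsyncDFA.evalFrom_comap {α β σ : Type} (f : α → β) (M : AsyncDFA β σ) (s : σ)
    (p q : List (Option α)) :
    (M.comap f).evalFrom s p q = M.evalFrom s (p.map (Option.map f)) (q.map (Option.map f)) := by
  induction s, p, q using AsyncDFA.evalFrom.induct (M := M.comap f) with
  | case1 s => simp only [List.map_nil]; rw [evalFrom, evalFrom]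
  | case2 s c p ih => rw [evalFrom, ih, List.map_cons, List.map_nil, evalFrom]; rfl
  | case3 s d q ih => rw [evalFrom, ih, List.map_cons, List.map_nil, evalFrom]; rfl
  | case4 s c p d q h ih =>
    rw [evalFrom, h, ih, List.map_cons, List.map_cons, evalFrom,
      show M.side s = .left from h]
    rfl
  | case5 s c p d q h ih =>
    rw [evalFrom, h, ih, List.map_cons, List.map_cons, evalFrom,
      show M.side s = .right from h]
    rfl

lemma wordVal_map (e : Γ ≃* Δ) (σ : κ → ι) (x : ι → Γ) (w : List (Letter κ)) :
    wordVal (fun i => e (x (σ i))) w = e (wordVal x (w.map (Prod.map σ id))) := by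
  rw [wordVal, wordVal, List.map_map, map_list_prod, List.map_map]
  refine congrArg List.prod (List.map_congr_left fun a _ => ?_)
  obtain ⟨i, _ | _⟩ := a <;> simp [letterVal]

/-- Asynchronously automatic structures are transported along isomorphisms and reindexings. -/
theorem IsAsynchronouslyAutomaticWith.transport {x : ι → Γ} (h : IsAsynchronouslyAutomaticWith x)
    (e : Γ ≃* Δ) (σ : κ ≃ ι) : IsAsynchronouslyAutomaticWith fun i => e (x (σ i)) := by
  obtain ⟨L, ⟨Q, _, A, rfl⟩, hsurj, hM⟩ := h
  refine ⟨(A.comap (Prod.map σ id)).accepts, ⟨Q, inferInstance, _, rfl⟩, fun g => ?_, fun a => ?_⟩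
  · obtain ⟨w, hw, hg⟩ := hsurj (e.symm g)
    have h1 : (w.map (Prod.map σ.symm id)).map (Prod.map σ id) = w := by
      rw [List.map_map, Prod.map_comp_map]
      simp
    refine ⟨w.map (Prod.map σ.symm id), ?_, ?_⟩
    · rw [DFA.accepts_comap]
      change List.map _ _ ∈ A.accepts
      rwa [h1]
    · rw [wordVal_map, h1, hg, e.apply_symm_apply]
  · obtain ⟨S, _, M, hM⟩ := hM (a.map (Prod.map σ id))
    refine ⟨S, inferInstance, M.comap (Prod.map σ id), fun w y => ?_⟩
    have h1 : ∀ w : List (Letter κ), (tape w).map (Option.map (Prod.map σ id)) =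
        tape (w.map (Prod.map σ id)) := fun w => by
      simp [tape]
    have h2 : symbolVal (fun i => e (x (σ i))) a = e (symbolVal x (a.map (Prod.map σ id))) := by
      rcases a with _ | ⟨i, _ | _⟩ <;> simp [symbolVal, letterVal]
    have h3 : (M.comap (Prod.map σ id)).Accepts w y ↔
        M.Accepts (w.map (Prod.map σ id)) (y.map (Prod.map σ id)) := by
      rw [AsyncDFA.Accepts, AsyncDFA.evalFrom_comap, h1, h1]
      rfl
    rw [h3, hM, wordVal_map, wordVal_map, h2, ← map_mul, e.injective.eq_iff, DFA.accepts_comap]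
    rfl

lemma IsAsynchronouslyAutomaticWith.isAsynchronouslyAutomatic [Finite ι] {x : ι → Γ}
    (h : IsAsynchronouslyAutomaticWith x) (e : Γ ≃* Δ) : IsAsynchronouslyAutomatic Δ := by
  obtain ⟨n, ⟨σ⟩⟩ := Finite.exists_equiv_fin ι
  have h1 := h.transport e σ.symm
  refine ⟨n, _, ?_, h1⟩
  obtain ⟨L, -, hL, -⟩ := h1
  refine (Subgroup.eq_top_iff' _).2 fun g => ?_
  obtain ⟨w, -, rfl⟩ := hL g
  refine Subgroup.list_prod_mem _ fun g hg => ?_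
  obtain ⟨⟨i, _ | _⟩, -, rfl⟩ := List.mem_map.1 hg
  · exact Subgroup.inv_mem _ (Subgroup.subset_closure ⟨i, rfl⟩)
  · exact Subgroup.subset_closure ⟨i, rfl⟩

end Transport

end AutGroup

namespace Sapir

open AutGroup

/-! ### `K` is asynchronously automatic -/

lemma yFamily_mem (i : Fin 2) : yFamily i ∈ Y := by fin_cases i <;> simp [yFamily, Y]

lemma exists_yFamily_eq {h : G} (hh : h ∈ Y) : ∃ i, yFamily i = h := by
  rcases hh with rfl | rfl
  · exact ⟨0, rfl⟩
  · exact ⟨1, rfl⟩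

lemma nil_mem_cosetLanguage : [] ∈ cosetLanguage := ⟨[], trivial, rfl⟩

theorem isAsynchronouslyAutomatic : IsAsynchronouslyAutomatic K := by
  have D := normalFormSystem_of_efficient (y := yFamily) (x := gGen) freeHom_injective
    range_freeHom nil_mem_cosetLanguage meetsCosets fellowTravels
    (fun w hw v hv h hh e => cosetLanguage_unique hw hv hh e) (by
      rintro w hw v hv ⟨i, c⟩ h hh e
      have hc : letterVal yFamily (i, c) ∈ Y ∪ Y⁻¹ := by
        cases c
        · exact Or.inr (by simpa [letterVal] using yFamily_mem i)
        · exact Or.inl (yFamily_mem i)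
      rcases efficient hw hv hc hh e with rfl | h1 | h1
      · exact LengthLE.one _ _
      · obtain ⟨j, rfl⟩ := exists_yFamily_eq h1
        exact lengthLE_letterVal yFamily (j, true)
      · obtain ⟨j, hj⟩ := exists_yFamily_eq h1
        rw [← inv_inv h, ← hj]
        exact lengthLE_letterVal yFamily (j, false))
  exact (D.isAsynchronouslyAutomaticWith (isRegular_normalWords
    (isRegular_reducedLanguage isRegular_cosetLanguage)
    (isRegular_rightLanguage isRegular_cosetLanguage))).isAsynchronouslyAutomatic kEquiv.symm

end Sapir

theorem mainTheorem2 :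
    -- `K` is the HNN extension of `G` along `H` whose stable letter `z` centralises `H`,
    -- where `u = xa` and `v = bx`
    (∃ e : Sapir.K ≃* HNNExtension Sapir.G Sapir.H Sapir.H (MulEquiv.refl Sapir.H),
      e (Sapir.kGen .x * Sapir.kGen .a) = HNNExtension.of (Sapir.gGen .u) ∧
      e (Sapir.kGen .b * Sapir.kGen .x) = HNNExtension.of (Sapir.gGen .v) ∧
      e (Sapir.kGen .b) = HNNExtension.of (Sapir.gGen .b) ∧
      e (Sapir.kGen .r) = HNNExtension.of (Sapir.gGen .r) ∧
      e (Sapir.kGen .z) = HNNExtension.t) ∧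
    -- `H` is free of rank 2
    Nonempty (FreeGroup (Fin 2) ≃* Sapir.H) ∧
    -- there is a strong automatic coset system for `(G, H)` with respect to which `Y` is efficient
    (∃ L : Language (AutGroup.Letter Sapir.GGen),
      AutGroup.IsStrongAutomaticCosetSystem Sapir.gGen Sapir.H L ∧
      AutGroup.IsEfficient Sapir.gGen Sapir.H L Sapir.Y) ∧
    -- `K` is asynchronously automatic
    AutGroup.IsAsynchronouslyAutomatic Sapir.K := by
  refine ⟨⟨Sapir.kEquiv, ?_, ?_, Sapir.toExt_kGen .b, Sapir.toExt_kGen .r, Sapir.toExt_kGen .z⟩,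
    ⟨Sapir.freeEquiv⟩, ⟨Sapir.cosetLanguage, Sapir.isStrongAutomaticCosetSystem,
      Sapir.isEfficient⟩, Sapir.isAsynchronouslyAutomatic⟩
  · rw [Sapir.kEquiv_apply, map_mul, Sapir.toExt_kGen, Sapir.toExt_kGen, Sapir.extGen,
      Sapir.extGen, ← map_mul]
    exact congrArg _ (by group)
  · rw [Sapir.kEquiv_apply, map_mul, Sapir.toExt_kGen, Sapir.toExt_kGen, Sapir.extGen,
      Sapir.extGen, ← map_mul]
    exact congrArg _ (by group)
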